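/- Manifolds are smooth, finite-dimensional, of constant dimension, Hausdorff and second countable, without boundary; vector bundles are smooth, real and of finite rank. Let $\underline G=(G\rightrightarrows M)$ be a Lie groupoid (source $s$ and target $t$ surjective submersions; multiplication, units and inversion smooth). A \emph{VB-groupoid} over $\underline G$ is a Lie groupoid $\underline\Gamma=(\Gamma\rightrightarrows E)$ with a Lie groupoid morphism $\underline\Gamma\to\underline G$ such that $\Gamma\to G$ and $E\to M$ are vector bundles and all structure maps of $\underline\Gamma$ are linear. A \emph{VB-map} over $\underline G$ is a Lie groupoid morphism $\underline\Gamma\to\underline\Gamma'$ that covers the identity of $\underline G$ and is fibrewise linear. They form a category $VB(\underline G)$. For vector bundles $A,B\to M$ let $C^p(\underline G,A\to B)$ be the set of families of linear maps $\omega_{g_1,\dots,g_p}:A_{s(g_p)}\to B_{t(g_1)}$ depending smoothly on the string $(g_1,\dots,g_p)$ of composable arrows. A (unital) \emph{2-term representation up to homotopy} (ruth) $\mathcal E=E\oplus C[1]$ of $\underline G$ consists of vector bundles $E,C\to M$, a vector bundle map $\partial:C\to E$, elements $\rho^E\in C^1(\underline G,E\to E)$ and $\rho^C\in C^1(\underline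 G,C\to C)$ with $\rho^E_{\rm id}={\rm id}$, $\rho^C_{\rm id}={\rm id}$, and $\gamma\in C^2(\underline G,E\to C)$ with $\gamma_{g,h}=0$ whenever $g$ or $h$ is a unit, such that for all composable arrows $$\rho^E_{g_1}\partial-\partial\rho^C_{g_1}=0,\quad \rho^C_{g_1}\rho^C_{g_2}-\rho^C_{g_1g_2}+\gamma_{g_1,g_2}\partial=0,\quad \rho^E_{g_1}\rho^E_{g_2}-\rho^E_{g_1g_2}+\partial\gamma_{g_1,g_2}=0,$$ $$\rho^C_{g_1}\gamma_{g_2,g_3}-\gamma_{g_1g_2,g_3}+\gamma_{g_1,g_2g_3}-\gamma_{g_1,g_2}\rho^E_{g_3}=0.$$ A \emph{morphism} $\mathcal E\to\mathcal E'$ is a triple $(\Phi_E,\Phi_C,\mu)$ of vector bundle maps $\Phi_E:E\to E'$, $\Phi_C:C\to C'$ and $\mu\in C^1(\underline G,E\to C')$ with $$\partial'\Phi_C-\Phi_E\partial=0,\quad \rho^{E'}_g\Phi_E+\partial'\mu_g-\Phi_E\rho^E_g=0,\quad \Phi_C\rho^C_g-\mu_g\partial-\rho^{C'}_g\Phi_C=0,$$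 $$\Phi_C\gamma_{g,h}+\mu_g\rho^E_h+\rho^{C'}_g\mu_h-\mu_{gh}-\gamma'_{g,h}\Phi_E=0.$$ The composite of $(\Phi_E,\Phi_C,\mu)$ followed by $(\Phi'_E,\Phi'_C,\mu')$ is $(\Phi'_E\Phi_E,\Phi'_C\Phi_C,\Phi'_C\mu+\mu'\Phi_E)$, the identity is $({\rm id},{\rm id},0)$, and the category obtained is $Rep^\infty_{\text{2-term}}(\underline G)$. The \emph{Grothendieck construction} of a 2-term ruth is $t^*C\oplus s^*E\rightrightarrows E$ with the structure maps $$\tilde s(c,g,e)=e,\qquad \tilde t(c,g,e)=\partial c+\rho^E_g e,\qquad \tilde u_e=(0,u(x),e)\ (e\in E_x),$$ $$(c_1,g_1,e_1)\cdot(c_2,g_2,e_2)=(c_1+\rho^C_{g_1}c_2-\gamma_{g_1,g_2}e_2,\;g_1g_2,\;e_2),$$ $$(c,g,e)^{-1}=(-\rho^C_{g^{-1}}c+\gamma_{g^{-1},g}e,\;g^{-1},\;\partial c+\rho^E_g e).$$ \textbf{Theorem.} The Grothendieck construction of every 2-term ruth of $\underline G$ is a VB-groupoid over $\underline G$. The assignment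 $(\Phi_E,\Phi_C,\mu)\mapsto\Phi$, $$\Phi(c,g,e)=(\Phi_C(c)+\mu_g(e),\,g,\,\Phi_E(e)),\qquad \Phi|_E=\Phi_E,$$ makes it a functor $Rep^\infty_{\text{2-term}}(\underline G)\to VB(\underline G)$, and this functor is an equivalence of categories. Moreover, morphisms correspond exactly: families of linear maps $(\Phi_{E,x})_x$, $(\Phi_{C,x})_x$, $(\mu_g)_g$ form a morphism of ruths if and only if $\Phi$ is a VB-map over $\underline G$, and every VB-map over $\underline G$ between Grothendieck constructions comes from exactly one morphism of ruths. -/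

import Mathlib

open CategoryTheory Bundle
open scoped Manifold ContDiff Topology

universe u

namespace LieGpd

noncomputable section

/-! ### Smoothness on submanifolds, submersions -/

/-- Smoothness of a map `f` defined on a subset of a manifold `X`. The subset is parametrised by an
injection `ι : P → X`; near each point, `f` is the restriction of a map on `X` that is smooth along
the subset `Set.range ι`. It is only used when `Set.range ι` is an embedded submanifold (a fibre
product over a submersion), where it is ordinary smoothness on that submanifold. -/
def SmoothAlong {EX HX EY HY X Y P : Type*}
    [NormedAddCommGroup EX] [NormedSpace ℝ EX] [TopologicalSpace HX]
    [NormedAddCommGroup EY] [NormedSpace ℝ EY] [TopologicalSpace HY]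
    [TopologicalSpace X] [ChartedSpace HX X] [TopologicalSpace Y] [ChartedSpace HY Y]
    (I : ModelWithCorners ℝ EX HX) (J : ModelWithCorners ℝ EY HY)
    (ι : P → X) (f : P → Y) : Prop :=
  ∀ p : P, ∃ F : X → Y, (∀ q : P, F (ι q) = f q) ∧
    ContMDiffWithinAt I J ∞ F (Set.range ι) (ι p)

/-- Surjective submersions between (finite-dimensional) manifolds. -/
structure IsSurjectiveSubmersion {EX HX EY HY X Y : Type*}
    [NormedAddCommGroup EX] [NormedSpace ℝ EX] [TopologicalSpace HX]
    [NormedAddCommGroup EY] [NormedSpace ℝ EY] [TopologicalSpace HY]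
    [TopologicalSpace X] [ChartedSpace HX X] [TopologicalSpace Y] [ChartedSpace HY Y]
    (I : ModelWithCorners ℝ EX HX) (J : ModelWithCorners ℝ EY HY) (f : X → Y) : Prop where
  smooth : ContMDiff I J ∞ f
  surjective : Function.Surjective f
  surjective_mfderiv : ∀ x : X, Function.Surjective (mfderiv I J f x)

/-! ### Lie groupoids -/

/-- The set of all arrows of a (small) category. -/
structure Arrows (M : Type u) [Category.{u} M] : Type u where
  {src : M}
  {tgt : M}
  hom : src ⟶ tgt

/-- Pairs of composable arrows `z ←h y ←g x`. -/
structure ComposablePair (M : Type u) [Category.{u} M] : Type u where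
  {x : M}
  {y : M}
  {z : M}
  h : y ⟶ z
  g : x ⟶ y

/-- A Lie groupoid `G ⇉ M`: a groupoid whose sets of objects `M` and of arrows `G` are smooth
manifolds (Hausdorff, second countable, without boundary), with source and target surjective
submersions, and with smooth multiplication `G ×_M G → G`, unit and inversion.
The product `h g` of `z ←h y ←g x` is written `g ≫ h`. -/
structure LieGroupoid : Type (u + 1) where
  Obj : Type u
  dimObj : ℕ
  dimArr : ℕ
  [topObj : TopologicalSpace Obj]
  [chartedObj : ChartedSpace (EuclideanSpace ℝ (Fin dimObj)) Obj]
  [manifoldObj : IsManifold (𝓡 dimObj) ∞ Obj]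
  [t2Obj : T2Space Obj]
  [secondCountableObj : SecondCountableTopology Obj]
  [groupoid : Groupoid.{u} Obj]
  [topArr : TopologicalSpace (Arrows Obj)]
  [chartedArr : ChartedSpace (EuclideanSpace ℝ (Fin dimArr)) (Arrows Obj)]
  [manifoldArr : IsManifold (𝓡 dimArr) ∞ (Arrows Obj)]
  [t2Arr : T2Space (Arrows Obj)]
  [secondCountableArr : SecondCountableTopology (Arrows Obj)]
  submersion_src : IsSurjectiveSubmersion (𝓡 dimArr) (𝓡 dimObj) (fun a : Arrows Obj => a.src)
  submersion_tgt : IsSurjectiveSubmersion (𝓡 dimArr) (𝓡 dimObj) (fun a : Arrows Obj => a.tgt)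
  smooth_one : ContMDiff (𝓡 dimObj) (𝓡 dimArr) ∞ (fun x : Obj => (⟨𝟙 x⟩ : Arrows Obj))
  smooth_inv : ContMDiff (𝓡 dimArr) (𝓡 dimArr) ∞
    (fun a : Arrows Obj => (⟨Groupoid.inv a.hom⟩ : Arrows Obj))
  smooth_mul : SmoothAlong ((𝓡 dimArr).prod (𝓡 dimArr)) (𝓡 dimArr)
    (fun p : ComposablePair Obj => ((⟨p.h⟩, ⟨p.g⟩) : Arrows Obj × Arrows Obj))
    (fun p : ComposablePair Obj => (⟨p.g ≫ p.h⟩ : Arrows Obj))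

attribute [instance] LieGroupoid.topObj LieGroupoid.chartedObj LieGroupoid.manifoldObj
  LieGroupoid.t2Obj LieGroupoid.secondCountableObj LieGroupoid.groupoid LieGroupoid.topArr
  LieGroupoid.chartedArr LieGroupoid.manifoldArr LieGroupoid.t2Arr LieGroupoid.secondCountableArr

/-- The manifold of arrows. -/
abbrev LieGroupoid.Arr (G : LieGroupoid.{u}) : Type u := Arrows G.Obj

/-- The source, as a smooth map. -/
def LieGroupoid.srcMap (G : LieGroupoid.{u}) :
    ContMDiffMap (𝓡 G.dimArr) (𝓡 G.dimObj) G.Arr G.Obj ∞ :=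
  ⟨fun a => a.src, G.submersion_src.smooth⟩

/-- The target, as a smooth map. -/
def LieGroupoid.tgtMap (G : LieGroupoid.{u}) :
    ContMDiffMap (𝓡 G.dimArr) (𝓡 G.dimObj) G.Arr G.Obj ∞ :=
  ⟨fun a => a.tgt, G.submersion_tgt.smooth⟩

/-! ### Smooth vector bundles -/

/-- A smooth real vector bundle of finite rank over the manifold `B`. -/
structure SmoothVB {EB HB : Type} [NormedAddCommGroup EB] [NormedSpace ℝ EB]
    [TopologicalSpace HB] (I : ModelWithCorners ℝ EB HB)
    (B : Type u) [TopologicalSpace B] [ChartedSpace HB B] : Type (u + 1) where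
  /-- the model fibre -/
  F : Type u
  /-- the fibres -/
  Fib : B → Type u
  [normF : NormedAddCommGroup F]
  [spaceF : NormedSpace ℝ F]
  [finF : FiniteDimensional ℝ F]
  [addFib : ∀ x, AddCommGroup (Fib x)]
  [modFib : ∀ x, Module ℝ (Fib x)]
  [topFib : ∀ x, TopologicalSpace (Fib x)]
  [topTot : TopologicalSpace (TotalSpace F Fib)]
  [fiberBundle : FiberBundle F Fib]
  [vectorBundle : VectorBundle ℝ F Fib]
  [smoothBundle : ContMDiffVectorBundle ∞ F Fib I]

attribute [instance] SmoothVB.normF SmoothVB.spaceF SmoothVB.finF SmoothVB.addFib SmoothVB.modFib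
  SmoothVB.topFib SmoothVB.topTot SmoothVB.fiberBundle SmoothVB.vectorBundle SmoothVB.smoothBundle

namespace SmoothVB

variable {EB HB : Type} [NormedAddCommGroup EB] [NormedSpace ℝ EB]
  [TopologicalSpace HB] {I : ModelWithCorners ℝ EB HB}
  {B : Type u} [TopologicalSpace B] [ChartedSpace HB B]
  {EB' HB' : Type} [NormedAddCommGroup EB'] [NormedSpace ℝ EB']
  [TopologicalSpace HB'] {I' : ModelWithCorners ℝ EB' HB'}
  {B' : Type u} [TopologicalSpace B'] [ChartedSpace HB' B']

/-- The total space. -/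
abbrev Tot (V : SmoothVB I B) : Type u := TotalSpace V.F V.Fib

/-- The point `v` of the total space, over the point `x`. -/
abbrev pt (V : SmoothVB I B) (x : B) (v : V.Fib x) : V.Tot := ⟨x, v⟩

/-- The model with corners of the total space. -/
abbrev model (V : SmoothVB I B) : ModelWithCorners ℝ (EB × V.F) (ModelProd HB V.F) :=
  I.prod 𝓘(ℝ, V.F)

/-- The pullback bundle `f^* V`. -/
def pullback (f : ContMDiffMap I' I B' B ∞) (V : SmoothVB I B) : SmoothVB I' B' where
  F := V.F
  Fib := (f : B' → B) *ᵖ V.Fib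
  addFib := fun b => inferInstanceAs (AddCommGroup (V.Fib (f b)))
  modFib := fun b => inferInstanceAs (Module ℝ (V.Fib (f b)))
  fiberBundle := inferInstanceAs (FiberBundle V.F ((f : B' → B) *ᵖ V.Fib))
  vectorBundle := inferInstanceAs (VectorBundle ℝ V.F ((f : B' → B) *ᵖ V.Fib))
  smoothBundle := inferInstanceAs (ContMDiffVectorBundle ∞ V.F ((f : B' → B) *ᵖ V.Fib) I')

/-- The direct sum bundle `V ⊕ W`. -/
def sum (V W : SmoothVB I B) : SmoothVB I B where
  F := V.F × W.F
  Fib := V.Fib ×ᵇ W.Fib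
  addFib := fun b => inferInstanceAs (AddCommGroup (V.Fib b × W.Fib b))
  modFib := fun b => inferInstanceAs (Module ℝ (V.Fib b × W.Fib b))
  fiberBundle := inferInstanceAs (FiberBundle (V.F × W.F) (V.Fib ×ᵇ W.Fib))
  vectorBundle := inferInstanceAs (VectorBundle ℝ (V.F × W.F) (V.Fib ×ᵇ W.Fib))
  smoothBundle := inferInstanceAs
    (ContMDiffVectorBundle ∞ (V.F × W.F) (V.Fib ×ᵇ W.Fib) I)

/-- Smoothness of a family of fibrewise linear maps, as a map of total spaces. -/
def IsSmoothHom (V W : SmoothVB I B) (φ : ∀ x, V.Fib x →ₗ[ℝ] W.Fib x) : Prop :=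
  ContMDiff V.model W.model ∞ (fun v : V.Tot => W.pt v.proj (φ v.proj v.snd))

end SmoothVB

/-! ### Transformations -/

namespace LieGroupoid

variable (G : LieGroupoid.{u})

/-- Vector bundles over the manifold of objects. -/
abbrev ObjVB : Type (u + 1) := SmoothVB (𝓡 G.dimObj) G.Obj

/-- Vector bundles over the manifold of arrows. -/
abbrev ArrVB : Type (u + 1) := SmoothVB (𝓡 G.dimArr) G.Arr

variable {G}

/-- The elements of `C¹(G, V → W)`: a family of linear maps `τ_g : V_x → W_y`, for `y ←g x`, is
smooth if it is smooth as a map `G ×_M V → W`. -/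
def IsSmooth₁ (V W : G.ObjVB)
    (τ : ∀ {x y : G.Obj}, (x ⟶ y) → (V.Fib x →ₗ[ℝ] W.Fib y)) : Prop :=
  SmoothAlong ((𝓡 G.dimArr).prod V.model) W.model
    (fun p : (Σ a : G.Arr, V.Fib a.src) => (p.1, V.pt p.1.src p.2))
    (fun p : (Σ a : G.Arr, V.Fib a.src) => W.pt p.1.tgt (τ p.1.hom p.2))

/-- The elements of `C²(G, V → W)`: a family of linear maps `τ_{h,g} : V_x → W_z`, for
`z ←h y ←g x`, is smooth if it is smooth as a map `G ×_M G ×_M V → W`. -/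
def IsSmooth₂ (V W : G.ObjVB)
    (τ : ∀ {x y z : G.Obj}, (y ⟶ z) → (x ⟶ y) → (V.Fib x →ₗ[ℝ] W.Fib z)) : Prop :=
  SmoothAlong ((𝓡 G.dimArr).prod ((𝓡 G.dimArr).prod V.model)) W.model
    (fun p : (Σ c : ComposablePair G.Obj, V.Fib c.x) =>
      ((⟨p.1.h⟩, ⟨p.1.g⟩, V.pt p.1.x p.2) : G.Arr × G.Arr × V.Tot))
    (fun p : (Σ c : ComposablePair G.Obj, V.Fib c.x) => W.pt p.1.z (τ p.1.h p.1.g p.2))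

end LieGroupoid

/-! ### 2-term representations up to homotopy -/

/-- A (unital) 2-term representation up to homotopy of `G` on `E ⊕ C[1]`. -/
structure Ruth (G : LieGroupoid.{u}) : Type (u + 1) where
  E : G.ObjVB
  C : G.ObjVB
  /-- the differential `∂ : C → E` -/
  d : ∀ x, C.Fib x →ₗ[ℝ] E.Fib x
  /-- the pseudo-representation on `E` -/
  rhoE : ∀ {x y : G.Obj}, (x ⟶ y) → (E.Fib x →ₗ[ℝ] E.Fib y)
  /-- the pseudo-representation on `C` -/
  rhoC : ∀ {x y : G.Obj}, (x ⟶ y) → (C.Fib x →ₗ[ℝ] C.Fib y)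
  /-- the curvature tensor -/
  gamma : ∀ {x y z : G.Obj}, (y ⟶ z) → (x ⟶ y) → (E.Fib x →ₗ[ℝ] C.Fib z)
  smooth_d : C.IsSmoothHom E d
  smooth_rhoE : LieGroupoid.IsSmooth₁ E E rhoE
  smooth_rhoC : LieGroupoid.IsSmooth₁ C C rhoC
  smooth_gamma : LieGroupoid.IsSmooth₂ E C gamma
  rhoE_one : ∀ (x : G.Obj) (e : E.Fib x), rhoE (𝟙 x) e = e
  rhoC_one : ∀ (x : G.Obj) (c : C.Fib x), rhoC (𝟙 x) c = c
  gamma_one_left : ∀ {x y : G.Obj} (g : x ⟶ y) (e : E.Fib x), gamma (𝟙 y) g e = 0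
  gamma_one_right : ∀ {x y : G.Obj} (g : x ⟶ y) (e : E.Fib x), gamma g (𝟙 x) e = 0
  rhoE_d : ∀ {x y : G.Obj} (g : x ⟶ y) (c : C.Fib x), rhoE g (d x c) - d y (rhoC g c) = 0
  rhoC_rhoC : ∀ {x y z : G.Obj} (g₁ : y ⟶ z) (g₂ : x ⟶ y) (c : C.Fib x),
    rhoC g₁ (rhoC g₂ c) - rhoC (g₂ ≫ g₁) c + gamma g₁ g₂ (d x c) = 0
  rhoE_rhoE : ∀ {x y z : G.Obj} (g₁ : y ⟶ z) (g₂ : x ⟶ y) (e : E.Fib x),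
    rhoE g₁ (rhoE g₂ e) - rhoE (g₂ ≫ g₁) e + d z (gamma g₁ g₂ e) = 0
  gamma_cocycle : ∀ {w x y z : G.Obj} (g₁ : y ⟶ z) (g₂ : x ⟶ y) (g₃ : w ⟶ x) (e : E.Fib w),
    rhoC g₁ (gamma g₂ g₃ e) - gamma (g₂ ≫ g₁) g₃ e + gamma g₁ (g₃ ≫ g₂) e
      - gamma g₁ g₂ (rhoE g₃ e) = 0

/-- A triple of families of linear maps `Φ_E : E → E'`, `Φ_C : C → C'`, and `μ_g : E_x → C'_y` for
`y ←g x`. -/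
@[ext]
structure RuthTriple {G : LieGroupoid.{u}} (R R' : Ruth G) : Type u where
  PhiE : ∀ x, R.E.Fib x →ₗ[ℝ] R'.E.Fib x
  PhiC : ∀ x, R.C.Fib x →ₗ[ℝ] R'.C.Fib x
  mu : ∀ {x y : G.Obj}, (x ⟶ y) → (R.E.Fib x →ₗ[ℝ] R'.C.Fib y)

/-- The triple `(Φ_E, Φ_C, μ)` is a morphism of 2-term representations up to homotopy. -/
structure RuthTriple.IsMorphism {G : LieGroupoid.{u}} {R R' : Ruth G}
    (T : RuthTriple R R') : Prop where
  smooth_PhiE : R.E.IsSmoothHom R'.E T.PhiE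
  smooth_PhiC : R.C.IsSmoothHom R'.C T.PhiC
  smooth_mu : LieGroupoid.IsSmooth₁ R.E R'.C T.mu
  comm_d : ∀ (x : G.Obj) (c : R.C.Fib x), R'.d x (T.PhiC x c) - T.PhiE x (R.d x c) = 0
  comm_rhoE : ∀ {x y : G.Obj} (g : x ⟶ y) (e : R.E.Fib x),
    R'.rhoE g (T.PhiE x e) + R'.d y (T.mu g e) - T.PhiE y (R.rhoE g e) = 0
  comm_rhoC : ∀ {x y : G.Obj} (g : x ⟶ y) (c : R.C.Fib x),
    T.PhiC y (R.rhoC g c) - T.mu g (R.d x c) - R'.rhoC g (T.PhiC x c) = 0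
  comm_gamma : ∀ {x y z : G.Obj} (g : y ⟶ z) (h : x ⟶ y) (e : R.E.Fib x),
    T.PhiC z (R.gamma g h e) + T.mu g (R.rhoE h e) + R'.rhoC g (T.mu h e) - T.mu (h ≫ g) e
      - R'.gamma g h (T.PhiE x e) = 0

/-- Morphisms of 2-term representations up to homotopy. -/
@[ext]
structure RuthHom {G : LieGroupoid.{u}} (R R' : Ruth G) : Type u extends RuthTriple R R' where
  isMorphism : toRuthTriple.IsMorphism

/-- The identity triple `(id, id, 0)`. -/
def RuthTriple.id {G : LieGroupoid.{u}} (R : Ruth G) : RuthTriple R R where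
  PhiE := fun _ => LinearMap.id
  PhiC := fun _ => LinearMap.id
  mu := fun _ => 0

/-- The composite triple `(Φ'_E Φ_E, Φ'_C Φ_C, Φ'_C μ + μ' Φ_E)`. -/
def RuthTriple.comp {G : LieGroupoid.{u}} {R R' R'' : Ruth G}
    (T : RuthTriple R R') (T' : RuthTriple R' R'') : RuthTriple R R'' where
  PhiE := fun x => T'.PhiE x ∘ₗ T.PhiE x
  PhiC := fun x => T'.PhiC x ∘ₗ T.PhiC x
  mu := fun {x y} g => T'.PhiC y ∘ₗ T.mu g + T'.mu g ∘ₗ T.PhiE x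

theorem LieGroupoid.isSmooth₁_zero {G : LieGroupoid.{u}} (V W : G.ObjVB) :
    LieGroupoid.IsSmooth₁ V W (fun {_ _} _ => 0) := by
  intro p
  refine ⟨fun q => W.pt q.1.tgt 0, fun q => rfl, ContMDiffAt.contMDiffWithinAt ?_⟩
  have h1 : ContMDiff ((𝓡 G.dimArr).prod V.model) (𝓡 G.dimObj) ∞
      (fun q : G.Arr × V.Tot => q.1.tgt) := G.submersion_tgt.smooth.comp contMDiff_fst
  exact ((contMDiff_zeroSection ℝ W.Fib).comp h1).contMDiffAt

open Classical in
/-- Addition of two points of the total space lying over the same base point. -/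
def SmoothVB.addTot {EB HB : Type} [NormedAddCommGroup EB] [NormedSpace ℝ EB]
    [TopologicalSpace HB] {I : ModelWithCorners ℝ EB HB}
    {B : Type u} [TopologicalSpace B] [ChartedSpace HB B] (V : SmoothVB I B)
    (a b : V.Tot) : V.Tot :=
  if h : b.proj = a.proj then V.pt a.proj (a.snd + h ▸ b.snd) else a

theorem SmoothVB.addTot_pt {EB HB : Type} [NormedAddCommGroup EB] [NormedSpace ℝ EB]
    [TopologicalSpace HB] {I : ModelWithCorners ℝ EB HB}
    {B : Type u} [TopologicalSpace B] [ChartedSpace HB B] (V : SmoothVB I B)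
    (x : B) (v w : V.Fib x) : V.addTot (V.pt x v) (V.pt x w) = V.pt x (v + w) := by
  simp [SmoothVB.addTot]

theorem LieGroupoid.isSmooth₁_add {G : LieGroupoid.{u}} {V W : G.ObjVB}
    {τ τ' : ∀ {x y : G.Obj}, (x ⟶ y) → (V.Fib x →ₗ[ℝ] W.Fib y)}
    (h : LieGroupoid.IsSmooth₁ V W τ) (h' : LieGroupoid.IsSmooth₁ V W τ') :
    LieGroupoid.IsSmooth₁ V W (fun {_ _} g => τ g + τ' g) := by
  intro p
  obtain ⟨F, hF, sF⟩ := h p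
  obtain ⟨F', hF', sF'⟩ := h' p
  beta_reduce at hF hF' sF sF'
  have key : ∀ q : (Σ a : G.Arr, V.Fib a.src), W.addTot (F (q.1, V.pt q.1.src q.2)) (F' (q.1, V.pt q.1.src q.2))
      = W.pt q.1.tgt ((τ q.1.hom + τ' q.1.hom) q.2) := by
    intro q
    rw [hF q, hF' q, SmoothVB.addTot_pt]
    rfl
  refine ⟨fun x => W.addTot (F x) (F' x), key, ?_⟩
  beta_reduce
  rw [contMDiffWithinAt_totalSpace] at sF sF' ⊢
  have hb : ∀ q : (Σ a : G.Arr, V.Fib a.src), (W.addTot (F (q.1, V.pt q.1.src q.2)) (F' (q.1, V.pt q.1.src q.2))).proj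
      = (F (q.1, V.pt q.1.src q.2)).proj := by
    intro q; rw [key, hF]
  refine ⟨sF.1.congr ?_ (hb p), ?_⟩
  · rintro _ ⟨q, rfl⟩
    exact hb q
  · have hp : (F (p.1, V.pt p.1.src p.2)).proj = p.1.tgt := by rw [hF]
    have hp' : (F' (p.1, V.pt p.1.src p.2)).proj = p.1.tgt := by rw [hF']
    have hev : ∀ᶠ x in 𝓝[Set.range (fun p : (Σ a : G.Arr, V.Fib a.src) =>
        (p.1, V.pt p.1.src p.2))] (p.1, V.pt p.1.src p.2),
        (F x).proj ∈ (trivializationAt W.F W.Fib p.1.tgt).baseSet := by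
      apply sF.1.continuousWithinAt.eventually_mem
      beta_reduce
      rw [hp]
      exact (trivializationAt W.F W.Fib p.1.tgt).open_baseSet.mem_nhds
        (mem_baseSet_trivializationAt W.F W.Fib _)
    have hadd : ∀ q : (Σ a : G.Arr, V.Fib a.src),
        (F (q.1, V.pt q.1.src q.2)).proj ∈ (trivializationAt W.F W.Fib p.1.tgt).baseSet →
        (trivializationAt W.F W.Fib p.1.tgt
          (W.addTot (F (q.1, V.pt q.1.src q.2)) (F' (q.1, V.pt q.1.src q.2)))).2
        = (trivializationAt W.F W.Fib p.1.tgt (F (q.1, V.pt q.1.src q.2))).2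
          + (trivializationAt W.F W.Fib p.1.tgt (F' (q.1, V.pt q.1.src q.2))).2 := by
      intro q hq
      rw [key, hF, hF']
      rw [hF] at hq
      exact ((trivializationAt W.F W.Fib p.1.tgt).linear ℝ hq).map_add _ _
    have hs := sF.2
    have hs' := sF'.2
    rw [hp] at hs
    rw [hp'] at hs'
    rw [hb p, hp]
    refine (hs.add hs').congr_of_eventuallyEq ?_ (hadd p ?_)
    · filter_upwards [hev, self_mem_nhdsWithin] with x hx hx'
      obtain ⟨q, rfl⟩ := hx'
      exact hadd q hx
    · rw [hp]; exact mem_baseSet_trivializationAt W.F W.Fib _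

theorem LieGroupoid.isSmooth₁_postcomp {G : LieGroupoid.{u}} {V W W' : G.ObjVB}
    {τ : ∀ {x y : G.Obj}, (x ⟶ y) → (V.Fib x →ₗ[ℝ] W.Fib y)}
    {φ : ∀ x, W.Fib x →ₗ[ℝ] W'.Fib x}
    (h : LieGroupoid.IsSmooth₁ V W τ) (hφ : W.IsSmoothHom W' φ) :
    LieGroupoid.IsSmooth₁ V W' (fun {_ y} g => φ y ∘ₗ τ g) := by
  intro p
  obtain ⟨F, hF, sF⟩ := h p
  refine ⟨fun x => W'.pt (F x).proj (φ _ (F x).snd), fun q => ?_, ?_⟩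
  · beta_reduce
    rw [hF]
    rfl
  · exact (hφ.contMDiffAt (x := F _)).comp_contMDiffWithinAt _ sF

theorem LieGroupoid.isSmooth₁_precomp {G : LieGroupoid.{u}} {V V' W : G.ObjVB}
    {τ : ∀ {x y : G.Obj}, (x ⟶ y) → (V'.Fib x →ₗ[ℝ] W.Fib y)}
    {φ : ∀ x, V.Fib x →ₗ[ℝ] V'.Fib x}
    (h : LieGroupoid.IsSmooth₁ V' W τ) (hφ : V.IsSmoothHom V' φ) :
    LieGroupoid.IsSmooth₁ V W (fun {x _} g => τ g ∘ₗ φ x) := by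
  intro p
  obtain ⟨F, hF, sF⟩ := h ⟨p.1, φ _ p.2⟩
  refine ⟨fun x => F (x.1, V'.pt x.2.proj (φ _ x.2.snd)), fun q => hF ⟨q.1, φ _ q.2⟩, ?_⟩
  have h1 : ContMDiff ((𝓡 G.dimArr).prod V.model) ((𝓡 G.dimArr).prod V'.model) ∞
      (fun x : G.Arr × V.Tot => (x.1, V'.pt x.2.proj (φ _ x.2.snd))) :=
    contMDiff_fst.prodMk (hφ.comp contMDiff_snd)
  refine ContMDiffWithinAt.comp (t := Set.range _) (p.1, V.pt p.1.src p.2) sF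
    h1.contMDiffAt.contMDiffWithinAt ?_
  rintro _ ⟨q, rfl⟩
  exact ⟨⟨q.1, φ _ q.2⟩, rfl⟩

theorem RuthTriple.isMorphism_id {G : LieGroupoid.{u}} (R : Ruth G) :
    (RuthTriple.id R).IsMorphism where
  smooth_PhiE := contMDiff_id
  smooth_PhiC := contMDiff_id
  smooth_mu := LieGroupoid.isSmooth₁_zero _ _
  comm_d := by intros; simp [RuthTriple.id]
  comm_rhoE := by intros; simp [RuthTriple.id]
  comm_rhoC := by intros; simp [RuthTriple.id]
  comm_gamma := by intros; simp [RuthTriple.id]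

theorem RuthTriple.isMorphism_comp {G : LieGroupoid.{u}} {R R' R'' : Ruth G}
    {T : RuthTriple R R'} {T' : RuthTriple R' R''}
    (h : T.IsMorphism) (h' : T'.IsMorphism) : (T.comp T').IsMorphism where
  smooth_PhiE := ContMDiff.comp h'.smooth_PhiE h.smooth_PhiE
  smooth_PhiC := ContMDiff.comp h'.smooth_PhiC h.smooth_PhiC
  smooth_mu := LieGroupoid.isSmooth₁_add
    (LieGroupoid.isSmooth₁_postcomp h.smooth_mu h'.smooth_PhiC)
    (LieGroupoid.isSmooth₁_precomp h'.smooth_mu h.smooth_PhiE)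
  comm_d := by
    intro x c
    have h1 := sub_eq_zero.mp (h.comm_d x c)
    have h2 := sub_eq_zero.mp (h'.comm_d x (T.PhiC x c))
    simp [RuthTriple.comp, h1, h2]
  comm_rhoE := by
    intro x y g e
    have h1 := congrArg (T'.PhiE y) (h.comm_rhoE g e)
    have h2 := h'.comm_rhoE g (T.PhiE x e)
    have h3 := sub_eq_zero.mp (h'.comm_d y (T.mu g e))
    simp only [map_add, map_sub, map_zero, ← h3] at h1
    simp only [RuthTriple.comp, LinearMap.comp_apply, LinearMap.add_apply, map_add]
    linear_combination (norm := module) h1 + h2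
  comm_rhoC := by
    intro x y g c
    have h1 := congrArg (T'.PhiC y) (h.comm_rhoC g c)
    have h2 := h'.comm_rhoC g (T.PhiC x c)
    have h3 := sub_eq_zero.mp (h.comm_d x c)
    simp only [map_sub, map_zero] at h1
    simp only [RuthTriple.comp, LinearMap.comp_apply, LinearMap.add_apply]
    rw [h3] at h2
    linear_combination (norm := module) h1 + h2
  comm_gamma := by
    intro x y z g k e
    have h1 := congrArg (T'.PhiC z) (h.comm_gamma g k e)
    have h2 := h'.comm_gamma g k (T.PhiE x e)
    have h3 := h'.comm_rhoC g (T.mu k e)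
    have h4 := congrArg (T'.mu g) (h.comm_rhoE k e)
    simp only [map_add, map_sub, map_zero] at h1 h4
    simp only [RuthTriple.comp, LinearMap.comp_apply, LinearMap.add_apply, map_add]
    linear_combination (norm := module) h1 + h2 - h3 - h4

/-- The category of 2-term representations up to homotopy of `G`. -/
instance Ruth.category (G : LieGroupoid.{u}) : Category.{u} (Ruth G) where
  Hom R R' := RuthHom R R'
  id R := ⟨RuthTriple.id R, RuthTriple.isMorphism_id R⟩
  comp Φ Ψ := ⟨Φ.toRuthTriple.comp Ψ.toRuthTriple,
    RuthTriple.isMorphism_comp Φ.isMorphism Ψ.isMorphism⟩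
  id_comp Φ := by
    apply RuthHom.ext <;> simp [RuthTriple.comp, RuthTriple.id]
  comp_id Φ := by
    apply RuthHom.ext <;> simp [RuthTriple.comp, RuthTriple.id]
  assoc Φ Ψ Θ := by
    apply RuthHom.ext <;>
      simp [RuthTriple.comp, LinearMap.comp_assoc, LinearMap.comp_add, LinearMap.add_comp, add_assoc]

/-! ### VB-groupoids -/

/-- The bundles `E → M`, `Γ → G` and the fibrewise structure maps of a VB-groupoid `Γ ⇉ E` over
`G ⇉ M`. That the projection `Γ → G` respects the structure maps is built in: for `y ←g x` the
source and target map `Γ_g` to `E_x` and `E_y`, the unit maps `E_x` to `Γ_{1_x}`, the inversion maps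
`Γ_g` to `Γ_{g⁻¹}`, and the product of composable elements of `Γ_h` and `Γ_g` lies in `Γ_{hg}`. -/
structure VBData (G : LieGroupoid.{u}) : Type (u + 1) where
  E : G.ObjVB
  Gam : G.ArrVB
  src : ∀ {x y : G.Obj} (g : x ⟶ y), Gam.Fib ⟨g⟩ →ₗ[ℝ] E.Fib x
  tgt : ∀ {x y : G.Obj} (g : x ⟶ y), Gam.Fib ⟨g⟩ →ₗ[ℝ] E.Fib y
  one : ∀ x : G.Obj, E.Fib x →ₗ[ℝ] Gam.Fib ⟨𝟙 x⟩
  inv : ∀ {x y : G.Obj} (g : x ⟶ y), Gam.Fib ⟨g⟩ →ₗ[ℝ] Gam.Fib ⟨Groupoid.inv g⟩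
  mul : ∀ {x y z : G.Obj} (h : y ⟶ z) (g : x ⟶ y) (a : Gam.Fib ⟨h⟩) (b : Gam.Fib ⟨g⟩),
    src h a = tgt g b → Gam.Fib ⟨g ≫ h⟩

namespace VBData

variable {G : LieGroupoid.{u}}

/-- Pairs of composable elements of `Γ`. -/
structure Composable (D : VBData G) : Type u where
  {x : G.Obj}
  {y : G.Obj}
  {z : G.Obj}
  h : y ⟶ z
  g : x ⟶ y
  a : D.Gam.Fib ⟨h⟩
  b : D.Gam.Fib ⟨g⟩
  comp : D.src h a = D.tgt g b

/-- `Γ ⇉ E` is a VB-groupoid over `G ⇉ M`: it is a Lie groupoid, and its structure maps are linear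
(the linearity of source, target, unit and inversion being built in). Identities between elements
of fibres of `Γ` over arrows that are equal but not syntactically equal are stated in the total
space of `Γ`. -/
structure IsVBGroupoid (D : VBData G) : Prop where
  src_one : ∀ (x : G.Obj) (e : D.E.Fib x), D.src (𝟙 x) (D.one x e) = e
  tgt_one : ∀ (x : G.Obj) (e : D.E.Fib x), D.tgt (𝟙 x) (D.one x e) = e
  src_mul : ∀ {x y z : G.Obj} (h : y ⟶ z) (g : x ⟶ y) (a : D.Gam.Fib ⟨h⟩) (b : D.Gam.Fib ⟨g⟩)
    (hab : D.src h a = D.tgt g b), D.src (g ≫ h) (D.mul h g a b hab) = D.src g b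
  tgt_mul : ∀ {x y z : G.Obj} (h : y ⟶ z) (g : x ⟶ y) (a : D.Gam.Fib ⟨h⟩) (b : D.Gam.Fib ⟨g⟩)
    (hab : D.src h a = D.tgt g b), D.tgt (g ≫ h) (D.mul h g a b hab) = D.tgt h a
  mul_assoc : ∀ {w x y z : G.Obj} (k : y ⟶ z) (h : x ⟶ y) (g : w ⟶ x)
    (a : D.Gam.Fib ⟨k⟩) (b : D.Gam.Fib ⟨h⟩) (c : D.Gam.Fib ⟨g⟩)
    (hab : D.src k a = D.tgt h b) (hbc : D.src h b = D.tgt g c)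
    (hab_c : D.src (h ≫ k) (D.mul k h a b hab) = D.tgt g c)
    (ha_bc : D.src k a = D.tgt (g ≫ h) (D.mul h g b c hbc)),
    D.Gam.pt _ (D.mul (h ≫ k) g (D.mul k h a b hab) c hab_c)
      = D.Gam.pt _ (D.mul k (g ≫ h) a (D.mul h g b c hbc) ha_bc)
  mul_one : ∀ {x y : G.Obj} (g : x ⟶ y) (a : D.Gam.Fib ⟨g⟩)
    (h : D.src g a = D.tgt (𝟙 x) (D.one x (D.src g a))),
    D.Gam.pt _ (D.mul g (𝟙 x) a (D.one x (D.src g a)) h) = D.Gam.pt _ a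
  one_mul : ∀ {x y : G.Obj} (g : x ⟶ y) (a : D.Gam.Fib ⟨g⟩)
    (h : D.src (𝟙 y) (D.one y (D.tgt g a)) = D.tgt g a),
    D.Gam.pt _ (D.mul (𝟙 y) g (D.one y (D.tgt g a)) a h) = D.Gam.pt _ a
  src_inv : ∀ {x y : G.Obj} (g : x ⟶ y) (a : D.Gam.Fib ⟨g⟩),
    D.src (Groupoid.inv g) (D.inv g a) = D.tgt g a
  tgt_inv : ∀ {x y : G.Obj} (g : x ⟶ y) (a : D.Gam.Fib ⟨g⟩),
    D.tgt (Groupoid.inv g) (D.inv g a) = D.src g a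
  inv_mul : ∀ {x y : G.Obj} (g : x ⟶ y) (a : D.Gam.Fib ⟨g⟩)
    (h : D.src (Groupoid.inv g) (D.inv g a) = D.tgt g a),
    D.Gam.pt _ (D.mul (Groupoid.inv g) g (D.inv g a) a h) = D.Gam.pt _ (D.one x (D.src g a))
  mul_inv : ∀ {x y : G.Obj} (g : x ⟶ y) (a : D.Gam.Fib ⟨g⟩)
    (h : D.src g a = D.tgt (Groupoid.inv g) (D.inv g a)),
    D.Gam.pt _ (D.mul g (Groupoid.inv g) a (D.inv g a) h) = D.Gam.pt _ (D.one y (D.tgt g a))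
  mul_add : ∀ {x y z : G.Obj} (h : y ⟶ z) (g : x ⟶ y)
    (a a' : D.Gam.Fib ⟨h⟩) (b b' : D.Gam.Fib ⟨g⟩)
    (hab : D.src h a = D.tgt g b) (hab' : D.src h a' = D.tgt g b')
    (hs : D.src h (a + a') = D.tgt g (b + b')),
    D.mul h g (a + a') (b + b') hs = D.mul h g a b hab + D.mul h g a' b' hab'
  mul_smul : ∀ {x y z : G.Obj} (h : y ⟶ z) (g : x ⟶ y) (r : ℝ)
    (a : D.Gam.Fib ⟨h⟩) (b : D.Gam.Fib ⟨g⟩)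
    (hab : D.src h a = D.tgt g b) (hs : D.src h (r • a) = D.tgt g (r • b)),
    D.mul h g (r • a) (r • b) hs = r • D.mul h g a b hab
  submersion_src : IsSurjectiveSubmersion D.Gam.model D.E.model
    (fun v : D.Gam.Tot => D.E.pt v.proj.src (D.src v.proj.hom v.snd))
  submersion_tgt : IsSurjectiveSubmersion D.Gam.model D.E.model
    (fun v : D.Gam.Tot => D.E.pt v.proj.tgt (D.tgt v.proj.hom v.snd))
  smooth_one : ContMDiff D.E.model D.Gam.model ∞
    (fun e : D.E.Tot => D.Gam.pt ⟨𝟙 e.proj⟩ (D.one e.proj e.snd))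
  smooth_inv : ContMDiff D.Gam.model D.Gam.model ∞
    (fun v : D.Gam.Tot => D.Gam.pt ⟨Groupoid.inv v.proj.hom⟩ (D.inv v.proj.hom v.snd))
  smooth_mul : SmoothAlong (D.Gam.model.prod D.Gam.model) D.Gam.model
    (fun p : D.Composable => (D.Gam.pt ⟨p.h⟩ p.a, D.Gam.pt ⟨p.g⟩ p.b))
    (fun p : D.Composable => D.Gam.pt ⟨p.g ≫ p.h⟩ (D.mul p.h p.g p.a p.b p.comp))

end VBData

/-- A VB-groupoid over `G`. -/
structure VBGroupoid (G : LieGroupoid.{u}) : Type (u + 1) where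
  data : VBData G
  isVBGroupoid : data.IsVBGroupoid

/-- A pair of families of linear maps `E_x → E'_x` and `Γ_g → Γ'_g` (covering the identity of
`G`). -/
@[ext]
structure VBMapData {G : LieGroupoid.{u}} (D D' : VBData G) : Type u where
  obj : ∀ x, D.E.Fib x →ₗ[ℝ] D'.E.Fib x
  arr : ∀ {x y : G.Obj} (g : x ⟶ y), D.Gam.Fib ⟨g⟩ →ₗ[ℝ] D'.Gam.Fib ⟨g⟩

/-- A pair of families of linear maps is a VB-map over `G`: it is smooth and commutes with the five
structure maps. -/
structure VBMapData.IsVBMap {G : LieGroupoid.{u}} {D D' : VBData G} (Φ : VBMapData D D') : Prop where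
  smooth_obj : D.E.IsSmoothHom D'.E Φ.obj
  smooth_arr : D.Gam.IsSmoothHom D'.Gam (fun a => Φ.arr a.hom)
  comm_src : ∀ {x y : G.Obj} (g : x ⟶ y) (a : D.Gam.Fib ⟨g⟩),
    D'.src g (Φ.arr g a) = Φ.obj x (D.src g a)
  comm_tgt : ∀ {x y : G.Obj} (g : x ⟶ y) (a : D.Gam.Fib ⟨g⟩),
    D'.tgt g (Φ.arr g a) = Φ.obj y (D.tgt g a)
  comm_one : ∀ (x : G.Obj) (e : D.E.Fib x), Φ.arr (𝟙 x) (D.one x e) = D'.one x (Φ.obj x e)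
  comm_inv : ∀ {x y : G.Obj} (g : x ⟶ y) (a : D.Gam.Fib ⟨g⟩),
    Φ.arr (Groupoid.inv g) (D.inv g a) = D'.inv g (Φ.arr g a)
  comm_mul : ∀ {x y z : G.Obj} (h : y ⟶ z) (g : x ⟶ y) (a : D.Gam.Fib ⟨h⟩) (b : D.Gam.Fib ⟨g⟩)
    (hab : D.src h a = D.tgt g b) (hab' : D'.src h (Φ.arr h a) = D'.tgt g (Φ.arr g b)),
    Φ.arr (g ≫ h) (D.mul h g a b hab) = D'.mul h g (Φ.arr h a) (Φ.arr g b) hab'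

/-- VB-maps over `G`. -/
@[ext]
structure VBHom {G : LieGroupoid.{u}} (Γ Γ' : VBGroupoid G) : Type u
    extends VBMapData Γ.data Γ'.data where
  isVBMap : toVBMapData.IsVBMap

/-- The identity. -/
def VBMapData.id {G : LieGroupoid.{u}} (D : VBData G) : VBMapData D D where
  obj := fun _ => LinearMap.id
  arr := fun _ => LinearMap.id

/-- The composite. -/
def VBMapData.comp {G : LieGroupoid.{u}} {D D' D'' : VBData G}
    (Φ : VBMapData D D') (Ψ : VBMapData D' D'') : VBMapData D D'' where
  obj := fun x => Ψ.obj x ∘ₗ Φ.obj x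
  arr := fun g => Ψ.arr g ∘ₗ Φ.arr g

theorem VBMapData.isVBMap_id {G : LieGroupoid.{u}} (D : VBData G) :
    (VBMapData.id D).IsVBMap where
  smooth_obj := contMDiff_id
  smooth_arr := contMDiff_id
  comm_src := fun _ _ => rfl
  comm_tgt := fun _ _ => rfl
  comm_one := fun _ _ => rfl
  comm_inv := fun _ _ => rfl
  comm_mul := fun _ _ _ _ _ _ => rfl

theorem VBMapData.isVBMap_comp {G : LieGroupoid.{u}} {D D' D'' : VBData G}
    {Φ : VBMapData D D'} {Ψ : VBMapData D' D''} (h : Φ.IsVBMap) (h' : Ψ.IsVBMap) :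
    (Φ.comp Ψ).IsVBMap where
  smooth_obj := ContMDiff.comp h'.smooth_obj h.smooth_obj
  smooth_arr := ContMDiff.comp h'.smooth_arr h.smooth_arr
  comm_src := by
    intro x y g a
    simp [VBMapData.comp, h.comm_src, h'.comm_src]
  comm_tgt := by
    intro x y g a
    simp [VBMapData.comp, h.comm_tgt, h'.comm_tgt]
  comm_one := by
    intro x e
    simp [VBMapData.comp, h.comm_one, h'.comm_one]
  comm_inv := by
    intro x y g a
    simp [VBMapData.comp, h.comm_inv, h'.comm_inv]
  comm_mul := by
    intro x y z k g a b hab hab'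
    have h1 : D'.src k (Φ.arr k a) = D'.tgt g (Φ.arr g b) := by
      rw [h.comm_src, h.comm_tgt, hab]
    simp only [VBMapData.comp, LinearMap.comp_apply]
    rw [h.comm_mul k g a b hab h1, h'.comm_mul k g _ _ h1]

/-- The category of VB-groupoids over `G` and VB-maps over `G`. -/
instance VBGroupoid.category (G : LieGroupoid.{u}) : Category.{u} (VBGroupoid G) where
  Hom Γ Γ' := VBHom Γ Γ'
  id Γ := ⟨VBMapData.id Γ.data, VBMapData.isVBMap_id Γ.data⟩
  comp Φ Ψ := ⟨Φ.toVBMapData.comp Ψ.toVBMapData,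
    VBMapData.isVBMap_comp Φ.isVBMap Ψ.isVBMap⟩
  id_comp _ := rfl
  comp_id _ := rfl
  assoc _ _ _ := rfl

/-! ### The Grothendieck construction -/

/-- The semi-direct product `t^*C ⊕ s^*E ⇉ E`. -/
def Ruth.semidirect {G : LieGroupoid.{u}} (R : Ruth G) : VBData G where
  E := R.E
  Gam := (R.C.pullback G.tgtMap).sum (R.E.pullback G.srcMap)
  src := fun {x y} _ => LinearMap.snd ℝ (R.C.Fib y) (R.E.Fib x)
  tgt := fun {_ y} g => LinearMap.coprod (R.d y) (R.rhoE g)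
  one := fun x => LinearMap.inr ℝ (R.C.Fib x) (R.E.Fib x)
  inv := fun {_ y} g => LinearMap.prod
    (LinearMap.coprod (-R.rhoC (Groupoid.inv g)) (R.gamma (Groupoid.inv g) g))
    (LinearMap.coprod (R.d y) (R.rhoE g))
  mul := fun {x y z} g₁ g₂ (v₁ : R.C.Fib z × R.E.Fib y) (v₂ : R.C.Fib y × R.E.Fib x) _ =>
    ((v₁.1 + R.rhoC g₁ v₂.1 - R.gamma g₁ g₂ v₂.2, v₂.2) : R.C.Fib z × R.E.Fib x)

/-- The map `(c, g, e) ↦ (Φ_C(c) + μ_g(e), g, Φ_E(e))` of semi-direct products. -/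
def RuthTriple.semidirectMap {G : LieGroupoid.{u}} {R R' : Ruth G} (T : RuthTriple R R') :
    VBMapData R.semidirect R'.semidirect where
  obj := T.PhiE
  arr := fun {x y} g => LinearMap.prod
    (LinearMap.coprod (T.PhiC y) (T.mu g))
    (T.PhiE x ∘ₗ LinearMap.snd ℝ (R.C.Fib y) (R.E.Fib x))

/-- The Grothendieck construction as a functor, given that semi-direct products are VB-groupoids and
that morphisms of representations up to homotopy induce VB-maps between them. -/
def grothendieckFunctor (G : LieGroupoid.{u})
    (hobj : ∀ R : Ruth G, R.semidirect.IsVBGroupoid)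
    (hmap : ∀ (R R' : Ruth G) (T : RuthTriple R R'), T.IsMorphism → T.semidirectMap.IsVBMap) :
    Ruth G ⥤ VBGroupoid G where
  obj R := ⟨R.semidirect, hobj R⟩
  map {R R'} Φ := ⟨Φ.toRuthTriple.semidirectMap, hmap R R' _ Φ.isMorphism⟩
  map_id R := by
    apply VBHom.ext
    · rfl
    · funext x y g
      refine LinearMap.ext fun v => ?_
      obtain ⟨c, e⟩ := (v : R.C.Fib y × R.E.Fib x)
      exact Prod.ext (show c + 0 = c from add_zero c) rfl
  map_comp {R R' R''} Φ Ψ := by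
    apply VBHom.ext
    · rfl
    · funext x y g
      refine LinearMap.ext fun v => ?_
      obtain ⟨c, e⟩ := (v : R.C.Fib y × R.E.Fib x)
      refine Prod.ext ?_ rfl
      change Ψ.PhiC y (Φ.PhiC y c) + (Ψ.PhiC y (Φ.mu g e) + Ψ.mu g (Φ.PhiE x e))
        = Ψ.PhiC y (Φ.PhiC y c + Φ.mu g e) + Ψ.mu g (Φ.PhiE x e)
      rw [map_add, add_assoc]

end

end LieGpd

/-!
The Grothendieck construction is a VB-groupoid by direct computation: each groupoid axiom reduces to
one of the equations of a representation up to homotopy. Its source map is a submersion because in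
trivialisations it is the product of the source map of `G` and the identity of the fibre of `E`, and
its target map is the source map composed with the inversion (`Ruth.isVBGroupoid`).

A VB-map `Ψ` between Grothendieck constructions preserves the second component `e`. On elements
`(c, g, 0)` it does not depend on `g`, because `(c, g, 0) = (c, 1, 0) · (0, g, 0)`. It is therefore
given by the triple with `Φ_E = Ψ|_E`, `Φ_C(c) = pr₁ Ψ(c, 1, 0)` and `μ_g(e) = pr₁ Ψ(0, g, e)`, and
compatibility with target and product is equivalent to the equations of a morphism
(`RuthTriple.IsMorphism.isVBMap`, `RuthTriple.isMorphism_of_isVBMap`,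
`RuthTriple.existsUnique_of_isVBMap`). Hence the functor is fully faithful.

For essential surjectivity, let `Γ ⇉ E` be a VB-groupoid. Its source map is a submersion at the zero
vectors, where its derivative splits into a horizontal part and the fibrewise linear part, so it is
surjective on each fibre. Therefore

* the kernels of the source map over the units have constant rank and form a vector bundle `C`, the
  core. It is built as the image of the smooth idempotents `v ↦ v - 1_{s(v)}` (`SmoothIdempotent`);
* there are smooth linear sections `σ_g : E_x → Γ_g` of the source map that agree with the unit map
  over the units. They exist locally and form convex sets, so a partition of unity glues them
  (`VBData.IsVBGroupoid.exists_unital_splitting`).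

Each `v ∈ Γ_g` is then uniquely `c · 0_g + σ_g(e)` with `c ∈ C` and `e = s(v)`. Put
`∂c = t(c)`, `ρ^E_g(e) = t(σ_g(e))`, let `ρ^C_g(c)` be the core component of `σ_g(∂c) · c`, and let
`-γ_{h,g}(e)` be the core component of `σ_h(ρ^E_g(e)) · σ_g(e)`. Linearity of the multiplication
shows that in these terms the product of `Γ` is that of the Grothendieck construction
(`CoreSplitting.mulTo_right_add_lift`). Comparing targets, units and the two ways to bracket a triple
product gives the equations of a representation up to homotopy (`CoreSplitting.ruth`), and
`(c, g, e) ↦ c · 0_g + σ_g(e)` is an isomorphism from its Grothendieck construction to `Γ`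
(`CoreSplitting.isoSemidirect`).

Smoothness of maps defined on fibre products is handled by a small calculus for `SmoothAlong`: maps
built from smooth ones by composition, pairing and fibrewise linear operations are smooth.
-/

namespace LieGpd

noncomputable section

/-! ### Calculus of smooth maps on subsets -/

section SmoothAlong

variable {EX HX EX' HX' EY HY EY' HY' X X' Y Y' P P' : Type*}
  [NormedAddCommGroup EX] [NormedSpace ℝ EX] [TopologicalSpace HX]
  [NormedAddCommGroup EX'] [NormedSpace ℝ EX'] [TopologicalSpace HX']
  [NormedAddCommGroup EY] [NormedSpace ℝ EY] [TopologicalSpace HY]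
  [NormedAddCommGroup EY'] [NormedSpace ℝ EY'] [TopologicalSpace HY']
  [TopologicalSpace X] [ChartedSpace HX X] [TopologicalSpace X'] [ChartedSpace HX' X']
  [TopologicalSpace Y] [ChartedSpace HY Y] [TopologicalSpace Y'] [ChartedSpace HY' Y']
  {I : ModelWithCorners ℝ EX HX} {I' : ModelWithCorners ℝ EX' HX'}
  {J : ModelWithCorners ℝ EY HY} {J' : ModelWithCorners ℝ EY' HY'}

theorem smoothAlong_id_iff {f : X → Y} : SmoothAlong I J (fun x : X => x) f ↔ ContMDiff I J ∞ f := by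
  constructor
  · intro h x
    obtain ⟨F, hF, sF⟩ := h x
    have : F = f := funext hF
    subst this
    simpa [ContMDiffAt] using sF
  · intro h x
    exact ⟨f, fun _ => rfl, (h x).contMDiffWithinAt⟩

theorem SmoothAlong.congr {ι : P → X} {f f' : P → Y} (hf : SmoothAlong I J ι f)
    (h : ∀ p, f p = f' p) : SmoothAlong I J ι f' := by
  rwa [← funext h]

theorem SmoothAlong.comp {ι : P → X} {ι' : P' → X'} {f : P' → Y} (hf : SmoothAlong I' J ι' f)
    {k : P → P'} (hk : SmoothAlong I I' ι (fun p => ι' (k p))) :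
    SmoothAlong I J ι (fun p => f (k p)) := by
  intro p
  obtain ⟨K, hK, sK⟩ := hk p
  obtain ⟨F, hF, sF⟩ := hf (k p)
  refine ⟨fun x => F (K x), fun q => by beta_reduce; rw [hK, hF], ?_⟩
  beta_reduce at hK
  rw [← hK p] at sF
  refine ContMDiffWithinAt.comp (t := Set.range ι') _ sF sK ?_
  rintro _ ⟨q, rfl⟩
  exact ⟨k q, (hK q).symm⟩

theorem _root_.ContMDiff.comp_smoothAlong {φ : Y → Y'} (hφ : ContMDiff J J' ∞ φ) {ι : P → X}
    {f : P → Y} (hf : SmoothAlong I J ι f) : SmoothAlong I J' ι (fun p => φ (f p)) :=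
  (smoothAlong_id_iff.2 hφ).comp hf

theorem smoothAlong_self (ι : P → X) : SmoothAlong I I ι ι :=
  fun _ => ⟨fun x => x, fun _ => rfl, contMDiffWithinAt_id⟩

theorem SmoothAlong.prodMk {ι : P → X} {f : P → Y} {f' : P → Y'}
    (hf : SmoothAlong I J ι f) (hf' : SmoothAlong I J' ι f') :
    SmoothAlong I (J.prod J') ι (fun p => (f p, f' p)) := by
  intro p
  obtain ⟨F, hF, sF⟩ := hf p
  obtain ⟨F', hF', sF'⟩ := hf' p
  exact ⟨fun x => (F x, F' x), fun q => by beta_reduce; rw [hF, hF'], sF.prodMk sF'⟩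

theorem SmoothAlong.fst {ι : P → X} {f : P → Y × Y'} (hf : SmoothAlong I (J.prod J') ι f) :
    SmoothAlong I J ι (fun p => (f p).1) :=
  contMDiff_fst.comp_smoothAlong hf

theorem SmoothAlong.snd {ι : P → X} {f : P → Y × Y'} (hf : SmoothAlong I (J.prod J') ι f) :
    SmoothAlong I J' ι (fun p => (f p).2) :=
  contMDiff_snd.comp_smoothAlong hf

end SmoothAlong

namespace SmoothVB

variable {EB HB : Type} [NormedAddCommGroup EB] [NormedSpace ℝ EB]
  [TopologicalSpace HB] {I : ModelWithCorners ℝ EB HB}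
  {B : Type u} [TopologicalSpace B] [ChartedSpace HB B]
  {EB' HB' : Type} [NormedAddCommGroup EB'] [NormedSpace ℝ EB']
  [TopologicalSpace HB'] {I' : ModelWithCorners ℝ EB' HB'}
  {B' : Type u} [TopologicalSpace B'] [ChartedSpace HB' B']
  {EX HX X P : Type*} [NormedAddCommGroup EX] [NormedSpace ℝ EX] [TopologicalSpace HX]
  [TopologicalSpace X] [ChartedSpace HX X] {J : ModelWithCorners ℝ EX HX} {ι : P → X}

theorem smoothAlong_proj {V : SmoothVB I B} {x : P → B} {v : ∀ p, V.Fib (x p)}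
    (h : SmoothAlong J V.model ι (fun p => V.pt (x p) (v p))) : SmoothAlong J I ι x :=
  (contMDiff_proj (n := ∞) (IB := I) V.Fib).comp_smoothAlong h

theorem smoothAlong_zero (V : SmoothVB I B) {x : P → B} (h : SmoothAlong J I ι x) :
    SmoothAlong J V.model ι (fun p => V.pt (x p) 0) :=
  (contMDiff_zeroSection ℝ V.Fib).comp_smoothAlong h

theorem IsSmoothHom.smoothAlong {V W : SmoothVB I B} {φ : ∀ x, V.Fib x →ₗ[ℝ] W.Fib x}
    (hφ : V.IsSmoothHom W φ) {x : P → B} {v : ∀ p, V.Fib (x p)}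
    (h : SmoothAlong J V.model ι (fun p => V.pt (x p) (v p))) :
    SmoothAlong J W.model ι (fun p => W.pt (x p) (φ (x p) (v p))) :=
  hφ.comp_smoothAlong h

theorem eventually_mem_baseSet (V : SmoothVB I B) {F : X → V.Tot} {s : Set X} {x₀ : X}
    (hF : ContMDiffWithinAt J V.model ∞ F s x₀) :
    ∀ᶠ x in 𝓝[s] x₀, (F x).proj ∈ (trivializationAt V.F V.Fib (F x₀).proj).baseSet := by
  rw [contMDiffWithinAt_totalSpace] at hF
  exact hF.1.continuousWithinAt.eventually_mem
    ((trivializationAt V.F V.Fib _).open_baseSet.mem_nhds (mem_baseSet_trivializationAt _ _ _))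

theorem smoothAlong_add {V : SmoothVB I B} {x : P → B} {v w : ∀ p, V.Fib (x p)}
    (h : SmoothAlong J V.model ι (fun p => V.pt (x p) (v p)))
    (h' : SmoothAlong J V.model ι (fun p => V.pt (x p) (w p))) :
    SmoothAlong J V.model ι (fun p => V.pt (x p) (v p + w p)) := by
  intro p
  obtain ⟨F, hF, sF⟩ := h p
  obtain ⟨F', hF', sF'⟩ := h' p
  have key : ∀ q, V.addTot (F (ι q)) (F' (ι q)) = V.pt (x q) (v q + w q) := by
    intro q; rw [hF, hF', addTot_pt]
  refine ⟨fun y => V.addTot (F y) (F' y), key, ?_⟩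
  have hev := V.eventually_mem_baseSet sF
  have hp : (V.addTot (F (ι p)) (F' (ι p))).proj = x p := by rw [key]
  rw [contMDiffWithinAt_totalSpace] at sF sF' ⊢
  obtain ⟨s1, s2⟩ := sF
  obtain ⟨-, s2'⟩ := sF'
  simp only [hF, hF'] at s2 s2' hev
  simp only [hp]
  have hadd : ∀ q, x q ∈ (trivializationAt V.F V.Fib (x p)).baseSet →
      (trivializationAt V.F V.Fib (x p) (V.addTot (F (ι q)) (F' (ι q)))).2 =
      (trivializationAt V.F V.Fib (x p) (F (ι q))).2
        + (trivializationAt V.F V.Fib (x p) (F' (ι q))).2 := by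
    intro q hq
    rw [key, hF, hF']
    exact ((trivializationAt V.F V.Fib (x p)).linear ℝ hq).map_add _ _
  refine ⟨s1.congr ?_ (by rw [key, hF]), (s2.add s2').congr_of_eventuallyEq ?_
    (hadd p (mem_baseSet_trivializationAt _ _ _))⟩
  · rintro _ ⟨q, rfl⟩
    rw [key, hF]
  · filter_upwards [hev, self_mem_nhdsWithin] with y hy hy'
    obtain ⟨q, rfl⟩ := hy'
    rw [hF] at hy
    exact hadd q hy

theorem smoothAlong_neg {V : SmoothVB I B} {x : P → B} {v : ∀ p, V.Fib (x p)}
    (h : SmoothAlong J V.model ι (fun p => V.pt (x p) (v p))) :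
    SmoothAlong J V.model ι (fun p => V.pt (x p) (-v p)) := by
  intro p
  obtain ⟨F, hF, sF⟩ := h p
  refine ⟨fun y => V.pt (F y).proj (-(F y).snd), fun q => by beta_reduce; rw [hF], ?_⟩
  have hev := V.eventually_mem_baseSet sF
  rw [contMDiffWithinAt_totalSpace] at sF ⊢
  obtain ⟨s1, s2⟩ := sF
  have hadd : ∀ y, (F y).proj ∈ (trivializationAt V.F V.Fib (F (ι p)).proj).baseSet →
      (trivializationAt V.F V.Fib (F (ι p)).proj (V.pt (F y).proj (-(F y).snd))).2 =
      -(trivializationAt V.F V.Fib (F (ι p)).proj (F y)).2 := by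
    intro q hq
    exact ((trivializationAt V.F V.Fib (F (ι p)).proj).linear ℝ hq).map_neg _
  refine ⟨s1, s2.neg.congr_of_eventuallyEq ?_ (hadd _ (mem_baseSet_trivializationAt _ _ _))⟩
  filter_upwards [hev] with y hy
  exact hadd y hy

theorem smoothAlong_sub {V : SmoothVB I B} {x : P → B} {v w : ∀ p, V.Fib (x p)}
    (h : SmoothAlong J V.model ι (fun p => V.pt (x p) (v p)))
    (h' : SmoothAlong J V.model ι (fun p => V.pt (x p) (w p))) :
    SmoothAlong J V.model ι (fun p => V.pt (x p) (v p - w p)) := by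
  simp only [sub_eq_add_neg]
  exact smoothAlong_add h (smoothAlong_neg h')

/-- A map into a direct sum is smooth as soon as its two components are. -/
theorem smoothAlong_sum {V W : SmoothVB I B} {x : P → B} {v : ∀ p, V.Fib (x p)}
    {w : ∀ p, W.Fib (x p)}
    (h : SmoothAlong J V.model ι (fun p => V.pt (x p) (v p)))
    (h' : SmoothAlong J W.model ι (fun p => W.pt (x p) (w p))) :
    SmoothAlong J (V.sum W).model ι (fun p => (V.sum W).pt (x p) (v p, w p)) := by
  classical
  intro p
  obtain ⟨F, hF, sF⟩ := h p
  obtain ⟨F', hF', sF'⟩ := h' p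
  let T : V.Tot → W.Tot → (V.sum W).Tot := fun a b =>
    if h : b.proj = a.proj then (V.sum W).pt a.proj (a.snd, h ▸ b.snd)
    else (V.sum W).pt a.proj (a.snd, 0)
  have hT : ∀ y (a : V.Fib y) (b : W.Fib y), T (V.pt y a) (W.pt y b) = (V.sum W).pt y (a, b) := by
    intro y a b
    simp [T]
  have key : ∀ q, T (F (ι q)) (F' (ι q)) = (V.sum W).pt (x q) (v q, w q) := by
    intro q; rw [hF, hF', hT]
  refine ⟨fun y => T (F y) (F' y), key, ?_⟩
  have hp : (T (F (ι p)) (F' (ι p))).proj = x p := by rw [key]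
  rw [contMDiffWithinAt_totalSpace] at sF sF' ⊢
  obtain ⟨s1, s2⟩ := sF
  obtain ⟨-, s2'⟩ := sF'
  simp only [hF, hF'] at s2 s2'
  simp only [hp]
  have hadd : ∀ q, (trivializationAt (V.sum W).F (V.sum W).Fib (x p) (T (F (ι q)) (F' (ι q)))).2 =
      ((trivializationAt V.F V.Fib (x p) (F (ι q))).2,
        (trivializationAt W.F W.Fib (x p) (F' (ι q))).2) := by
    intro q
    rw [key, hF, hF']
    rfl
  refine ⟨s1.congr ?_ (by rw [key, hF]), (s2.prodMk_space s2').congr ?_ (hadd p)⟩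
  · rintro _ ⟨q, rfl⟩
    rw [key, hF]
  · rintro _ ⟨q, rfl⟩
    exact hadd q

theorem contMDiff_sum_fst (V W : SmoothVB I B) :
    ContMDiff (V.sum W).model V.model ∞ (fun z : (V.sum W).Tot => V.pt z.proj z.snd.1) := by
  intro z
  have h := contMDiffAt_id (n := ∞) (I := (V.sum W).model) (x := z)
  rw [contMDiffAt_totalSpace] at h ⊢
  exact ⟨h.1, (contDiff_fst (E := V.F) (F := W.F)).contMDiff.contMDiffAt.comp z h.2⟩

theorem contMDiff_sum_snd (V W : SmoothVB I B) :
    ContMDiff (V.sum W).model W.model ∞ (fun z : (V.sum W).Tot => W.pt z.proj z.snd.2) := by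
  intro z
  have h := contMDiffAt_id (n := ∞) (I := (V.sum W).model) (x := z)
  rw [contMDiffAt_totalSpace] at h ⊢
  exact ⟨h.1, (contDiff_snd (E := V.F) (F := W.F)).contMDiff.contMDiffAt.comp z h.2⟩

/-- A map into a pullback bundle is smooth as soon as its two components are. -/
theorem smoothAlong_pullback {f : ContMDiffMap I' I B' B ∞} {V : SmoothVB I B} {x : P → B'}
    {v : ∀ p, V.Fib (f (x p))} (h : SmoothAlong J I' ι x)
    (h' : SmoothAlong J V.model ι (fun p => V.pt (f (x p)) (v p))) :
    SmoothAlong J (V.pullback f).model ι (fun p => (V.pullback f).pt (x p) (v p)) := by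
  classical
  intro p
  obtain ⟨F, hF, sF⟩ := h p
  obtain ⟨F', hF', sF'⟩ := h' p
  let T : B' → V.Tot → (V.pullback f).Tot := fun a b =>
    if h : b.proj = f a then (V.pullback f).pt a (show V.Fib (f a) from h ▸ b.snd)
    else (V.pullback f).pt a 0
  have hT : ∀ y (b : V.Fib (f y)), T y (V.pt (f y) b) = (V.pullback f).pt y b := by
    intro y b
    simp [T]
  have key : ∀ q, T (F (ι q)) (F' (ι q)) = (V.pullback f).pt (x q) (v q) := by
    intro q; rw [hF, hF', hT]
  refine ⟨fun y => T (F y) (F' y), key, ?_⟩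
  have hp : (T (F (ι p)) (F' (ι p))).proj = x p := by rw [key]
  rw [contMDiffWithinAt_totalSpace] at sF' ⊢
  obtain ⟨-, s2'⟩ := sF'
  simp only [hF'] at s2'
  simp only [hp]
  have hadd : ∀ q,
      (trivializationAt (V.pullback f).F (V.pullback f).Fib (x p) (T (F (ι q)) (F' (ι q)))).2 =
        (trivializationAt V.F V.Fib (f (x p)) (F' (ι q))).2 := by
    intro q
    rw [key, hF']
    rfl
  refine ⟨sF.congr ?_ (by rw [key, hF]), s2'.congr ?_ (hadd p)⟩
  · rintro _ ⟨q, rfl⟩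
    rw [key, hF]
  · rintro _ ⟨q, rfl⟩
    exact hadd q

theorem contMDiff_pullback_lift (f : ContMDiffMap I' I B' B ∞) (V : SmoothVB I B) :
    ContMDiff (V.pullback f).model V.model ∞
      (fun z : (V.pullback f).Tot => V.pt (f z.proj) z.snd) := by
  intro z
  have h := contMDiffAt_id (n := ∞) (I := (V.pullback f).model) (x := z)
  rw [contMDiffAt_totalSpace] at h ⊢
  exact ⟨f.contMDiff.contMDiffAt.comp z h.1, h.2⟩

end SmoothVB

/-! ### Smoothness of families of linear maps -/

section Families

variable {G : LieGroupoid.{u}} {EX HX X P : Type*} [NormedAddCommGroup EX] [NormedSpace ℝ EX]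
  [TopologicalSpace HX] [TopologicalSpace X] [ChartedSpace HX X] {J : ModelWithCorners ℝ EX HX}
  {ι : P → X}

theorem smoothAlong_tgt {a : P → G.Arr} (ha : SmoothAlong J (𝓡 G.dimArr) ι a) :
    SmoothAlong J (𝓡 G.dimObj) ι (fun p => (a p).tgt) :=
  G.submersion_tgt.smooth.comp_smoothAlong ha

theorem smoothAlong_one {x : P → G.Obj} (hx : SmoothAlong J (𝓡 G.dimObj) ι x) :
    SmoothAlong J (𝓡 G.dimArr) ι (fun p => (⟨𝟙 (x p)⟩ : G.Arr)) :=
  G.smooth_one.comp_smoothAlong hx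

theorem smoothAlong_inv {a : P → G.Arr} (ha : SmoothAlong J (𝓡 G.dimArr) ι a) :
    SmoothAlong J (𝓡 G.dimArr) ι (fun p => (⟨Groupoid.inv (a p).hom⟩ : G.Arr)) :=
  G.smooth_inv.comp_smoothAlong ha

theorem smoothAlong_comp {x y z : P → G.Obj} {h : ∀ p, y p ⟶ z p} {g : ∀ p, x p ⟶ y p}
    (hh : SmoothAlong J (𝓡 G.dimArr) ι (fun p => (⟨h p⟩ : G.Arr)))
    (hg : SmoothAlong J (𝓡 G.dimArr) ι (fun p => (⟨g p⟩ : G.Arr))) :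
    SmoothAlong J (𝓡 G.dimArr) ι (fun p => (⟨g p ≫ h p⟩ : G.Arr)) :=
  G.smooth_mul.comp (k := fun p => ⟨h p, g p⟩) (hh.prodMk hg)

theorem LieGroupoid.IsSmooth₁.smoothAlong {V W : G.ObjVB}
    {τ : ∀ {x y : G.Obj}, (x ⟶ y) → (V.Fib x →ₗ[ℝ] W.Fib y)} (hτ : LieGroupoid.IsSmooth₁ V W τ)
    {x y : P → G.Obj} {g : ∀ p, x p ⟶ y p} {v : ∀ p, V.Fib (x p)}
    (hg : SmoothAlong J (𝓡 G.dimArr) ι (fun p => (⟨g p⟩ : G.Arr)))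
    (hv : SmoothAlong J V.model ι (fun p => V.pt (x p) (v p))) :
    SmoothAlong J W.model ι (fun p => W.pt (y p) (τ (g p) (v p))) :=
  SmoothAlong.comp hτ (k := fun p => (⟨⟨g p⟩, v p⟩ : Σ a : G.Arr, V.Fib a.src)) (hg.prodMk hv)

theorem LieGroupoid.IsSmooth₂.smoothAlong {V W : G.ObjVB}
    {τ : ∀ {x y z : G.Obj}, (y ⟶ z) → (x ⟶ y) → (V.Fib x →ₗ[ℝ] W.Fib z)}
    (hτ : LieGroupoid.IsSmooth₂ V W τ)
    {x y z : P → G.Obj} {h : ∀ p, y p ⟶ z p} {g : ∀ p, x p ⟶ y p} {v : ∀ p, V.Fib (x p)}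
    (hh : SmoothAlong J (𝓡 G.dimArr) ι (fun p => (⟨h p⟩ : G.Arr)))
    (hg : SmoothAlong J (𝓡 G.dimArr) ι (fun p => (⟨g p⟩ : G.Arr)))
    (hv : SmoothAlong J V.model ι (fun p => V.pt (x p) (v p))) :
    SmoothAlong J W.model ι (fun p => W.pt (z p) (τ (h p) (g p) (v p))) :=
  SmoothAlong.comp hτ
    (k := fun p => (⟨⟨h p, g p⟩, v p⟩ : Σ c : ComposablePair G.Obj, V.Fib c.x))
    (hh.prodMk (hg.prodMk hv))

theorem Ruth.smoothAlong_pt (R : Ruth G) {x y : P → G.Obj} {g : ∀ p, x p ⟶ y p}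
    {c : ∀ p, R.C.Fib (y p)} {e : ∀ p, R.E.Fib (x p)}
    (hg : SmoothAlong J (𝓡 G.dimArr) ι (fun p => (⟨g p⟩ : G.Arr)))
    (hc : SmoothAlong J R.C.model ι (fun p => R.C.pt (y p) (c p)))
    (he : SmoothAlong J R.E.model ι (fun p => R.E.pt (x p) (e p))) :
    SmoothAlong J R.semidirect.Gam.model ι
      (fun p => R.semidirect.Gam.pt ⟨g p⟩ ((c p, e p) : R.C.Fib (y p) × R.E.Fib (x p))) :=
  SmoothVB.smoothAlong_sum (SmoothVB.smoothAlong_pullback hg hc)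
    (SmoothVB.smoothAlong_pullback hg he)

theorem Ruth.smoothAlong_fst (R : Ruth G) {x y : P → G.Obj} {g : ∀ p, x p ⟶ y p}
    {v : ∀ p, R.C.Fib (y p) × R.E.Fib (x p)}
    (hv : SmoothAlong J R.semidirect.Gam.model ι (fun p => R.semidirect.Gam.pt ⟨g p⟩ (v p))) :
    SmoothAlong J R.C.model ι (fun p => R.C.pt (y p) (v p).1) :=
  (SmoothVB.contMDiff_pullback_lift G.tgtMap R.C).comp_smoothAlong
    ((SmoothVB.contMDiff_sum_fst (R.C.pullback G.tgtMap) (R.E.pullback G.srcMap)).comp_smoothAlong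
      hv)

theorem Ruth.smoothAlong_snd (R : Ruth G) {x y : P → G.Obj} {g : ∀ p, x p ⟶ y p}
    {v : ∀ p, R.C.Fib (y p) × R.E.Fib (x p)}
    (hv : SmoothAlong J R.semidirect.Gam.model ι (fun p => R.semidirect.Gam.pt ⟨g p⟩ (v p))) :
    SmoothAlong J R.E.model ι (fun p => R.E.pt (x p) (v p).2) :=
  (SmoothVB.contMDiff_pullback_lift G.srcMap R.E).comp_smoothAlong
    ((SmoothVB.contMDiff_sum_snd (R.C.pullback G.tgtMap) (R.E.pullback G.srcMap)).comp_smoothAlong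
      hv)

theorem Ruth.smoothAlong_proj (R : Ruth G) {x y : P → G.Obj} {g : ∀ p, x p ⟶ y p}
    {v : ∀ p, R.C.Fib (y p) × R.E.Fib (x p)}
    (hv : SmoothAlong J R.semidirect.Gam.model ι (fun p => R.semidirect.Gam.pt ⟨g p⟩ (v p))) :
    SmoothAlong J (𝓡 G.dimArr) ι (fun p => (⟨g p⟩ : G.Arr)) :=
  SmoothVB.smoothAlong_proj (V := R.semidirect.Gam) hv

end Families

/-! ### The structure maps of the Grothendieck construction -/

namespace Ruth

variable {G : LieGroupoid.{u}} (R : Ruth G)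

theorem contMDiff_src : ContMDiff R.semidirect.Gam.model R.E.model ∞
    (fun v : R.semidirect.Gam.Tot => R.E.pt v.proj.src (R.semidirect.src v.proj.hom v.snd)) :=
  smoothAlong_id_iff.1 (R.smoothAlong_snd (smoothAlong_self _))

theorem contMDiff_inv : ContMDiff R.semidirect.Gam.model R.semidirect.Gam.model ∞
    (fun v : R.semidirect.Gam.Tot =>
      R.semidirect.Gam.pt ⟨Groupoid.inv v.proj.hom⟩ (R.semidirect.inv v.proj.hom v.snd)) := by
  have h0 := smoothAlong_self (I := R.semidirect.Gam.model) (fun v : R.semidirect.Gam.Tot => v)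
  have hg := R.smoothAlong_proj h0
  have hc := R.smoothAlong_fst h0
  have he := R.smoothAlong_snd h0
  have hi := smoothAlong_inv hg
  have key := R.smoothAlong_pt hi
    (SmoothVB.smoothAlong_add (SmoothVB.smoothAlong_neg (R.smooth_rhoC.smoothAlong hi hc))
      (R.smooth_gamma.smoothAlong hi hg he))
    (SmoothVB.smoothAlong_add (R.smooth_d.smoothAlong hc) (R.smooth_rhoE.smoothAlong hg he))
  exact smoothAlong_id_iff.1 key

theorem contMDiff_one : ContMDiff R.E.model R.semidirect.Gam.model ∞
    (fun e : R.E.Tot => R.semidirect.Gam.pt ⟨𝟙 e.proj⟩ (R.semidirect.one e.proj e.snd)) := by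
  have h0 := smoothAlong_self (I := R.E.model) (fun v : R.E.Tot => v)
  have hx := SmoothVB.smoothAlong_proj h0
  exact smoothAlong_id_iff.1
    (R.smoothAlong_pt (smoothAlong_one hx) (R.C.smoothAlong_zero hx) h0)

theorem smoothAlong_mul :
    SmoothAlong (R.semidirect.Gam.model.prod R.semidirect.Gam.model) R.semidirect.Gam.model
      (fun p : R.semidirect.Composable =>
        (R.semidirect.Gam.pt ⟨p.h⟩ p.a, R.semidirect.Gam.pt ⟨p.g⟩ p.b))
      (fun p => R.semidirect.Gam.pt ⟨p.g ≫ p.h⟩ (R.semidirect.mul p.h p.g p.a p.b p.comp)) := by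
  have h0 := smoothAlong_self (I := R.semidirect.Gam.model.prod R.semidirect.Gam.model)
    (fun p : R.semidirect.Composable =>
      (R.semidirect.Gam.pt ⟨p.h⟩ p.a, R.semidirect.Gam.pt ⟨p.g⟩ p.b))
  have hh := R.smoothAlong_proj h0.fst
  have hg := R.smoothAlong_proj h0.snd
  exact R.smoothAlong_pt (smoothAlong_comp hh hg)
    (SmoothVB.smoothAlong_sub
      (SmoothVB.smoothAlong_add (R.smoothAlong_fst h0.fst)
        (R.smooth_rhoC.smoothAlong hh (R.smoothAlong_fst h0.snd)))
      (R.smooth_gamma.smoothAlong hh hg (R.smoothAlong_snd h0.snd)))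
    (R.smoothAlong_snd h0.snd)

theorem tgt_inv {x y : G.Obj} (g : x ⟶ y) (c : R.C.Fib y) (e : R.E.Fib x) :
    R.d x (-R.rhoC (Groupoid.inv g) c + R.gamma (Groupoid.inv g) g e)
      + R.rhoE (Groupoid.inv g) (R.d y c + R.rhoE g e) = e := by
  have h1 := R.rhoE_d (Groupoid.inv g) c
  have h2 := R.rhoE_rhoE (Groupoid.inv g) g e
  rw [Groupoid.comp_inv, R.rhoE_one] at h2
  simp only [map_add, map_neg]
  linear_combination (norm := module) h1 + h2

theorem inv_mul_fst {x y : G.Obj} (g : x ⟶ y) (c : R.C.Fib y) (e : R.E.Fib x) :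
    (-R.rhoC (Groupoid.inv g) c + R.gamma (Groupoid.inv g) g e) + R.rhoC (Groupoid.inv g) c
      - R.gamma (Groupoid.inv g) g e = 0 := by
  module

theorem mul_inv_fst {x y : G.Obj} (g : x ⟶ y) (c : R.C.Fib y) (e : R.E.Fib x) :
    c + R.rhoC g (-R.rhoC (Groupoid.inv g) c + R.gamma (Groupoid.inv g) g e)
      - R.gamma g (Groupoid.inv g) (R.d y c + R.rhoE g e) = 0 := by
  have h1 := R.rhoC_rhoC g (Groupoid.inv g) c
  have h2 := R.gamma_cocycle g (Groupoid.inv g) g e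
  rw [Groupoid.inv_comp, R.rhoC_one] at h1
  rw [Groupoid.inv_comp, Groupoid.comp_inv, R.gamma_one_left, R.gamma_one_right] at h2
  simp only [map_add, map_neg]
  linear_combination (norm := module) h2 - h1

theorem tgt_mul {x y z : G.Obj} (h : y ⟶ z) (g : x ⟶ y) (c₁ : R.C.Fib z) (c₂ : R.C.Fib y)
    (e : R.E.Fib x) : R.d z (c₁ + R.rhoC h c₂ - R.gamma h g e) + R.rhoE (g ≫ h) e
      = R.d z c₁ + R.rhoE h (R.d y c₂ + R.rhoE g e) := by
  have h1 := R.rhoE_d h c₂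
  have h2 := R.rhoE_rhoE h g e
  simp only [map_add, map_sub]
  linear_combination (norm := module) - h1 - h2

theorem mul_assoc_fst {w x y z : G.Obj} (k : y ⟶ z) (h : x ⟶ y) (g : w ⟶ x)
    (c₁ : R.C.Fib z) (c₂ : R.C.Fib y) (c₃ : R.C.Fib x) (e₂ : R.E.Fib x) (e₃ : R.E.Fib w)
    (he : e₂ = R.d x c₃ + R.rhoE g e₃) :
    c₁ + R.rhoC k c₂ - R.gamma k h e₂ + R.rhoC (h ≫ k) c₃ - R.gamma (h ≫ k) g e₃
      = c₁ + R.rhoC k (c₂ + R.rhoC h c₃ - R.gamma h g e₃) - R.gamma k (g ≫ h) e₃ := by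
  have h1 := R.rhoC_rhoC k h c₃
  have h2 := R.gamma_cocycle k h g e₃
  subst he
  simp only [map_add, map_sub]
  linear_combination (norm := module) - h1 + h2

/-- Equality of points of the semi-direct product, over equal arrows. -/
theorem pt_congr {x y : G.Obj} {g g' : x ⟶ y} (hg : g = g') {c c' : R.C.Fib y} (hc : c = c')
    {e e' : R.E.Fib x} (he : e = e') :
    R.semidirect.Gam.pt ⟨g⟩ ((c, e) : R.C.Fib y × R.E.Fib x)
      = R.semidirect.Gam.pt ⟨g'⟩ ((c', e') : R.C.Fib y × R.E.Fib x) := by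
  subst hg hc he; rfl

end Ruth

/-! ### Submersions and local trivialisations -/

section Submersion

variable {EX HX EY HY EZ HZ X Y Z : Type*}
  [NormedAddCommGroup EX] [NormedSpace ℝ EX] [TopologicalSpace HX]
  [NormedAddCommGroup EY] [NormedSpace ℝ EY] [TopologicalSpace HY]
  [NormedAddCommGroup EZ] [NormedSpace ℝ EZ] [TopologicalSpace HZ]
  [TopologicalSpace X] [ChartedSpace HX X] [TopologicalSpace Y] [ChartedSpace HY Y]
  [TopologicalSpace Z] [ChartedSpace HZ Z]
  {I : ModelWithCorners ℝ EX HX} {J : ModelWithCorners ℝ EY HY} {K : ModelWithCorners ℝ EZ HZ}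

/-- If `f ∘ ψ` is a submersion at `x`, then `f` is one at `ψ x`. -/
theorem surjective_mfderiv_of_eventuallyEq_comp {f : Y → Z} {ψ : X → Y} {k : X → Z} {x : X}
    (hf : MDifferentiableAt J K f (ψ x)) (hψ : MDifferentiableAt I J ψ x)
    (hk : (fun x => f (ψ x)) =ᶠ[𝓝 x] k) (h : Function.Surjective (mfderiv I K k x)) :
    Function.Surjective (mfderiv J K f (ψ x)) := by
  intro w
  obtain ⟨v, hv⟩ := h (show EZ from w)
  have h2 : HasMFDerivAt I K k x ((mfderiv J K f (ψ x)).comp (mfderiv I J ψ x)) :=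
    (hf.hasMFDerivAt.comp x hψ.hasMFDerivAt).congr_of_eventuallyEq hk.symm
  rw [h2.mfderiv] at hv
  exact ⟨_, hv⟩

/-- A map that is a submersion stays one after precomposition with an involution. -/
theorem IsSurjectiveSubmersion.comp_involutive {f : X → Y} (hf : IsSurjectiveSubmersion I J f)
    {i : X → X} (hi : ContMDiff I I ∞ i) (hii : Function.Involutive i) :
    IsSurjectiveSubmersion I J (fun x => f (i x)) where
  smooth := hf.smooth.comp hi
  surjective := hf.surjective.comp hii.surjective
  surjective_mfderiv x := by
    have h1 : MDifferentiableAt I I i (i (i x)) := hi.mdifferentiable (by simp) _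
    have h2 := surjective_mfderiv_of_eventuallyEq_comp (k := fun x => x) (x := i x) h1
      (hi.mdifferentiable (by simp) _) (Filter.Eventually.of_forall hii)
      (fun w => ⟨w, by
        change mfderiv I I id (i x) w = w
        rw [mfderiv_id]
        rfl⟩)
    rw [hii x] at h2
    have h3 : mfderiv I J (f ∘ i) x = _ :=
      mfderiv_comp x (hf.smooth.mdifferentiable (by simp) _) (hi.mdifferentiable (by simp) x)
    intro w
    obtain ⟨v, hv⟩ := hf.surjective_mfderiv (i x) w
    obtain ⟨v', hv'⟩ := h2 v
    refine ⟨v', ?_⟩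
    change mfderiv I J (f ∘ i) x v' = w
    rw [h3, ← hv, ← hv']
    rfl

end Submersion

namespace SmoothVB

variable {EB HB : Type} [NormedAddCommGroup EB] [NormedSpace ℝ EB]
  [TopologicalSpace HB] {I : ModelWithCorners ℝ EB HB}
  {B : Type u} [TopologicalSpace B] [ChartedSpace HB B]
  {EX HX X : Type*} [NormedAddCommGroup EX] [NormedSpace ℝ EX] [TopologicalSpace HX]
  [TopologicalSpace X] [ChartedSpace HX X] {J : ModelWithCorners ℝ EX HX}

/-- The trivialisation of `V` at a point of `B`. -/
abbrev triv (V : SmoothVB I B) (x : B) : Trivialization V.F (π V.F V.Fib) :=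
  trivializationAt V.F V.Fib x

theorem mem_triv (V : SmoothVB I B) (x : B) : x ∈ (V.triv x).baseSet :=
  mem_baseSet_trivializationAt _ _ _

theorem contMDiffWithinAt_symm (V : SmoothVB I B) {a : B} {s : Set X} {x₀ : X} {b : X → B}
    {v : X → V.F} (hb : ContMDiffWithinAt J I ∞ b s x₀)
    (hv : ContMDiffWithinAt J 𝓘(ℝ, V.F) ∞ v s x₀) (ha : b x₀ ∈ (V.triv a).baseSet) :
    ContMDiffWithinAt J V.model ∞ (fun x => V.pt (b x) ((V.triv a).symmₗ ℝ (b x) (v x))) s x₀ := by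
  have h1 : ContMDiffAt (I.prod 𝓘(ℝ, V.F)) V.model ∞ (V.triv a).toOpenPartialHomeomorph.symm
      (b x₀, v x₀) := (V.triv a).contMDiffOn_symm.contMDiffAt
        ((V.triv a).open_target.mem_nhds ((V.triv a).mem_target.2 ha))
  have h2 := h1.comp_contMDiffWithinAt x₀ (f := fun x => (b x, v x)) (hb.prodMk hv)
  have h3 : ∀ x, b x ∈ (V.triv a).baseSet → V.pt (b x) ((V.triv a).symmₗ ℝ (b x) (v x))
      = (V.triv a).toOpenPartialHomeomorph.symm (b x, v x) := by
    intro x hx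
    rw [(V.triv a).symmₗ_apply hx]
    exact (V.triv a).mk_symm hx _
  refine h2.congr_of_eventuallyEq ?_ (h3 x₀ ha)
  filter_upwards [hb.continuousWithinAt.eventually_mem ((V.triv a).open_baseSet.mem_nhds ha)]
    with x hx using h3 x hx

theorem surjective_mfderiv_triv_symm (V : SmoothVB I B) {a x : B} (hx : x ∈ (V.triv a).baseSet)
    (w : V.F) : Function.Surjective (mfderiv (I.prod 𝓘(ℝ, V.F)) V.model
      (V.triv a).toOpenPartialHomeomorph.symm (x, w)) := by
  let e := V.triv a
  let z : V.Tot := e.toOpenPartialHomeomorph.symm (x, w)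
  have hz : z ∈ e.source := e.toOpenPartialHomeomorph.map_target (e.mem_target.2 hx)
  have hez : e z = (x, w) := e.apply_symm_apply (e.mem_target.2 hx)
  have hsymm : MDifferentiableAt (I.prod 𝓘(ℝ, V.F)) V.model
      e.toOpenPartialHomeomorph.symm (x, w) :=
    (e.contMDiffOn_symm.contMDiffAt (n := ∞) (e.open_target.mem_nhds
      (e.mem_target.2 hx))).mdifferentiableAt (by simp)
  change Function.Surjective (mfderiv _ _ e.toOpenPartialHomeomorph.symm (x, w))
  rw [← hez] at hsymm ⊢
  refine surjective_mfderiv_of_eventuallyEq_comp (I := V.model) (ψ := e) (k := id) hsymm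
    ((e.contMDiffOn.contMDiffAt (n := ∞) (e.open_source.mem_nhds hz)).mdifferentiableAt
      (by simp)) ?_ ?_
  · filter_upwards [e.open_source.mem_nhds hz] with z hz
    exact e.toOpenPartialHomeomorph.left_inv hz
  · rw [mfderiv_id]; exact Function.surjective_id

theorem surjective_mfderiv_triv (V : SmoothVB I B) {a : B} {z : V.Tot}
    (hz : z ∈ (V.triv a).source) :
    Function.Surjective (mfderiv V.model (I.prod 𝓘(ℝ, V.F)) (V.triv a) z) := by
  let e := V.triv a
  have hez : e z ∈ e.target := e.toOpenPartialHomeomorph.map_source hz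
  have hsymm : e.toOpenPartialHomeomorph.symm (e z) = z := e.toOpenPartialHomeomorph.left_inv hz
  have hd : MDifferentiableAt V.model (I.prod 𝓘(ℝ, V.F)) e z :=
    (e.contMDiffOn.contMDiffAt (n := ∞) (e.open_source.mem_nhds hz)).mdifferentiableAt (by simp)
  change Function.Surjective (mfderiv _ _ e z)
  rw [← hsymm] at hd ⊢
  refine surjective_mfderiv_of_eventuallyEq_comp (I := I.prod 𝓘(ℝ, V.F))
    (ψ := e.toOpenPartialHomeomorph.symm) (k := id) hd
    ((e.contMDiffOn_symm.contMDiffAt (n := ∞) (e.open_target.mem_nhds hez)).mdifferentiableAt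
      (by simp)) ?_ ?_
  · filter_upwards [e.open_target.mem_nhds hez] with p hp
    exact e.apply_symm_apply hp
  · rw [mfderiv_id]; exact Function.surjective_id

end SmoothVB

/-! ### The Grothendieck construction is a VB-groupoid -/

namespace Ruth

variable {G : LieGroupoid.{u}} (R : Ruth G)

/-- The source map of the semi-direct product is a submersion at `(c₀, g₀, e₀)`: precomposed with
the map `(g, w) ↦ (c(g), g, e(g, w))`, where `c(g)` has the constant coordinate of `c₀` and `e(g, w)`
has the coordinate `w` in trivialisations, it is in coordinates `(g, w) ↦ (s(g), w)`. -/
theorem submersion_src : IsSurjectiveSubmersion R.semidirect.Gam.model R.E.model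
    (fun v : R.semidirect.Gam.Tot => R.E.pt v.proj.src (R.semidirect.src v.proj.hom v.snd)) where
  smooth := R.contMDiff_src
  surjective := by
    rintro ⟨x, e⟩
    exact ⟨R.semidirect.Gam.pt ⟨𝟙 x⟩ ((0, e) : R.C.Fib x × R.E.Fib x), rfl⟩
  surjective_mfderiv := by
    rintro ⟨⟨g₀⟩, v₀⟩
    rename_i x₀ y₀
    obtain ⟨c₀, e₀⟩ := (v₀ : R.C.Fib y₀ × R.E.Fib x₀)
    let eE := R.E.triv x₀
    let eC := R.C.triv y₀
    have hE : x₀ ∈ eE.baseSet := R.E.mem_triv x₀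
    have hC : y₀ ∈ eC.baseSet := R.C.mem_triv y₀
    let N := G.Arr × R.E.F
    let S : Set N := {p | p.1.src ∈ eE.baseSet ∧ p.1.tgt ∈ eC.baseSet}
    have hS : IsOpen S :=
      (eE.open_baseSet.preimage (G.submersion_src.smooth.continuous.comp continuous_fst)).inter
        (eC.open_baseSet.preimage (G.submersion_tgt.smooth.continuous.comp continuous_fst))
    let ι : S → N := Subtype.val
    let K := (𝓡 G.dimArr).prod 𝓘(ℝ, R.E.F)
    let w₀ := eE.linearMapAt ℝ x₀ e₀
    let z₀ := eC.linearMapAt ℝ y₀ c₀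
    have hE' : SmoothAlong K R.E.model ι
        (fun p => R.E.pt p.1.1.src (eE.symmₗ ℝ p.1.1.src p.1.2)) := fun p =>
      ⟨fun q => R.E.pt q.1.src (eE.symmₗ ℝ q.1.src q.2), fun _ => rfl,
        R.E.contMDiffWithinAt_symm ((G.submersion_src.smooth.comp contMDiff_fst) _).contMDiffWithinAt
          contMDiffWithinAt_snd p.2.1⟩
    have hC' : SmoothAlong K R.C.model ι
        (fun p => R.C.pt p.1.1.tgt (eC.symmₗ ℝ p.1.1.tgt z₀)) := fun p =>
      ⟨fun q => R.C.pt q.1.tgt (eC.symmₗ ℝ q.1.tgt z₀), fun _ => rfl,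
        R.C.contMDiffWithinAt_symm ((G.submersion_tgt.smooth.comp contMDiff_fst) _).contMDiffWithinAt
          contMDiffWithinAt_const p.2.2⟩
    let p₀ : S := ⟨(⟨g₀⟩, w₀), hE, hC⟩
    obtain ⟨Ψ, hΨ, sΨ⟩ := R.smoothAlong_pt (smoothAlong_self ι).fst hC' hE' p₀
    have hΨ₀ : Ψ p₀.1 = R.semidirect.Gam.pt ⟨g₀⟩ ((c₀, e₀) : R.C.Fib y₀ × R.E.Fib x₀) :=
      (hΨ p₀).trans (congrArg (R.semidirect.Gam.pt ⟨g₀⟩) (Prod.ext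
        (eC.symmₗ_linearMapAt hC c₀) (eE.symmₗ_linearMapAt hE e₀)))
    have hrange : Set.range ι ∈ 𝓝 p₀.1 := by
      rw [Subtype.range_coe]
      exact hS.mem_nhds p₀.2
    have sΨ' : ContMDiffAt K R.semidirect.Gam.model ∞ Ψ p₀.1 := sΨ.contMDiffAt hrange
    have hsymm : MDifferentiableAt ((𝓡 G.dimObj).prod 𝓘(ℝ, R.E.F)) R.E.model
        eE.toOpenPartialHomeomorph.symm (x₀, w₀) :=
      (eE.contMDiffOn_symm.contMDiffAt (n := ∞) (eE.open_target.mem_nhds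
        (eE.mem_target.2 hE))).mdifferentiableAt (by simp)
    have hs : HasMFDerivAt K ((𝓡 G.dimObj).prod 𝓘(ℝ, R.E.F)) (fun q : N => (q.1.src, q.2)) p₀.1
        _ :=
      (G.submersion_src.smooth.mdifferentiable (by simp) _).hasMFDerivAt.prodMap
        (mdifferentiableAt_id (I := 𝓘(ℝ, R.E.F)) (x := p₀.1.2)).hasMFDerivAt
    rw [mfderiv_id] at hs
    have hk := hsymm.hasMFDerivAt.comp (f := fun q : N => (q.1.src, q.2)) p₀.1 hs
    have key := surjective_mfderiv_of_eventuallyEq_comp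
      (k := fun q : N => eE.toOpenPartialHomeomorph.symm (q.1.src, q.2))
      (R.contMDiff_src.mdifferentiable (by simp) (Ψ p₀.1)) (sΨ'.mdifferentiableAt (by simp))
      (by
        filter_upwards [hrange] with q hq
        obtain ⟨p, rfl⟩ := hq
        rw [hΨ]
        refine Eq.trans (congrArg (R.E.pt p.1.1.src) ?_) (eE.mk_symm p.2.1 p.1.2)
        exact eE.symmₗ_apply p.2.1 p.1.2) (by
        change Function.Surjective (mfderiv K R.E.model
          (eE.toOpenPartialHomeomorph.symm ∘ fun q : N => (q.1.src, q.2)) p₀.1)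
        rw [hk.mfderiv]
        refine (R.E.surjective_mfderiv_triv_symm hE w₀).comp ?_
        exact (G.submersion_src.surjective_mfderiv ⟨g₀⟩).prodMap Function.surjective_id)
    rw [hΨ₀] at key
    exact key

theorem inv_inv_hom {x y : G.Obj} (g : x ⟶ y) : Groupoid.inv (Groupoid.inv g) = g := by
  simp [Groupoid.inv_eq_inv]

theorem inv_inv_fst {x y : G.Obj} (g : x ⟶ y) (c : R.C.Fib y) (e : R.E.Fib x) :
    -R.rhoC (Groupoid.inv (Groupoid.inv g))
        (-R.rhoC (Groupoid.inv g) c + R.gamma (Groupoid.inv g) g e)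
      + R.gamma (Groupoid.inv (Groupoid.inv g)) (Groupoid.inv g) (R.d y c + R.rhoE g e) = c := by
  have h := R.mul_inv_fst g c e
  rw [inv_inv_hom]
  linear_combination (norm := module) -h

theorem involutive_inv : Function.Involutive (fun v : R.semidirect.Gam.Tot =>
      R.semidirect.Gam.pt ⟨Groupoid.inv v.proj.hom⟩ (R.semidirect.inv v.proj.hom v.snd)) := by
  rintro ⟨⟨g⟩, v⟩
  rename_i x y
  obtain ⟨c, e⟩ := (v : R.C.Fib y × R.E.Fib x)
  exact R.pt_congr (inv_inv_hom g) (R.inv_inv_fst g c e) (R.tgt_inv g c e)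

theorem tgt_one (x : G.Obj) (e : R.E.Fib x) : R.d x 0 + R.rhoE (𝟙 x) e = e := by
  rw [map_zero, R.rhoE_one, zero_add]

theorem mul_one_fst {x y : G.Obj} (g : x ⟶ y) (c : R.C.Fib y) (e : R.E.Fib x) :
    c + R.rhoC g 0 - R.gamma g (𝟙 x) e = c := by
  rw [R.gamma_one_right, map_zero, add_zero, sub_zero]

theorem one_mul_fst {x y : G.Obj} (g : x ⟶ y) (c : R.C.Fib y) (e : R.E.Fib x) :
    0 + R.rhoC (𝟙 y) c - R.gamma (𝟙 y) g e = c := by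
  rw [R.gamma_one_left, R.rhoC_one, zero_add, sub_zero]

theorem mul_add_fst {x y z : G.Obj} (h : y ⟶ z) (g : x ⟶ y) (c₁ c₁' : R.C.Fib z)
    (c₂ c₂' : R.C.Fib y) (e e' : R.E.Fib x) :
    (c₁ + c₁') + R.rhoC h (c₂ + c₂') - R.gamma h g (e + e') =
      (c₁ + R.rhoC h c₂ - R.gamma h g e) + (c₁' + R.rhoC h c₂' - R.gamma h g e') := by
  simp only [map_add]
  module

theorem mul_smul_fst {x y z : G.Obj} (h : y ⟶ z) (g : x ⟶ y) (r : ℝ) (c₁ : R.C.Fib z)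
    (c₂ : R.C.Fib y) (e : R.E.Fib x) :
    r • c₁ + R.rhoC h (r • c₂) - R.gamma h g (r • e) =
      r • (c₁ + R.rhoC h c₂ - R.gamma h g e) := by
  simp only [map_smul]
  module

theorem isVBGroupoid : R.semidirect.IsVBGroupoid where
  src_one _ _ := rfl
  tgt_one x e := R.tgt_one x e
  src_mul _ _ _ _ _ := rfl
  tgt_mul {x y z} h g a b hab := by
    obtain ⟨c₁, e₁⟩ := (a : R.C.Fib z × R.E.Fib y)
    obtain ⟨c₂, e₂⟩ := (b : R.C.Fib y × R.E.Fib x)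
    change e₁ = R.d y c₂ + R.rhoE g e₂ at hab
    subst hab
    exact R.tgt_mul h g c₁ c₂ e₂
  mul_assoc k h g a b c hab hbc hab_c ha_bc :=
    R.pt_congr (Category.assoc _ _ _).symm
      (R.mul_assoc_fst k h g a.1 b.1 c.1 b.2 c.2 hbc) rfl
  mul_one g a _ := R.pt_congr (Category.id_comp _) (R.mul_one_fst g a.1 a.2) rfl
  one_mul g a _ := R.pt_congr (Category.comp_id _) (R.one_mul_fst g a.1 a.2) rfl
  src_inv _ _ := rfl
  tgt_inv g a := R.tgt_inv g a.1 a.2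
  inv_mul g a h := R.pt_congr (Groupoid.comp_inv _) (R.inv_mul_fst g a.1 a.2) rfl
  mul_inv g a h := R.pt_congr (Groupoid.inv_comp _) (R.mul_inv_fst g a.1 a.2) rfl
  mul_add h g a a' b b' _ _ _ := Prod.ext (R.mul_add_fst h g a.1 a'.1 b.1 b'.1 b.2 b'.2) rfl
  mul_smul h g r a b _ _ := Prod.ext (R.mul_smul_fst h g r a.1 b.1 b.2) rfl
  submersion_src := R.submersion_src
  submersion_tgt := R.submersion_src.comp_involutive R.contMDiff_inv R.involutive_inv
  smooth_one := R.contMDiff_one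
  smooth_inv := R.contMDiff_inv
  smooth_mul := R.smoothAlong_mul

end Ruth

/-! ### Morphisms of representations up to homotopy and VB-maps -/

namespace RuthTriple

variable {G : LieGroupoid.{u}} {R R' : Ruth G} {T : RuthTriple R R'}

theorem IsMorphism.mu_one (hT : T.IsMorphism) (x : G.Obj) (e : R.E.Fib x) : T.mu (𝟙 x) e = 0 := by
  have h := hT.comm_gamma (𝟙 x) (𝟙 x) e
  rw [Category.comp_id, R.gamma_one_left, R'.gamma_one_left, R.rhoE_one, R'.rhoC_one, map_zero] at h
  linear_combination (norm := module) h

theorem IsMorphism.comm_tgt (hT : T.IsMorphism) {x y : G.Obj} (g : x ⟶ y) (c : R.C.Fib y)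
    (e : R.E.Fib x) : R'.d y (T.PhiC y c + T.mu g e) + R'.rhoE g (T.PhiE x e)
      = T.PhiE y (R.d y c + R.rhoE g e) := by
  have h1 := hT.comm_d y c
  have h2 := hT.comm_rhoE g e
  simp only [map_add]
  linear_combination (norm := module) h1 + h2

theorem IsMorphism.comm_mul (hT : T.IsMorphism) {x y z : G.Obj} (h : y ⟶ z) (g : x ⟶ y)
    (c₁ : R.C.Fib z) (c₂ : R.C.Fib y) (e₁ : R.E.Fib y) (e : R.E.Fib x)
    (he : e₁ = R.d y c₂ + R.rhoE g e) :
    T.PhiC z (c₁ + R.rhoC h c₂ - R.gamma h g e) + T.mu (g ≫ h) e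
      = (T.PhiC z c₁ + T.mu h e₁) + R'.rhoC h (T.PhiC y c₂ + T.mu g e)
        - R'.gamma h g (T.PhiE x e) := by
  have h1 := hT.comm_rhoC h c₂
  have h2 := hT.comm_gamma h g e
  subst he
  simp only [map_add, map_sub]
  linear_combination (norm := module) h1 - h2

theorem IsMorphism.comm_inv (hT : T.IsMorphism) {x y : G.Obj} (g : x ⟶ y) (c : R.C.Fib y)
    (e : R.E.Fib x) :
    T.PhiC x (-R.rhoC (Groupoid.inv g) c + R.gamma (Groupoid.inv g) g e)
        + T.mu (Groupoid.inv g) (R.d y c + R.rhoE g e)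
      = -R'.rhoC (Groupoid.inv g) (T.PhiC y c + T.mu g e)
        + R'.gamma (Groupoid.inv g) g (T.PhiE x e) := by
  have h1 := hT.comm_rhoC (Groupoid.inv g) c
  have h2 := hT.comm_gamma (Groupoid.inv g) g e
  rw [Groupoid.comp_inv, hT.mu_one] at h2
  simp only [map_add, map_neg]
  linear_combination (norm := module) h2 - h1

theorem IsMorphism.isVBMap (hT : T.IsMorphism) : T.semidirectMap.IsVBMap where
  smooth_obj := hT.smooth_PhiE
  smooth_arr := by
    have h0 := smoothAlong_self (I := R.semidirect.Gam.model) (fun v : R.semidirect.Gam.Tot => v)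
    have hg := R.smoothAlong_proj h0
    have hc := R.smoothAlong_fst h0
    have he := R.smoothAlong_snd h0
    exact smoothAlong_id_iff.1 (R'.smoothAlong_pt hg
      (SmoothVB.smoothAlong_add (hT.smooth_PhiC.smoothAlong hc) (hT.smooth_mu.smoothAlong hg he))
      (hT.smooth_PhiE.smoothAlong he))
  comm_src _ _ := rfl
  comm_tgt g a := hT.comm_tgt g a.1 a.2
  comm_one x e := by
    refine Prod.ext ?_ rfl
    change T.PhiC x 0 + T.mu (𝟙 x) (show R.E.Fib x from e) = 0
    rw [map_zero, hT.mu_one, add_zero]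
  comm_inv g a := Prod.ext (hT.comm_inv g a.1 a.2) (hT.comm_tgt g a.1 a.2).symm
  comm_mul h g a b hab _ := Prod.ext (hT.comm_mul h g a.1 b.1 a.2 b.2 hab) rfl

theorem isMorphism_of_isVBMap (hT : T.semidirectMap.IsVBMap) : T.IsMorphism := by
  have tgt : ∀ {x y : G.Obj} (g : x ⟶ y) (c : R.C.Fib y) (e : R.E.Fib x),
      R'.d y (T.PhiC y c + T.mu g e) + R'.rhoE g (T.PhiE x e)
        = T.PhiE y (R.d y c + R.rhoE g e) :=
    fun {x y} g c e => hT.comm_tgt g ((c, e) : R.C.Fib y × R.E.Fib x)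
  have mul : ∀ {x y z : G.Obj} (h : y ⟶ z) (g : x ⟶ y) (c₂ : R.C.Fib y) (e : R.E.Fib x),
      T.PhiC z (0 + R.rhoC h c₂ - R.gamma h g e) + T.mu (g ≫ h) e
        = (T.PhiC z 0 + T.mu h (R.d y c₂ + R.rhoE g e))
          + R'.rhoC h (T.PhiC y c₂ + T.mu g e) - R'.gamma h g (T.PhiE x e) :=
    fun {x y z} h g c₂ e => congrArg Prod.fst
      (hT.comm_mul h g ((0, R.d y c₂ + R.rhoE g e) : R.C.Fib z × R.E.Fib y)
        ((c₂, e) : R.C.Fib y × R.E.Fib x) rfl (tgt g c₂ e).symm)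
  constructor
  · exact hT.smooth_obj
  · have h0 := smoothAlong_self (I := R.C.model) (fun v : R.C.Tot => v)
    have hx := SmoothVB.smoothAlong_proj h0
    have h1 := R'.smoothAlong_fst (hT.smooth_arr.comp_smoothAlong
      (R.smoothAlong_pt (smoothAlong_one hx) h0 (R.E.smoothAlong_zero hx)))
    refine smoothAlong_id_iff.1 (SmoothAlong.congr h1 fun c => ?_)
    change R'.C.pt c.proj (T.PhiC c.proj c.snd + T.mu (𝟙 c.proj) 0) = _
    rw [map_zero, add_zero]
  · have h0 := smoothAlong_self (I := (𝓡 G.dimArr).prod R.E.model)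
      (fun p : (Σ a : G.Arr, R.E.Fib a.src) => (p.1, R.E.pt p.1.src p.2))
    have h1 := R'.smoothAlong_fst (hT.smooth_arr.comp_smoothAlong
      (R.smoothAlong_pt h0.fst (R.C.smoothAlong_zero (smoothAlong_tgt h0.fst)) h0.snd))
    refine SmoothAlong.congr h1 fun p => ?_
    change R'.C.pt p.1.tgt (T.PhiC p.1.tgt 0 + T.mu p.1.hom p.2) = _
    rw [map_zero, zero_add]
  · intro x c
    have h := tgt (𝟙 x) c 0
    simp only [map_zero, add_zero] at h
    rw [h, sub_self]
  · intro x y g e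
    have h := tgt g 0 e
    simp only [map_zero, zero_add] at h
    rw [add_comm, sub_eq_zero]
    exact h
  · intro x y g c
    have h := mul g (𝟙 x) (R.rhoC (𝟙 x) c) 0
    simp only [map_zero, zero_add, add_zero, sub_zero, R.rhoC_one] at h
    rw [h]
    module
  · intro x y z g h e
    have h := mul g h 0 e
    simp only [map_zero, zero_add, zero_sub, map_neg] at h
    linear_combination (norm := module) -h

/-- The triple determined by a pair of families of linear maps between semi-direct products. -/
def ofVBMapData (Ψ : VBMapData R.semidirect R'.semidirect) : RuthTriple R R' where
  PhiE := Ψ.obj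
  PhiC := fun y => LinearMap.fst ℝ (R'.C.Fib y) (R'.E.Fib y) ∘ₗ Ψ.arr (𝟙 y) ∘ₗ
    LinearMap.inl ℝ (R.C.Fib y) (R.E.Fib y)
  mu := fun {x y} g => LinearMap.fst ℝ (R'.C.Fib y) (R'.E.Fib x) ∘ₗ Ψ.arr g ∘ₗ
    LinearMap.inr ℝ (R.C.Fib y) (R.E.Fib x)

theorem ofVBMapData_semidirectMap (T : RuthTriple R R') : ofVBMapData T.semidirectMap = T := by
  refine RuthTriple.ext rfl ?_ ?_
  · funext y
    refine LinearMap.ext fun c => ?_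
    change T.PhiC y c + T.mu (𝟙 y) 0 = T.PhiC y c
    rw [map_zero, add_zero]
  · funext x y g
    refine LinearMap.ext fun e => ?_
    change T.PhiC y 0 + T.mu g e = T.mu g e
    rw [map_zero, zero_add]

/-- On the core part a VB-map does not depend on the arrow, because `(c, g, 0)` is the product of
`(c, 1, 0)` and `(0, g, 0)`. -/
theorem _root_.LieGpd.VBMapData.IsVBMap.arr_core {Ψ : VBMapData R.semidirect R'.semidirect}
    (hΨ : Ψ.IsVBMap) {x y : G.Obj} (g : x ⟶ y) (c : R.C.Fib y) :
    (show R'.C.Fib y × R'.E.Fib x from Ψ.arr g ((c, 0) : R.C.Fib y × R.E.Fib x)).1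
      = (show R'.C.Fib y × R'.E.Fib y from Ψ.arr (𝟙 y) ((c, 0) : R.C.Fib y × R.E.Fib y)).1 := by
  have hcongr : ∀ g' : x ⟶ y, g' = g →
      (show R'.C.Fib y × R'.E.Fib x from Ψ.arr g' ((c, 0) : R.C.Fib y × R.E.Fib x)).1
        = (show R'.C.Fib y × R'.E.Fib x from Ψ.arr g ((c, 0) : R.C.Fib y × R.E.Fib x)).1 := by
    rintro _ rfl; rfl
  rw [← hcongr (g ≫ 𝟙 y) (Category.comp_id g)]
  have hab : R.semidirect.src (𝟙 y) ((c, 0) : R.C.Fib y × R.E.Fib y) = R.semidirect.tgt g 0 :=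
    (map_zero (R.semidirect.tgt g)).symm
  have hab' : R'.semidirect.src (𝟙 y) (Ψ.arr (𝟙 y) ((c, 0) : R.C.Fib y × R.E.Fib y))
      = R'.semidirect.tgt g (Ψ.arr g 0) :=
    (hΨ.comm_src _ _).trans ((congrArg (Ψ.obj y) hab).trans (hΨ.comm_tgt g 0).symm)
  have h := hΨ.comm_mul (𝟙 y) g ((c, 0) : R.C.Fib y × R.E.Fib y) 0 hab hab'
  have hm : R.semidirect.mul (𝟙 y) g ((c, 0) : R.C.Fib y × R.E.Fib y) 0 hab
      = ((c, 0) : R.C.Fib y × R.E.Fib x) := by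
    refine Prod.ext ?_ rfl
    change c + R.rhoC (𝟙 y) 0 - R.gamma (𝟙 y) g 0 = c
    rw [map_zero, map_zero, add_zero, sub_zero]
  have hz : Ψ.arr g 0 = 0 := map_zero (Ψ.arr g)
  have hm' : ∀ (a : R'.C.Fib y × R'.E.Fib y) (b : R'.semidirect.Gam.Fib ⟨g⟩) (hb : b = 0)
      (hab : R'.semidirect.src (𝟙 y) a = R'.semidirect.tgt g b),
      (show R'.C.Fib y × R'.E.Fib x from R'.semidirect.mul (𝟙 y) g a b hab).1 = a.1 := by
    rintro a _ rfl hab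
    change a.1 + R'.rhoC (𝟙 y) 0 - R'.gamma (𝟙 y) g 0 = a.1
    rw [map_zero, map_zero, add_zero, sub_zero]
  rw [hm] at h
  exact (congrArg Prod.fst h).trans (hm' _ _ hz _)

theorem semidirectMap_ofVBMapData {Ψ : VBMapData R.semidirect R'.semidirect} (hΨ : Ψ.IsVBMap) :
    (ofVBMapData Ψ).semidirectMap = Ψ := by
  refine VBMapData.ext rfl ?_
  funext x y g
  refine LinearMap.ext fun v => ?_
  obtain ⟨c, e⟩ := (v : R.C.Fib y × R.E.Fib x)
  refine Prod.ext ?_ (hΨ.comm_src g ((c, e) : R.C.Fib y × R.E.Fib x)).symm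
  have h : Ψ.arr g ((c, e) : R.C.Fib y × R.E.Fib x)
      = Ψ.arr g ((c, 0) : R.C.Fib y × R.E.Fib x) + Ψ.arr g ((0, e) : R.C.Fib y × R.E.Fib x) := by
    refine Eq.trans (congrArg (Ψ.arr g) ?_) (map_add (Ψ.arr g) _ _)
    exact Prod.ext (add_zero c).symm (zero_add e).symm
  refine Eq.trans ?_ (congrArg Prod.fst h).symm
  change (show R'.C.Fib y × R'.E.Fib y from Ψ.arr (𝟙 y) ((c, 0) : R.C.Fib y × R.E.Fib y)).1
    + (show R'.C.Fib y × R'.E.Fib x from Ψ.arr g ((0, e) : R.C.Fib y × R.E.Fib x)).1 =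
    (show R'.C.Fib y × R'.E.Fib x from Ψ.arr g ((c, 0) : R.C.Fib y × R.E.Fib x)).1
    + (show R'.C.Fib y × R'.E.Fib x from Ψ.arr g ((0, e) : R.C.Fib y × R.E.Fib x)).1
  rw [hΨ.arr_core g c]

theorem existsUnique_of_isVBMap {Ψ : VBMapData R.semidirect R'.semidirect} (hΨ : Ψ.IsVBMap) :
    ∃! T : RuthTriple R R', T.IsMorphism ∧ T.semidirectMap = Ψ := by
  have h := semidirectMap_ofVBMapData hΨ
  refine ⟨ofVBMapData Ψ, ⟨isMorphism_of_isVBMap (h.symm ▸ hΨ), h⟩, ?_⟩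
  rintro T ⟨-, rfl⟩
  exact (ofVBMapData_semidirectMap T).symm

end RuthTriple

/-! ### Families of linear maps in local trivialisations -/

theorem contMDiffWithinAt_clm_of_apply {EX HX X K L : Type*}
    [NormedAddCommGroup EX] [NormedSpace ℝ EX] [TopologicalSpace HX]
    [TopologicalSpace X] [ChartedSpace HX X] {J : ModelWithCorners ℝ EX HX}
    [NormedAddCommGroup K] [NormedSpace ℝ K] [FiniteDimensional ℝ K]
    [NormedAddCommGroup L] [NormedSpace ℝ L] [FiniteDimensional ℝ L]
    {f : X → K →L[ℝ] L} {s : Set X} {x : X}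
    (h : ∀ v, ContMDiffWithinAt J 𝓘(ℝ, L) ∞ (fun y => f y v) s x) :
    ContMDiffWithinAt J 𝓘(ℝ, K →L[ℝ] L) ∞ f s x := by
  let b := Module.finBasis ℝ K
  let T : (Fin (Module.finrank ℝ K) → L) →L[ℝ] (K →L[ℝ] L) := LinearMap.toContinuousLinearMap
    ((LinearMap.toContinuousLinearMap (𝕜 := ℝ) (E := K) (F' := L)).toLinearMap ∘ₗ
      (b.constr ℝ (M' := L)).toLinearMap)
  have hT : f = fun y => T (fun i => f y (b i)) := by
    funext y
    refine ContinuousLinearMap.coe_injective (b.ext fun i => ?_)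
    simp [T]
  rw [hT]
  exact T.contMDiff.contMDiffAt.comp_contMDiffWithinAt x
    (contMDiffWithinAt_pi_space.2 fun i => h (b i))

namespace SmoothVB

variable {EB HB : Type} [NormedAddCommGroup EB] [NormedSpace ℝ EB]
  [TopologicalSpace HB] {I : ModelWithCorners ℝ EB HB}
  {B : Type u} [TopologicalSpace B] [ChartedSpace HB B]
  {EX HX X : Type*} [NormedAddCommGroup EX] [NormedSpace ℝ EX] [TopologicalSpace HX]
  [TopologicalSpace X] [ChartedSpace HX X] {J : ModelWithCorners ℝ EX HX}

instance finiteDimensional_fib (V : SmoothVB I B) (x : B) : FiniteDimensional ℝ (V.Fib x) :=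
  ((V.triv x).linearEquivAt ℝ x (V.mem_triv x)).symm.finiteDimensional

theorem finrank_fib (V : SmoothVB I B) (x : B) :
    Module.finrank ℝ (V.Fib x) = Module.finrank ℝ V.F :=
  ((V.triv x).linearEquivAt ℝ x (V.mem_triv x)).finrank_eq

/-- The matrix of a family of linear maps `V_x → W_x` in the trivialisations of `V` at `a` and
of `W` at `b`. -/
def coord {V W : SmoothVB I B} (φ : ∀ x, V.Fib x →ₗ[ℝ] W.Fib x) (a b x : B) : V.F →L[ℝ] W.F :=
  LinearMap.toContinuousLinearMap
    ((W.triv b).linearMapAt ℝ x ∘ₗ φ x ∘ₗ (V.triv a).symmₗ ℝ x)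

theorem coord_apply {V W : SmoothVB I B} (φ : ∀ x, V.Fib x →ₗ[ℝ] W.Fib x) (a b x : B) (v : V.F) :
    coord φ a b x v = (W.triv b).linearMapAt ℝ x (φ x ((V.triv a).symmₗ ℝ x v)) := rfl

theorem contMDiffWithinAt_linearMapAt (V : SmoothVB I B) {a : B} {s : Set X} {x₀ : X} {b : X → B}
    {v : ∀ x, V.Fib (b x)}
    (hv : ContMDiffWithinAt J V.model ∞ (fun x => V.pt (b x) (v x)) s x₀)
    (ha : b x₀ ∈ (V.triv a).baseSet) :
    ContMDiffWithinAt J 𝓘(ℝ, V.F) ∞ (fun x => (V.triv a).linearMapAt ℝ (b x) (v x)) s x₀ := by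
  have h := ((V.triv a).contMDiffWithinAt_iff ((V.triv a).mem_source.2 ha)).1 hv
  have h3 : ∀ x, b x ∈ (V.triv a).baseSet → (V.triv a).linearMapAt ℝ (b x) (v x)
      = (V.triv a (V.pt (b x) (v x))).2 := by
    intro x hx
    rw [(V.triv a).coe_linearMapAt_of_mem hx]
  refine h.2.congr_of_eventuallyEq ?_ (h3 x₀ ha)
  filter_upwards [h.1.continuousWithinAt.eventually_mem ((V.triv a).open_baseSet.mem_nhds ha)]
    with x hx using h3 x hx

theorem IsSmoothHom.contMDiffAt_coord {V W : SmoothVB I B} {φ : ∀ x, V.Fib x →ₗ[ℝ] W.Fib x}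
    (hφ : V.IsSmoothHom W φ) {a b x : B} (ha : x ∈ (V.triv a).baseSet)
    (hb : x ∈ (W.triv b).baseSet) :
    ContMDiffAt I 𝓘(ℝ, V.F →L[ℝ] W.F) ∞ (coord φ a b) x :=
  contMDiffWithinAt_clm_of_apply fun _ => W.contMDiffWithinAt_linearMapAt
    (ContMDiffAt.comp_contMDiffWithinAt x hφ.contMDiffAt
      (V.contMDiffWithinAt_symm contMDiffWithinAt_id contMDiffWithinAt_const ha)) hb

end SmoothVB

/-! ### The image of a smooth idempotent of constant rank -/

/-- A smooth family `P` of idempotent endomorphisms of a vector bundle `V` whose images all have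
the dimension of a fixed vector space `K`. -/
structure SmoothIdempotent {EB HB : Type} [NormedAddCommGroup EB] [NormedSpace ℝ EB]
    [TopologicalSpace HB] {I : ModelWithCorners ℝ EB HB}
    {B : Type u} [TopologicalSpace B] [ChartedSpace HB B] (V : SmoothVB I B)
    (K : Type u) [NormedAddCommGroup K] [NormedSpace ℝ K] where
  P : ∀ x, V.Fib x →ₗ[ℝ] V.Fib x
  smooth : V.IsSmoothHom V P
  idem : ∀ x v, P x (P x v) = P x v
  finrank_eq : ∀ x, Module.finrank ℝ (LinearMap.range (P x)) = Module.finrank ℝ K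

namespace SmoothIdempotent

variable {EB HB : Type} [NormedAddCommGroup EB] [NormedSpace ℝ EB]
  [TopologicalSpace HB] {I : ModelWithCorners ℝ EB HB}
  {B : Type u} [TopologicalSpace B] [ChartedSpace HB B] {V : SmoothVB I B}
  {K : Type u} [NormedAddCommGroup K] [NormedSpace ℝ K] [FiniteDimensional ℝ K]
  (S : SmoothIdempotent V K)

open SmoothVB

/-- An identification of `K` with the image of `P_a`. -/
def equivRange (a : B) : K ≃ₗ[ℝ] LinearMap.range (S.P a) :=
  LinearEquiv.ofFinrankEq _ _ (S.finrank_eq a).symm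

/-- The inclusion `K ≃ im P_a ⊆ V_a`, in the trivialisation of `V` at `a`. -/
def incl (a : B) : K →L[ℝ] V.F :=
  LinearMap.toContinuousLinearMap ((V.triv a).linearMapAt ℝ a ∘ₗ
    (LinearMap.range (S.P a)).subtype ∘ₗ (S.equivRange a).toLinearMap)

/-- The projection `P_a : V_a → im P_a ≃ K`, in the trivialisation of `V` at `a`. -/
def projK (a : B) : V.F →L[ℝ] K :=
  LinearMap.toContinuousLinearMap ((S.equivRange a).symm.toLinearMap ∘ₗ
    (S.P a).rangeRestrict ∘ₗ (V.triv a).symmₗ ℝ a)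

/-- The endomorphism `B_a P_x A_a` of `K`, where `A_a` is `incl a` and `B_a` is `projK a`. It is
the identity at `x = a`, and where it is invertible, `P_x A_a` is a frame of the image of `P_x`. -/
def gram (a x : B) : K →L[ℝ] K := S.projK a ∘L coord S.P a a x ∘L S.incl a

theorem gram_self (a : B) : S.gram a a = 1 := by
  ext k
  have h : S.P a (S.equivRange a k) = S.equivRange a k := by
    obtain ⟨v, hv⟩ := (S.equivRange a k).2
    rw [← hv, S.idem]
  simp only [gram, projK, incl, coord, ContinuousLinearMap.comp_apply,
    LinearMap.coe_toContinuousLinearMap', LinearMap.comp_apply, Submodule.subtype_apply,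
    LinearEquiv.coe_coe, Trivialization.symmₗ_linearMapAt _ (V.mem_triv a), h]
  rw [one_apply_eq_self, LinearEquiv.symm_apply_eq]
  exact Subtype.ext h

/-- The set of points over which `P A_a` is a frame of the image of `P`. -/
def frameSet (a : B) : Set B := {x | x ∈ (V.triv a).baseSet ∧ IsUnit (S.gram a x)}

theorem mem_frameSet (a : B) : a ∈ S.frameSet a :=
  ⟨V.mem_triv a, by rw [gram_self]; exact isUnit_one⟩

theorem contMDiffAt_gram {a x : B} (hx : x ∈ (V.triv a).baseSet) :
    ContMDiffAt I 𝓘(ℝ, K →L[ℝ] K) ∞ (S.gram a) x :=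
  contMDiffAt_const.clm_comp ((S.smooth.contMDiffAt_coord hx hx).clm_comp contMDiffAt_const)

theorem isOpen_frameSet (a : B) : IsOpen (S.frameSet a) := by
  have h : ContinuousOn (S.gram a) (V.triv a).baseSet :=
    fun x hx => (S.contMDiffAt_gram hx).continuousAt.continuousWithinAt
  exact h.isOpen_inter_preimage (V.triv a).open_baseSet Units.isOpen

theorem contMDiffAt_inverse_gram {a x : B} (hx : x ∈ S.frameSet a) :
    ContMDiffAt I 𝓘(ℝ, K →L[ℝ] K) ∞ (fun y => Ring.inverse (S.gram a y)) x := by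
  obtain ⟨u, hu⟩ := hx.2
  have h := contDiffAt_ringInverse ℝ (n := ∞) u
  rw [hu] at h
  exact h.contMDiffAt.comp x (S.contMDiffAt_gram hx.1)

/-- The frame `P_x A_a : K → V_x`. -/
def frame (a x : B) : K →ₗ[ℝ] V.Fib x :=
  S.P x ∘ₗ (V.triv a).symmₗ ℝ x ∘ₗ (S.incl a).toLinearMap

/-- The coframe `(B_a P_x A_a)⁻¹ B_a P_x : V_x → K`. -/
def coframe (a x : B) : V.Fib x →ₗ[ℝ] K :=
  (Ring.inverse (S.gram a x) ∘L S.projK a).toLinearMap ∘ₗ (V.triv a).linearMapAt ℝ x ∘ₗ S.P x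

theorem coframe_apply (a x : B) (v : V.Fib x) : S.coframe a x v =
    Ring.inverse (S.gram a x) (S.projK a ((V.triv a).linearMapAt ℝ x (S.P x v))) := rfl

theorem frame_apply (a x : B) (k : K) :
    S.frame a x k = S.P x ((V.triv a).symmₗ ℝ x (S.incl a k)) := rfl

theorem coframe_P (a x : B) (v : V.Fib x) : S.coframe a x (S.P x v) = S.coframe a x v := by
  rw [coframe_apply, coframe_apply, S.idem]

theorem P_frame (a x : B) (k : K) : S.P x (S.frame a x k) = S.frame a x k := by
  rw [frame_apply, S.idem]

theorem coframe_frame {a x : B} (hx : x ∈ S.frameSet a) (k : K) :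
    S.coframe a x (S.frame a x k) = k := by
  rw [coframe_apply, frame_apply, S.idem]
  change (Ring.inverse (S.gram a x) * S.gram a x) k = k
  rw [Ring.inverse_mul_cancel _ hx.2]
  rfl

theorem frame_coframe {a x : B} (hx : x ∈ S.frameSet a) (v : V.Fib x) :
    S.frame a x (S.coframe a x v) = S.P x v := by
  have hinj : Function.Injective (S.frame a x) :=
    Function.LeftInverse.injective (S.coframe_frame hx)
  -- The image of the frame lies in that of `P_x` and has the same dimension.
  have hrange : LinearMap.range (S.frame a x) = LinearMap.range (S.P x) := by
    refine Submodule.eq_of_le_of_finrank_eq ?_ ?_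
    · rintro _ ⟨k, rfl⟩
      exact ⟨_, rfl⟩
    · rw [LinearMap.finrank_range_of_inj hinj, S.finrank_eq]
  obtain ⟨k, hk⟩ : S.P x v ∈ LinearMap.range (S.frame a x) := hrange ▸ ⟨v, rfl⟩
  rw [← S.coframe_P, ← hk, S.coframe_frame hx]

theorem contMDiffWithinAt_coframe {EX HX X : Type*} [NormedAddCommGroup EX] [NormedSpace ℝ EX]
    [TopologicalSpace HX] [TopologicalSpace X] [ChartedSpace HX X] {J : ModelWithCorners ℝ EX HX}
    {a : B} {s : Set X} {x₀ : X} {b : X → B} {v : ∀ x, V.Fib (b x)}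
    (hv : ContMDiffWithinAt J V.model ∞ (fun x => V.pt (b x) (v x)) s x₀)
    (ha : b x₀ ∈ S.frameSet a) :
    ContMDiffWithinAt J 𝓘(ℝ, K) ∞ (fun x => S.coframe a (b x) (v x)) s x₀ := by
  have hb : ContMDiffWithinAt J I ∞ b s x₀ :=
    (contMDiffAt_proj V.Fib).comp_contMDiffWithinAt x₀ hv
  have h1 := ((S.contMDiffAt_inverse_gram ha).comp_contMDiffWithinAt x₀ hb).clm_comp
    (contMDiffWithinAt_const (c := S.projK a))
  have h2 := V.contMDiffWithinAt_linearMapAt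
    (ContMDiffAt.comp_contMDiffWithinAt x₀ (f := fun x => V.pt (b x) (v x))
      S.smooth.contMDiffAt hv) ha.1
  exact h1.clm_apply h2

theorem contMDiffWithinAt_frame {EX HX X : Type*} [NormedAddCommGroup EX] [NormedSpace ℝ EX]
    [TopologicalSpace HX] [TopologicalSpace X] [ChartedSpace HX X] {J : ModelWithCorners ℝ EX HX}
    {a : B} {s : Set X} {x₀ : X} {b : X → B} {k : X → K}
    (hb : ContMDiffWithinAt J I ∞ b s x₀) (hk : ContMDiffWithinAt J 𝓘(ℝ, K) ∞ k s x₀)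
    (ha : b x₀ ∈ S.frameSet a) :
    ContMDiffWithinAt J V.model ∞ (fun x => V.pt (b x) (S.frame a (b x) (k x))) s x₀ :=
  ContMDiffAt.comp_contMDiffWithinAt x₀ S.smooth.contMDiffAt
    (V.contMDiffWithinAt_symm hb
      ((S.incl a).contMDiff.contMDiffAt.comp_contMDiffWithinAt x₀ hk) ha.1)

theorem contMDiffAt_coordChange {a b x : B} (ha : x ∈ S.frameSet a) (hb : x ∈ S.frameSet b) :
    ContMDiffAt I 𝓘(ℝ, K →L[ℝ] K) ∞
      (fun x => LinearMap.toContinuousLinearMap (S.coframe b x ∘ₗ S.frame a x)) x :=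
  contMDiffWithinAt_clm_of_apply fun _ => S.contMDiffWithinAt_coframe
    (S.contMDiffWithinAt_frame contMDiffWithinAt_id contMDiffWithinAt_const ha) hb

/-- The image of `P`, glued from the local frames `P A_a`. -/
def core : VectorBundleCore ℝ B K B where
  baseSet := S.frameSet
  isOpen_baseSet := S.isOpen_frameSet
  indexAt x := x
  mem_baseSet_at := S.mem_frameSet
  coordChange a b x := LinearMap.toContinuousLinearMap (S.coframe b x ∘ₗ S.frame a x)
  coordChange_self a _ hx v := S.coframe_frame hx v
  continuousOn_coordChange a b := fun _ hx =>
    (S.contMDiffAt_coordChange hx.1 hx.2).continuousAt.continuousWithinAt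
  coordChange_comp a b c x hx v := by
    change S.coframe c x (S.frame b x (S.coframe b x (S.frame a x v)))
      = S.coframe c x (S.frame a x v)
    rw [S.frame_coframe hx.1.2, S.coframe_P]

instance : S.core.IsContMDiff I ∞ :=
  ⟨fun _ _ _ hx => (S.contMDiffAt_coordChange hx.1 hx.2).contMDiffWithinAt⟩

/-- The image of `P`, as a vector bundle. -/
def image : SmoothVB I B where
  F := K
  Fib := S.core.Fiber
  addFib _ := inferInstanceAs (AddCommGroup K)

/-- The inclusion of the image of `P` into `V`. -/
def imageIncl (x : B) : S.image.Fib x →ₗ[ℝ] V.Fib x := S.frame x x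

/-- The projection of `V` to the image of `P`. -/
def imageProj (x : B) : V.Fib x →ₗ[ℝ] S.image.Fib x := S.coframe x x

theorem imageProj_imageIncl (x : B) (k : S.image.Fib x) : S.imageProj x (S.imageIncl x k) = k :=
  S.coframe_frame (S.mem_frameSet x) k

theorem imageIncl_imageProj (x : B) (v : V.Fib x) : S.imageIncl x (S.imageProj x v) = S.P x v :=
  S.frame_coframe (S.mem_frameSet x) v

theorem smooth_imageProj : V.IsSmoothHom S.image S.imageProj := by
  intro z
  rw [contMDiffAt_totalSpace]
  refine ⟨contMDiffAt_proj V.Fib, ?_⟩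
  have h := S.contMDiffWithinAt_coframe (contMDiffWithinAt_id (I := V.model) (s := Set.univ)
    (x := z)) (S.mem_frameSet z.proj)
  refine ContMDiffAt.congr_of_eventuallyEq h ?_
  filter_upwards [(FiberBundle.continuous_proj V.F V.Fib).continuousAt.eventually_mem
    ((S.isOpen_frameSet z.proj).mem_nhds (S.mem_frameSet z.proj))] with y hy
  change S.coframe z.proj y.proj (S.frame y.proj y.proj (S.coframe y.proj y.proj y.snd)) = _
  rw [S.frame_coframe (S.mem_frameSet y.proj), S.coframe_P]

theorem smooth_imageIncl : S.image.IsSmoothHom V S.imageIncl := by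
  intro z
  have h0 := contMDiffAt_id (n := ∞) (I := S.image.model) (x := z)
  rw [contMDiffAt_totalSpace] at h0
  have h := S.contMDiffWithinAt_frame h0.1 h0.2 (S.mem_frameSet z.proj)
  refine ContMDiffAt.congr_of_eventuallyEq h ?_
  filter_upwards [(FiberBundle.continuous_proj S.image.F S.image.Fib).continuousAt.eventually_mem
    ((S.isOpen_frameSet z.proj).mem_nhds (S.mem_frameSet z.proj))] with y hy
  refine congrArg (V.pt y.proj) ?_
  change S.frame y.proj y.proj y.snd
    = S.frame z.proj y.proj (S.coframe z.proj y.proj (S.frame y.proj y.proj y.snd))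
  exact ((S.frame_coframe hy _).trans (S.P_frame _ _ _)).symm

end SmoothIdempotent

/-! ### Smooth choices of linear maps between vector bundles -/

namespace SmoothVB

variable {EB HB : Type} [NormedAddCommGroup EB] [NormedSpace ℝ EB]
  [TopologicalSpace HB] {I : ModelWithCorners ℝ EB HB}
  {B : Type u} [TopologicalSpace B] [ChartedSpace HB B]
  {EB' HB' : Type} [NormedAddCommGroup EB'] [NormedSpace ℝ EB']
  [TopologicalSpace HB'] {I' : ModelWithCorners ℝ EB' HB'}
  {B' : Type u} [TopologicalSpace B'] [ChartedSpace HB' B']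

instance isTopologicalAddGroup_fib (V : SmoothVB I B) (x : B) : IsTopologicalAddGroup (V.Fib x) :=
  ((V.triv x).continuousLinearEquivAt ℝ x (V.mem_triv x)).toHomeomorph.isInducing.topologicalAddGroup
    ((V.triv x).continuousLinearEquivAt ℝ x (V.mem_triv x))

instance continuousSMul_fib (V : SmoothVB I B) (x : B) : ContinuousSMul ℝ (V.Fib x) :=
  ((V.triv x).continuousLinearEquivAt ℝ x (V.mem_triv x)).toHomeomorph.isInducing.continuousSMul
    continuous_id (map_smul ((V.triv x).continuousLinearEquivAt ℝ x (V.mem_triv x)) _ _)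

/-- A convex condition on families of linear maps `V_x → W_x` that has smooth solutions locally has
a global smooth solution. Local solutions are given by their matrices in the trivialisations at
a point. -/
theorem exists_isSmoothHom_forall_mem [FiniteDimensional ℝ EB] [IsManifold I ∞ B] [T2Space B]
    [SigmaCompactSpace B] (V W : SmoothVB I B) (t : ∀ x, Set (V.Fib x →ₗ[ℝ] W.Fib x))
    (ht : ∀ x, Convex ℝ (t x))
    (hloc : ∀ x₀ : B, ∃ A : B → V.F →L[ℝ] W.F, ∀ᶠ x in 𝓝 x₀,
      ContMDiffAt I 𝓘(ℝ, V.F →L[ℝ] W.F) ∞ A x ∧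
        (W.triv x₀).symmₗ ℝ x ∘ₗ (A x).toLinearMap ∘ₗ (V.triv x₀).linearMapAt ℝ x ∈ t x) :
    ∃ σ : ∀ x, V.Fib x →ₗ[ℝ] W.Fib x, V.IsSmoothHom W σ ∧ ∀ x, σ x ∈ t x := by
  let H : B → Type u := fun x => V.Fib x →L[ℝ] W.Fib x
  have hconv : ∀ x, Convex ℝ {φ : H x | φ.toLinearMap ∈ t x} :=
    fun x φ hφ ψ hψ a b ha hb hab => ht x hφ hψ ha hb hab
  have hloc' : ∀ x₀ : B, ∃ U ∈ 𝓝 x₀, ∃ s : ∀ x, H x,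
      ContMDiffOn I (I.prod 𝓘(ℝ, V.F →L[ℝ] W.F)) ∞
        (fun x => TotalSpace.mk' (V.F →L[ℝ] W.F) (E := H) x (s x)) U ∧
      ∀ y ∈ U, s y ∈ {φ : H y | φ.toLinearMap ∈ t y} := by
    intro x₀
    obtain ⟨A, hA⟩ := hloc x₀
    obtain ⟨U, hU, hUo, hxU⟩ := eventually_nhds_iff.1 (hA.and
      (((V.triv x₀).open_baseSet.inter (W.triv x₀).open_baseSet).mem_nhds
        ⟨V.mem_triv x₀, W.mem_triv x₀⟩))
    refine ⟨U, hUo.mem_nhds hxU, fun x => (W.triv x₀).symmL ℝ x ∘L A x ∘L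
      (V.triv x₀).continuousLinearMapAt ℝ x, fun x hx => ?_, fun x hx => (hU x hx).1.2⟩
    refine ContMDiffAt.contMDiffWithinAt ?_
    let e := Trivialization.continuousLinearMap (RingHom.id ℝ) (V.triv x₀) (W.triv x₀)
    refine (Trivialization.contMDiffAt_section_iff (E := H) e (hU x hx).2).2 ?_
    refine (hU x hx).1.1.congr_of_eventuallyEq ?_
    filter_upwards [hUo.mem_nhds hx] with y hy
    change (W.triv x₀).continuousLinearMapAt ℝ y ∘L ((W.triv x₀).symmL ℝ y ∘L A y ∘L
      (V.triv x₀).continuousLinearMapAt ℝ y) ∘L (V.triv x₀).symmL ℝ y = A y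
    ext v
    simp only [ContinuousLinearMap.comp_apply]
    rw [Trivialization.continuousLinearMapAt_symmL _ (hU y hy).2.1,
      Trivialization.continuousLinearMapAt_symmL _ (hU y hy).2.2]
  obtain ⟨s, hs⟩ := exists_contMDiffSection_forall_mem_convex_of_local (n := ⊤)
    (F_fiber := V.F →L[ℝ] W.F) I H (fun x => {φ | φ.toLinearMap ∈ t x}) hconv hloc'
  refine ⟨fun x => (s x).toLinearMap, ?_, hs⟩
  exact ContMDiff.clm_bundle_apply (n := ∞) (IB := I) (IM := V.model) (F₁ := V.F) (F₂ := W.F)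
    (b := fun v : V.Tot => v.proj) (v := fun v : V.Tot => v.snd) (ϕ := fun v : V.Tot => s v.proj)
    (s.contMDiff.comp (contMDiff_proj V.Fib)) contMDiff_id

/-- A fibrewise linear map that is a submersion at the zero vectors is fibrewise surjective: there
its derivative is the sum of the derivative of the base map and of the map of fibres. -/
theorem surjective_of_surjective_mfderiv_zero {V : SmoothVB I' B'} {W : SmoothVB I B}
    {b : B' → B} {φ : ∀ x, V.Fib x →ₗ[ℝ] W.Fib (b x)}
    (hφ : ContMDiff V.model W.model ∞ (fun v : V.Tot => W.pt (b v.proj) (φ v.proj v.snd))) (x : B')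
    (hs : Function.Surjective (mfderiv V.model W.model
      (fun v : V.Tot => W.pt (b v.proj) (φ v.proj v.snd)) (V.pt x 0))) :
    Function.Surjective (φ x) := by
  let f : V.Tot → W.Tot := fun v => W.pt (b v.proj) (φ v.proj v.snd)
  let e := V.triv x
  let e' := W.triv (b x)
  have hx : x ∈ e.baseSet := V.mem_triv x
  have hx' : b x ∈ e'.baseSet := W.mem_triv (b x)
  have he0 : ∀ y ∈ e.baseSet, ∀ v, e.toOpenPartialHomeomorph.symm (y, v)
      = V.pt y (e.symmₗ ℝ y v) := by
    intro y hy v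
    rw [e.symmₗ_apply hy]
    exact (e.mk_symm hy v).symm
  have he1 : ∀ y, b y ∈ e'.baseSet → ∀ w, (e' (W.pt (b y) w)).2 = e'.linearMapAt ℝ (b y) w := by
    intro y hy w
    rw [e'.coe_linearMapAt_of_mem hy]
  -- The fibre component of the map in trivialisations: it vanishes on `(y, 0)` and is linear on
  -- `(x, v)`, so its derivative at `(x, 0)` is that linear map on the second component.
  let h : B' × V.F → W.F := fun p => (e' (f (e.toOpenPartialHomeomorph.symm p))).2
  have hψ : MDifferentiableAt (I'.prod 𝓘(ℝ, V.F)) V.model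
      e.toOpenPartialHomeomorph.symm (x, 0) :=
    (e.contMDiffOn_symm.contMDiffAt (n := ∞) (e.open_target.mem_nhds
      (e.mem_target.2 hx))).mdifferentiableAt (by simp)
  have hψ0 : e.toOpenPartialHomeomorph.symm (x, 0) = V.pt x 0 := by
    rw [he0 x hx, map_zero]
  have hf : MDifferentiableAt V.model W.model f (e.toOpenPartialHomeomorph.symm (x, 0)) :=
    hφ.mdifferentiable (by simp) _
  have hfsrc : f (e.toOpenPartialHomeomorph.symm (x, 0)) ∈ e'.source := by
    rw [hψ0]
    exact e'.mem_source.2 hx'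
  have he' : MDifferentiableAt W.model (I.prod 𝓘(ℝ, W.F)) e'
      (f (e.toOpenPartialHomeomorph.symm (x, 0))) :=
    (e'.contMDiffOn.contMDiffAt (n := ∞) (e'.open_source.mem_nhds hfsrc)).mdifferentiableAt
      (by simp)
  have hh := (hasMFDerivAt_snd (I := I) (I' := 𝓘(ℝ, W.F))
    (x := e' (f (e.toOpenPartialHomeomorph.symm (x, 0))))).comp (x, (0 : V.F))
      (he'.hasMFDerivAt.comp (x, (0 : V.F)) (hf.hasMFDerivAt.comp (x, (0 : V.F)) hψ.hasMFDerivAt))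
  have hsurj : Function.Surjective (mfderiv (I'.prod 𝓘(ℝ, V.F)) 𝓘(ℝ, W.F) h (x, 0)) := by
    rw [show mfderiv (I'.prod 𝓘(ℝ, V.F)) 𝓘(ℝ, W.F) h (x, 0) = _ from hh.mfderiv]
    have hsnd : Function.Surjective (fun p : EB × W.F => p.2) := Prod.snd_surjective
    have hf' : Function.Surjective (mfderiv V.model W.model f
        (e.toOpenPartialHomeomorph.symm (x, 0))) := by
      rw [hψ0]
      exact hs
    exact hsnd.comp ((W.surjective_mfderiv_triv hfsrc).comp
      (hf'.comp (V.surjective_mfderiv_triv_symm hx 0)))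
  have hh' : MDifferentiableAt (I'.prod 𝓘(ℝ, V.F)) 𝓘(ℝ, W.F) h (x, 0) := hh.mdifferentiableAt
  let L : V.F →L[ℝ] W.F := LinearMap.toContinuousLinearMap
    (e'.linearMapAt ℝ (b x) ∘ₗ φ x ∘ₗ e.symmₗ ℝ x)
  have h1 : (fun y => h (y, 0)) =ᶠ[𝓝 x] fun _ => 0 := by
    have hb : ContinuousAt b x := by
      have h2 := (contMDiff_proj (n := ∞) (IB := I) W.Fib).comp
        (hφ.comp (contMDiff_zeroSection ℝ V.Fib))
      exact h2.continuous.continuousAt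
    filter_upwards [e.open_baseSet.mem_nhds hx,
      hb.eventually_mem (e'.open_baseSet.mem_nhds hx')] with y hy hy'
    change (e' (f (e.toOpenPartialHomeomorph.symm (y, 0)))).2 = 0
    rw [he0 y hy, map_zero]
    change (e' (W.pt (b y) (φ y 0))).2 = 0
    rw [map_zero, he1 y hy', map_zero]
  have h2 : (fun v => h (x, v)) = L := by
    funext v
    change (e' (f (e.toOpenPartialHomeomorph.symm (x, v)))).2 = _
    rw [he0 x hx]
    exact he1 x hx' _
  intro w
  obtain ⟨v, hv⟩ := hsurj (e'.linearMapAt ℝ (b x) w)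
  have h3 := mfderiv_prod_eq_add_apply (v := v) hh'
  have h4 : mfderiv I' 𝓘(ℝ, W.F) (fun y => h (y, 0)) x = 0 := by
    rw [h1.mfderiv_eq, mfderiv_const]
    rfl
  have h5 : mfderiv 𝓘(ℝ, V.F) 𝓘(ℝ, W.F) (fun v => h (x, v)) 0 = L := by
    rw [h2]
    exact L.mfderiv_eq
  have h6 : e'.linearMapAt ℝ (b x) w = 0 + L v.2 := by
    rw [← hv]
    refine h3.trans (congrArg₂ (fun p q : W.F => p + q) ?_ ?_)
    · exact congrArg (fun T : EB' →L[ℝ] W.F => T v.1) h4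
    · exact congrArg (fun T : V.F →L[ℝ] W.F => T v.2) h5
  rw [zero_add] at h6
  refine ⟨e.symmₗ ℝ x v.2, ?_⟩
  have h7 := congrArg (e'.symmₗ ℝ (b x)) h6
  rw [e'.symmₗ_linearMapAt hx'] at h7
  rw [h7]
  exact (e'.symmₗ_linearMapAt hx' _).symm

end SmoothVB

/-! ### Unital splittings of a VB-groupoid -/

namespace VBData.IsVBGroupoid

variable {G : LieGroupoid.{u}} {D : VBData G}

/-- The source map of `Γ` is a submersion at the zero vectors, hence surjective on each fibre. -/
theorem surjective_src (hD : D.IsVBGroupoid) {x y : G.Obj} (g : x ⟶ y) :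
    Function.Surjective (D.src g) :=
  SmoothVB.surjective_of_surjective_mfderiv_zero (V := D.Gam) (W := D.E)
    (b := fun a : G.Arr => a.src) (φ := fun a => D.src a.hom) hD.submersion_src.smooth ⟨g⟩
    (hD.submersion_src.surjective_mfderiv _)

/-- The splittings `E_x → Γ_g` of the source map that, if `g` is a unit, agree with the unit map. -/
def splittings (D : VBData G) (g : G.Arr) : Set (D.E.Fib g.src →ₗ[ℝ] D.Gam.Fib g) :=
  {φ | (∀ e, D.src g.hom (φ e) = e) ∧
    (g = ⟨𝟙 g.src⟩ → ∀ e, D.Gam.pt g (φ e) = D.Gam.pt ⟨𝟙 g.src⟩ (D.one g.src e))}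

theorem convex_splittings (g : G.Arr) : Convex ℝ (splittings D g) := by
  rintro φ ⟨h1, h2⟩ ψ ⟨h1', h2'⟩ a b - - hab
  refine ⟨fun e => ?_, fun hg => ?_⟩
  · simp only [LinearMap.add_apply, LinearMap.smul_apply, map_add, map_smul]
    rw [h1, h1', ← add_smul, hab, one_smul]
  · obtain ⟨x, rfl⟩ : ∃ x, g = ⟨𝟙 x⟩ := ⟨_, hg⟩
    intro e
    have k1 : φ e = D.one x e := TotalSpace.mk_inj.1 (h2 rfl e)
    have k2 : ψ e = D.one x e := TotalSpace.mk_inj.1 (h2' rfl e)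
    refine congrArg (D.Gam.pt _) ?_
    simp only [LinearMap.add_apply, LinearMap.smul_apply]
    rw [k1, k2, ← add_smul, hab, one_smul]

/-- The source map, as a map from `Γ` to the pullback of `E`. -/
def srcHom (D : VBData G) (g : G.Arr) : D.Gam.Fib g →ₗ[ℝ] (D.E.pullback G.srcMap).Fib g :=
  D.src g.hom

theorem smooth_srcHom (hD : D.IsVBGroupoid) :
    D.Gam.IsSmoothHom (D.E.pullback G.srcMap) (srcHom D) := by
  have h0 := smoothAlong_self (I := D.Gam.model) (fun v : D.Gam.Tot => v)
  exact smoothAlong_id_iff.1 (SmoothVB.smoothAlong_pullback (f := G.srcMap)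
    (SmoothVB.smoothAlong_proj h0) (hD.submersion_src.smooth.comp_smoothAlong h0))

open SmoothVB

/-- The matrix of the unit map `E_x → Γ_{1_x}` in the trivialisations at the arrow `g₀`. -/
def oneCoord (D : VBData G) (g₀ : G.Arr) (x : G.Obj) :
    (D.E.pullback G.srcMap).F →L[ℝ] D.Gam.F :=
  LinearMap.toContinuousLinearMap ((D.Gam.triv g₀).linearMapAt ℝ ⟨𝟙 x⟩ ∘ₗ D.one x ∘ₗ
    (show (D.E.pullback G.srcMap).F →ₗ[ℝ] D.E.Fib x from
      ((D.E.pullback G.srcMap).triv g₀).symmₗ ℝ ⟨𝟙 x⟩))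

theorem contMDiffAt_oneCoord (hD : D.IsVBGroupoid) {g₀ : G.Arr} {x : G.Obj}
    (h : (⟨𝟙 x⟩ : G.Arr) ∈ (D.Gam.triv g₀).baseSet)
    (h' : (⟨𝟙 x⟩ : G.Arr) ∈ ((D.E.pullback G.srcMap).triv g₀).baseSet) :
    ContMDiffAt (𝓡 G.dimObj) 𝓘(ℝ, (D.E.pullback G.srcMap).F →L[ℝ] D.Gam.F) ∞
      (oneCoord D g₀) x := by
  refine contMDiffWithinAt_clm_of_apply fun v => ?_
  have h1 := (D.E.pullback G.srcMap).contMDiffWithinAt_symm (J := 𝓡 G.dimObj) (s := Set.univ)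
    (x₀ := x) (a := g₀) (b := fun x => ⟨𝟙 x⟩) (v := fun _ => v)
    (G.smooth_one x).contMDiffWithinAt contMDiffWithinAt_const h'
  have h2 := ((hD.smooth_one.comp (contMDiff_pullback_lift G.srcMap D.E)).contMDiffAt
    ).comp_contMDiffWithinAt x h1
  exact D.Gam.contMDiffWithinAt_linearMapAt (b := fun x => ⟨𝟙 x⟩) h2 h

/-- Near an arrow `g₀`, the map `A (S A)⁻¹` splits the matrix `S` of the source map if `A` is close
to a splitting at `g₀`. If `A` is the unit map along the units, so is `A (S A)⁻¹`. -/
theorem exists_local_splitting (hD : D.IsVBGroupoid) (g₀ : G.Arr)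
    (A : G.Arr → (D.E.pullback G.srcMap).F →L[ℝ] D.Gam.F)
    (hA : ∀ᶠ g in 𝓝 g₀, ContMDiffAt (𝓡 G.dimArr)
      𝓘(ℝ, (D.E.pullback G.srcMap).F →L[ℝ] D.Gam.F) ∞ A g)
    (hA₀ : coord (srcHom D) g₀ g₀ g₀ ∘L A g₀ = 1)
    (hA₁ : ∀ᶠ g in 𝓝 g₀, g = ⟨𝟙 g.src⟩ → A g = oneCoord D g₀ g.src) :
    ∃ A' : G.Arr → (D.E.pullback G.srcMap).F →L[ℝ] D.Gam.F, ∀ᶠ g in 𝓝 g₀,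
      ContMDiffAt (𝓡 G.dimArr) 𝓘(ℝ, (D.E.pullback G.srcMap).F →L[ℝ] D.Gam.F) ∞ A' g ∧
        (D.Gam.triv g₀).symmₗ ℝ g ∘ₗ (A' g).toLinearMap ∘ₗ
          ((D.E.pullback G.srcMap).triv g₀).linearMapAt ℝ g ∈ splittings D g := by
  let V := D.E.pullback G.srcMap
  let N : G.Arr → V.F →L[ℝ] V.F := fun g => coord (srcHom D) g₀ g₀ g ∘L A g
  have hN : ∀ g, g ∈ (D.Gam.triv g₀).baseSet → g ∈ (V.triv g₀).baseSet →
      ContMDiffAt (𝓡 G.dimArr) 𝓘(ℝ, V.F →L[ℝ] D.Gam.F) ∞ A g →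
      ContMDiffAt (𝓡 G.dimArr) 𝓘(ℝ, V.F →L[ℝ] V.F) ∞ N g :=
    fun g h h' hg => (hD.smooth_srcHom.contMDiffAt_coord h h').clm_comp hg
  have hunit : ∀ᶠ g in 𝓝 g₀, IsUnit (N g) := by
    refine (hN g₀ (D.Gam.mem_triv g₀) (V.mem_triv g₀) hA.self_of_nhds).continuousAt.eventually_mem
      (Units.isOpen.mem_nhds ?_)
    change IsUnit (N g₀)
    rw [show N g₀ = 1 from hA₀]
    exact isUnit_one
  refine ⟨fun g => A g ∘L Ring.inverse (N g), ?_⟩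
  filter_upwards [hA, hA₁, hunit, (D.Gam.triv g₀).open_baseSet.mem_nhds (D.Gam.mem_triv g₀),
    (V.triv g₀).open_baseSet.mem_nhds (V.mem_triv g₀)] with g hg hg₁ hu hΓ hV
  refine ⟨?_, ?_, ?_⟩
  · obtain ⟨w, hw⟩ := hu
    have h := contDiffAt_ringInverse ℝ (n := ∞) w
    rw [hw] at h
    exact hg.clm_comp (h.contMDiffAt.comp g (hN g hΓ hV hg))
  · intro e
    let e' : V.Fib g := e
    change srcHom D g ((D.Gam.triv g₀).symmₗ ℝ g (A g (Ring.inverse (N g)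
      ((V.triv g₀).linearMapAt ℝ g e')))) = e'
    have h1 : (N g * Ring.inverse (N g)) ((V.triv g₀).linearMapAt ℝ g e')
        = (V.triv g₀).linearMapAt ℝ g e' := by
      rw [Ring.mul_inverse_cancel _ hu]
      rfl
    have h2 := congrArg ((V.triv g₀).symmₗ ℝ g) h1
    rw [(V.triv g₀).symmₗ_linearMapAt hV] at h2
    refine Eq.trans ?_ h2
    exact ((V.triv g₀).symmₗ_linearMapAt hV _).symm
  · intro hgu
    have hA' := hg₁ hgu
    obtain ⟨x, rfl⟩ : ∃ x, g = ⟨𝟙 x⟩ := ⟨_, hgu⟩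
    intro e
    let e' : V.Fib ⟨𝟙 x⟩ := e
    have h0 : ∀ v, A ⟨𝟙 x⟩ v = (D.Gam.triv g₀).linearMapAt ℝ ⟨𝟙 x⟩
        (D.one x ((V.triv g₀).symmₗ ℝ ⟨𝟙 x⟩ v)) := fun v => congrArg (fun T => T v) hA'
    have h1 : N ⟨𝟙 x⟩ = 1 := by
      ext v
      change (V.triv g₀).linearMapAt ℝ ⟨𝟙 x⟩ (D.src (𝟙 x)
        ((D.Gam.triv g₀).symmₗ ℝ ⟨𝟙 x⟩ (A ⟨𝟙 x⟩ v))) = v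
      rw [h0, (D.Gam.triv g₀).symmₗ_linearMapAt hΓ]
      refine Eq.trans (congrArg ((V.triv g₀).linearMapAt ℝ ⟨𝟙 x⟩) (hD.src_one x _)) ?_
      exact (V.triv g₀).linearMapAt_symmₗ hV v
    refine congrArg (D.Gam.pt _) ?_
    change (D.Gam.triv g₀).symmₗ ℝ ⟨𝟙 x⟩ (A ⟨𝟙 x⟩ (Ring.inverse (N ⟨𝟙 x⟩)
      ((V.triv g₀).linearMapAt ℝ ⟨𝟙 x⟩ e'))) = D.one x e
    rw [h1, Ring.inverse_one]
    change (D.Gam.triv g₀).symmₗ ℝ ⟨𝟙 x⟩ (A ⟨𝟙 x⟩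
      ((V.triv g₀).linearMapAt ℝ ⟨𝟙 x⟩ e')) = D.one x e
    rw [h0, (D.Gam.triv g₀).symmₗ_linearMapAt hΓ]
    exact congrArg (D.one x) ((V.triv g₀).symmₗ_linearMapAt hV e')

instance sigmaCompactSpace_arr (G : LieGroupoid.{u}) : SigmaCompactSpace G.Arr := by
  have : LocallyCompactSpace G.Arr := Manifold.locallyCompact_of_finiteDimensional (𝓡 G.dimArr)
  infer_instance

/-- Near a unit, the unit map at the source of the arrow is an approximate splitting; near any other
arrow there are no units, and a splitting at that arrow is extended by a constant matrix. -/
theorem exists_local_unital_splitting (hD : D.IsVBGroupoid) (g₀ : G.Arr) :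
    ∃ A : G.Arr → (D.E.pullback G.srcMap).F →L[ℝ] D.Gam.F, ∀ᶠ g in 𝓝 g₀,
      ContMDiffAt (𝓡 G.dimArr) 𝓘(ℝ, (D.E.pullback G.srcMap).F →L[ℝ] D.Gam.F) ∞ A g ∧
        (D.Gam.triv g₀).symmₗ ℝ g ∘ₗ (A g).toLinearMap ∘ₗ
          ((D.E.pullback G.srcMap).triv g₀).linearMapAt ℝ g ∈ splittings D g := by
  by_cases hg₀ : g₀ = ⟨𝟙 g₀.src⟩
  · obtain ⟨x₀, rfl⟩ : ∃ x, g₀ = ⟨𝟙 x⟩ := ⟨_, hg₀⟩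
    refine hD.exists_local_splitting _ (fun g => oneCoord D ⟨𝟙 x₀⟩ g.src) ?_ ?_ ?_
    · have hs : ContinuousAt (fun g : G.Arr => (⟨𝟙 g.src⟩ : G.Arr)) ⟨𝟙 x₀⟩ :=
        (G.smooth_one.comp G.submersion_src.smooth).continuous.continuousAt
      filter_upwards [hs.eventually_mem ((D.Gam.triv ⟨𝟙 x₀⟩).open_baseSet.mem_nhds
          (D.Gam.mem_triv ⟨𝟙 x₀⟩)), hs.eventually_mem
        (((D.E.pullback G.srcMap).triv ⟨𝟙 x₀⟩).open_baseSet.mem_nhds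
          ((D.E.pullback G.srcMap).mem_triv ⟨𝟙 x₀⟩))] with g hg hg'
      exact (hD.contMDiffAt_oneCoord hg hg').comp g (G.submersion_src.smooth g)
    · ext v
      change ((D.E.pullback G.srcMap).triv ⟨𝟙 x₀⟩).linearMapAt ℝ ⟨𝟙 x₀⟩ (D.src (𝟙 x₀)
        ((D.Gam.triv ⟨𝟙 x₀⟩).symmₗ ℝ ⟨𝟙 x₀⟩ ((D.Gam.triv ⟨𝟙 x₀⟩).linearMapAt ℝ ⟨𝟙 x₀⟩
        (D.one x₀ (((D.E.pullback G.srcMap).triv ⟨𝟙 x₀⟩).symmₗ ℝ ⟨𝟙 x₀⟩ v))))) = v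
      rw [(D.Gam.triv _).symmₗ_linearMapAt (D.Gam.mem_triv _)]
      refine Eq.trans (congrArg (((D.E.pullback G.srcMap).triv ⟨𝟙 x₀⟩).linearMapAt ℝ ⟨𝟙 x₀⟩)
        (hD.src_one x₀ _)) ?_
      exact ((D.E.pullback G.srcMap).triv _).linearMapAt_symmₗ
        ((D.E.pullback G.srcMap).mem_triv _) v
    · exact Filter.Eventually.of_forall fun _ _ => rfl
  · have hsurj : Function.Surjective (coord (srcHom D) g₀ g₀ g₀) := by
      intro w
      obtain ⟨v, hv⟩ := hD.surjective_src g₀.hom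
        (((D.E.pullback G.srcMap).triv g₀).symmₗ ℝ g₀ w)
      refine ⟨(D.Gam.triv g₀).linearMapAt ℝ g₀ v, ?_⟩
      rw [coord_apply, (D.Gam.triv g₀).symmₗ_linearMapAt (D.Gam.mem_triv g₀)]
      refine Eq.trans (congrArg _ hv) ?_
      exact ((D.E.pullback G.srcMap).triv g₀).linearMapAt_symmₗ
        ((D.E.pullback G.srcMap).mem_triv g₀) w
    obtain ⟨A, hA⟩ := (coord (srcHom D) g₀ g₀ g₀).toLinearMap.exists_rightInverse_of_surjective
      (LinearMap.range_eq_top.2 hsurj)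
    refine hD.exists_local_splitting _ (fun _ => LinearMap.toContinuousLinearMap A) ?_ ?_ ?_
    · exact Filter.Eventually.of_forall fun _ => contMDiffAt_const
    · ext v
      exact congrArg (fun T => T v) hA
    · have hcl : IsClosed {g : G.Arr | g = ⟨𝟙 g.src⟩} :=
        isClosed_eq continuous_id (G.smooth_one.comp G.submersion_src.smooth).continuous
      filter_upwards [hcl.isOpen_compl.mem_nhds hg₀] with g hg hg'
      exact absurd hg' hg

/-- The splittings over an arrow form an affine space, so that a partition of unity glues local
smooth choices. -/
theorem exists_unital_splitting (hD : D.IsVBGroupoid) :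
    ∃ σ : ∀ {x y : G.Obj} (g : x ⟶ y), D.E.Fib x →ₗ[ℝ] D.Gam.Fib ⟨g⟩,
      (D.E.pullback G.srcMap).IsSmoothHom D.Gam (fun g => σ g.hom) ∧
      (∀ {x y : G.Obj} (g : x ⟶ y) (e : D.E.Fib x), D.src g (σ g e) = e) ∧
      ∀ (x : G.Obj) (e : D.E.Fib x), σ (𝟙 x) e = D.one x e := by
  obtain ⟨σ, hσ, hσ'⟩ := exists_isSmoothHom_forall_mem (D.E.pullback G.srcMap) D.Gam
    (splittings D) convex_splittings hD.exists_local_unital_splitting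
  exact ⟨fun {x y} g => σ ⟨g⟩, hσ, fun {x y} g e => (hσ' ⟨g⟩).1 e,
    fun x e => TotalSpace.mk_inj.1 ((hσ' ⟨𝟙 x⟩).2 rfl e)⟩

end VBData.IsVBGroupoid

/-! ### The core of a VB-groupoid -/

/-- The unit map of `G`, as a smooth map. -/
def LieGroupoid.oneMap (G : LieGroupoid.{u}) :
    ContMDiffMap (𝓡 G.dimObj) (𝓡 G.dimArr) G.Obj G.Arr ∞ :=
  ⟨fun x => ⟨𝟙 x⟩, G.smooth_one⟩

/-- A core bundle of a VB-groupoid together with a unital splitting: a vector bundle `C`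
identified with the kernel of the source map over the units, and linear sections `E_x → Γ_g` of the
source map, equal to the unit map over the units. -/
structure CoreSplitting {G : LieGroupoid.{u}} (D : VBData G) where
  C : G.ObjVB
  /-- the inclusion of the core into `Γ` -/
  incl : ∀ x, C.Fib x →ₗ[ℝ] D.Gam.Fib ⟨𝟙 x⟩
  /-- a retraction of the inclusion of the core -/
  proj : ∀ x, D.Gam.Fib ⟨𝟙 x⟩ →ₗ[ℝ] C.Fib x
  /-- the splitting of the source map -/
  lift : ∀ {x y : G.Obj} (g : x ⟶ y), D.E.Fib x →ₗ[ℝ] D.Gam.Fib ⟨g⟩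
  smooth_incl : ContMDiff C.model D.Gam.model ∞
    (fun c : C.Tot => D.Gam.pt ⟨𝟙 c.proj⟩ (incl c.proj c.snd))
  smooth_proj : (D.Gam.pullback G.oneMap).IsSmoothHom C proj
  smooth_lift : (D.E.pullback G.srcMap).IsSmoothHom D.Gam (fun g => lift g.hom)
  src_incl : ∀ (x : G.Obj) (c : C.Fib x), D.src (𝟙 x) (incl x c) = 0
  proj_incl : ∀ (x : G.Obj) (c : C.Fib x), proj x (incl x c) = c
  incl_proj : ∀ (x : G.Obj) (v : D.Gam.Fib ⟨𝟙 x⟩), D.src (𝟙 x) v = 0 → incl x (proj x v) = v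
  src_lift : ∀ {x y : G.Obj} (g : x ⟶ y) (e : D.E.Fib x), D.src g (lift g e) = e
  lift_one : ∀ (x : G.Obj) (e : D.E.Fib x), lift (𝟙 x) e = D.one x e

namespace VBData

variable {G : LieGroupoid.{u}} {D : VBData G}

/-- The projection `v ↦ v - 1_{s(v)}` of the restriction of `Γ` to the units onto the kernel of the
source map. -/
def coreProj (D : VBData G) (x : G.Obj) :
    (D.Gam.pullback G.oneMap).Fib x →ₗ[ℝ] (D.Gam.pullback G.oneMap).Fib x :=
  show D.Gam.Fib ⟨𝟙 x⟩ →ₗ[ℝ] D.Gam.Fib ⟨𝟙 x⟩ from LinearMap.id - D.one x ∘ₗ D.src (𝟙 x)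

theorem coreProj_apply (D : VBData G) (x : G.Obj) (v : D.Gam.Fib ⟨𝟙 x⟩) :
    D.coreProj x v = (v - D.one x (D.src (𝟙 x) v) : D.Gam.Fib ⟨𝟙 x⟩) := rfl

theorem IsVBGroupoid.src_coreProj (hD : D.IsVBGroupoid) (x : G.Obj) (v : D.Gam.Fib ⟨𝟙 x⟩) :
    D.src (𝟙 x) (D.coreProj x v) = 0 := by
  rw [coreProj_apply, map_sub, hD.src_one, sub_self]

theorem coreProj_of_src_eq_zero {x : G.Obj} {v : D.Gam.Fib ⟨𝟙 x⟩} (hv : D.src (𝟙 x) v = 0) :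
    D.coreProj x v = v := by
  rw [coreProj_apply, hv, map_zero, sub_zero]

theorem IsVBGroupoid.range_coreProj (hD : D.IsVBGroupoid) (x : G.Obj) :
    LinearMap.range (D.coreProj x) = LinearMap.ker (D.src (𝟙 x)) := by
  ext v
  constructor
  · rintro ⟨w, rfl⟩
    exact hD.src_coreProj x w
  · intro hv
    exact ⟨v, coreProj_of_src_eq_zero hv⟩

/-- The core has constant rank, because the source map is surjective on each fibre. -/
theorem IsVBGroupoid.finrank_range_coreProj (hD : D.IsVBGroupoid) (x : G.Obj) :
    Module.finrank ℝ (LinearMap.range (D.coreProj x))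
      = Module.finrank ℝ D.Gam.F - Module.finrank ℝ D.E.F := by
  have h1 := (D.src (𝟙 x)).finrank_range_add_finrank_ker
  rw [LinearMap.range_eq_top.2 (hD.surjective_src (𝟙 x)), finrank_top, SmoothVB.finrank_fib,
    SmoothVB.finrank_fib] at h1
  have h2 : Module.finrank ℝ (LinearMap.range (D.coreProj x))
      = Module.finrank ℝ (LinearMap.ker (D.src (𝟙 x))) := by
    rw [hD.range_coreProj]
    rfl
  omega

/-- The smooth family of projections onto the kernel of the source map. Its rank is realised by a
Euclidean space, lifted to the universe of the model fibres. -/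
def IsVBGroupoid.coreIdempotent (hD : D.IsVBGroupoid) :
    SmoothIdempotent (D.Gam.pullback G.oneMap) (EuclideanSpace ℝ
      (ULift.{u} (Fin (Module.finrank ℝ D.Gam.F - Module.finrank ℝ D.E.F)))) where
  P := D.coreProj
  smooth := by
    have h0 := smoothAlong_self (I := (D.Gam.pullback G.oneMap).model)
      (fun v : (D.Gam.pullback G.oneMap).Tot => v)
    have h1 := (SmoothVB.contMDiff_pullback_lift G.oneMap D.Gam).comp_smoothAlong h0
    exact smoothAlong_id_iff.1 (SmoothVB.smoothAlong_pullback (f := G.oneMap)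
      (SmoothVB.smoothAlong_proj h0) (SmoothVB.smoothAlong_sub h1
        (hD.smooth_one.comp_smoothAlong (hD.submersion_src.smooth.comp_smoothAlong h1))))
  idem x v := coreProj_of_src_eq_zero (hD.src_coreProj x v)
  finrank_eq x := by
    rw [hD.finrank_range_coreProj, finrank_euclideanSpace, Fintype.card_ulift, Fintype.card_fin]

/-- The core bundle is the image of the projections `v ↦ v - 1_{s(v)}`. -/
theorem IsVBGroupoid.nonempty_coreSplitting (hD : D.IsVBGroupoid) :
    Nonempty (CoreSplitting D) := by
  obtain ⟨σ, hσ, hσs, hσ1⟩ := hD.exists_unital_splitting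
  let S := hD.coreIdempotent
  exact ⟨{
    C := S.image
    incl := S.imageIncl
    proj := S.imageProj
    lift := σ
    smooth_incl := (SmoothVB.contMDiff_pullback_lift G.oneMap D.Gam).comp S.smooth_imageIncl
    smooth_proj := S.smooth_imageProj
    smooth_lift := hσ
    src_incl := fun x c => by
      have h : S.P x (S.imageIncl x c) = S.imageIncl x c := by
        rw [← S.imageIncl_imageProj, S.imageProj_imageIncl]
      exact (congrArg (D.src (𝟙 x)) h).symm.trans (hD.src_coreProj x _)
    proj_incl := S.imageProj_imageIncl
    incl_proj := fun x v hv => (S.imageIncl_imageProj x v).trans (coreProj_of_src_eq_zero hv)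
    src_lift := hσs
    lift_one := hσ1 }⟩

/-! ### Multiplication with values over a prescribed arrow -/

/-- The product of `a ∈ Γ_h` and `b ∈ Γ_g`, as an element of the fibre over an arrow `k` that is
equal to the composite of `g` and `h`. -/
def mulTo (D : VBData G) {x y z : G.Obj} {h : y ⟶ z} {g : x ⟶ y} {k : x ⟶ z} (hk : g ≫ h = k)
    (a : D.Gam.Fib ⟨h⟩) (b : D.Gam.Fib ⟨g⟩) (hab : D.src h a = D.tgt g b) : D.Gam.Fib ⟨k⟩ :=
  hk ▸ D.mul h g a b hab

theorem pt_mulTo {x y z : G.Obj} {h : y ⟶ z} {g : x ⟶ y} {k : x ⟶ z} (hk : g ≫ h = k)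
    (a : D.Gam.Fib ⟨h⟩) (b : D.Gam.Fib ⟨g⟩) (hab : D.src h a = D.tgt g b) :
    D.Gam.pt ⟨k⟩ (D.mulTo hk a b hab) = D.Gam.pt ⟨g ≫ h⟩ (D.mul h g a b hab) := by
  subst hk; rfl

theorem mulTo_congr {x y z : G.Obj} {h : y ⟶ z} {g : x ⟶ y} {k : x ⟶ z} (hk : g ≫ h = k)
    {a a' : D.Gam.Fib ⟨h⟩} {b b' : D.Gam.Fib ⟨g⟩} (hab : D.src h a = D.tgt g b) (ha : a = a')
    (hb : b = b') : D.mulTo hk a b hab = D.mulTo hk a' b' (ha ▸ hb ▸ hab) := by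
  subst ha hb; rfl

namespace IsVBGroupoid

variable (hD : D.IsVBGroupoid)
include hD

theorem src_mulTo {x y z : G.Obj} {h : y ⟶ z} {g : x ⟶ y} {k : x ⟶ z} (hk : g ≫ h = k)
    (a : D.Gam.Fib ⟨h⟩) (b : D.Gam.Fib ⟨g⟩) (hab : D.src h a = D.tgt g b) :
    D.src k (D.mulTo hk a b hab) = D.src g b := by
  subst hk; exact hD.src_mul h g a b hab

theorem tgt_mulTo {x y z : G.Obj} {h : y ⟶ z} {g : x ⟶ y} {k : x ⟶ z} (hk : g ≫ h = k)
    (a : D.Gam.Fib ⟨h⟩) (b : D.Gam.Fib ⟨g⟩) (hab : D.src h a = D.tgt g b) :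
    D.tgt k (D.mulTo hk a b hab) = D.tgt h a := by
  subst hk; exact hD.tgt_mul h g a b hab

theorem mulTo_assoc {w x y z : G.Obj} {k : y ⟶ z} {h : x ⟶ y} {g : w ⟶ x} {hk : x ⟶ z}
    {gh : w ⟶ y} {ghk : w ⟶ z} (e₁ : h ≫ k = hk) (e₂ : g ≫ h = gh) (e₃ : g ≫ hk = ghk)
    (e₄ : gh ≫ k = ghk) (a : D.Gam.Fib ⟨k⟩) (b : D.Gam.Fib ⟨h⟩) (c : D.Gam.Fib ⟨g⟩)
    (hab : D.src k a = D.tgt h b) (hbc : D.src h b = D.tgt g c) :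
    D.mulTo e₃ (D.mulTo e₁ a b hab) c ((hD.src_mulTo e₁ a b hab).trans hbc)
      = D.mulTo e₄ a (D.mulTo e₂ b c hbc) (hab.trans (hD.tgt_mulTo e₂ b c hbc).symm) := by
  subst e₁ e₂ e₃
  refine TotalSpace.mk_inj.1 (Eq.trans (hD.mul_assoc k h g a b c hab hbc
    ((hD.src_mul k h a b hab).trans hbc) (hab.trans (hD.tgt_mul h g b c hbc).symm)) ?_)
  exact (D.pt_mulTo e₄ _ _ _).symm

theorem mulTo_one {x y : G.Obj} {g k : x ⟶ y} (hk : 𝟙 x ≫ k = g) (a : D.Gam.Fib ⟨k⟩)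
    (e : D.E.Fib x) (h : D.src k a = D.tgt (𝟙 x) (D.one x e)) :
    D.Gam.pt ⟨g⟩ (D.mulTo hk a (D.one x e) h) = D.Gam.pt ⟨k⟩ a := by
  obtain rfl : D.src k a = e := by rw [h, hD.tgt_one]
  rw [pt_mulTo, hD.mul_one]

theorem one_mulTo {x y : G.Obj} {g k : x ⟶ y} (hk : k ≫ 𝟙 y = g) (a : D.Gam.Fib ⟨k⟩)
    (e : D.E.Fib y) (h : D.src (𝟙 y) (D.one y e) = D.tgt k a) :
    D.Gam.pt ⟨g⟩ (D.mulTo hk (D.one y e) a h) = D.Gam.pt ⟨k⟩ a := by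
  obtain rfl : e = D.tgt k a := by rw [← h, hD.src_one]
  rw [pt_mulTo, hD.one_mul]

theorem mulTo_add {x y z : G.Obj} {h : y ⟶ z} {g : x ⟶ y} {k : x ⟶ z} (hk : g ≫ h = k)
    {a a' : D.Gam.Fib ⟨h⟩} {b b' : D.Gam.Fib ⟨g⟩} (hab : D.src h a = D.tgt g b)
    (hab' : D.src h a' = D.tgt g b') (hs : D.src h (a + a') = D.tgt g (b + b')) :
    D.mulTo hk (a + a') (b + b') hs = D.mulTo hk a b hab + D.mulTo hk a' b' hab' := by
  subst hk; exact hD.mul_add h g a a' b b' hab hab' hs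

theorem mulTo_smul {x y z : G.Obj} {h : y ⟶ z} {g : x ⟶ y} {k : x ⟶ z} (hk : g ≫ h = k) (r : ℝ)
    {a : D.Gam.Fib ⟨h⟩} {b : D.Gam.Fib ⟨g⟩} (hab : D.src h a = D.tgt g b)
    (hs : D.src h (r • a) = D.tgt g (r • b)) :
    D.mulTo hk (r • a) (r • b) hs = r • D.mulTo hk a b hab := by
  subst hk; exact hD.mul_smul h g r a b hab hs

/-- The product of two families of elements of `Γ` depending linearly on a parameter. -/
def mulLin {x y z : G.Obj} {h : y ⟶ z} {g : x ⟶ y} {k : x ⟶ z} (hk : g ≫ h = k)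
    {U : Type*} [AddCommGroup U] [Module ℝ U] (a : U →ₗ[ℝ] D.Gam.Fib ⟨h⟩)
    (b : U →ₗ[ℝ] D.Gam.Fib ⟨g⟩) (hab : ∀ v, D.src h (a v) = D.tgt g (b v)) :
    U →ₗ[ℝ] D.Gam.Fib ⟨k⟩ where
  toFun v := D.mulTo hk (a v) (b v) (hab v)
  map_add' v w := by
    rw [← hD.mulTo_add hk (hab v) (hab w) (by rw [← map_add, ← map_add, hab])]
    exact mulTo_congr _ _ (map_add _ _ _) (map_add _ _ _)
  map_smul' r v := by
    rw [RingHom.id_apply, ← hD.mulTo_smul hk r (hab v) (by rw [← map_smul, ← map_smul, hab])]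
    exact mulTo_congr _ _ (map_smul _ _ _) (map_smul _ _ _)

theorem mulTo_zero {x y z : G.Obj} {h : y ⟶ z} {g : x ⟶ y} {k : x ⟶ z} (hk : g ≫ h = k)
    (h0 : D.src h 0 = D.tgt g 0) : D.mulTo hk 0 0 h0 = 0 := by
  have h1 := hD.mulTo_smul hk 0 h0 (by rw [zero_smul, zero_smul, h0])
  exact (mulTo_congr hk _ (zero_smul ℝ _).symm (zero_smul ℝ _).symm).trans
    (h1.trans (zero_smul ℝ _))

theorem smoothAlong_mulTo {EX HX X P : Type*} [NormedAddCommGroup EX] [NormedSpace ℝ EX]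
    [TopologicalSpace HX] [TopologicalSpace X] [ChartedSpace HX X]
    {J : ModelWithCorners ℝ EX HX} {ι : P → X} {x y z : P → G.Obj} {h : ∀ p, y p ⟶ z p}
    {g : ∀ p, x p ⟶ y p} {k : ∀ p, x p ⟶ z p} (hk : ∀ p, g p ≫ h p = k p)
    {a : ∀ p, D.Gam.Fib ⟨h p⟩} {b : ∀ p, D.Gam.Fib ⟨g p⟩}
    (hab : ∀ p, D.src (h p) (a p) = D.tgt (g p) (b p))
    (ha : SmoothAlong J D.Gam.model ι (fun p => D.Gam.pt ⟨h p⟩ (a p)))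
    (hb : SmoothAlong J D.Gam.model ι (fun p => D.Gam.pt ⟨g p⟩ (b p))) :
    SmoothAlong J D.Gam.model ι (fun p => D.Gam.pt ⟨k p⟩ (D.mulTo (hk p) (a p) (b p) (hab p))) :=
  SmoothAlong.congr (hD.smooth_mul.comp (k := fun p => ⟨h p, g p, a p, b p, hab p⟩)
    (ha.prodMk hb)) fun p => (D.pt_mulTo (hk p) (a p) (b p) (hab p)).symm

end IsVBGroupoid
end VBData

/-! ### The representation up to homotopy of a split VB-groupoid -/

namespace VBData.IsVBGroupoid

variable {G : LieGroupoid.{u}} {D : VBData G} (hD : D.IsVBGroupoid)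
include hD

theorem one_mulTo_self {x y : G.Obj} {g : x ⟶ y} (hk : g ≫ 𝟙 y = g) (a : D.Gam.Fib ⟨g⟩)
    (e : D.E.Fib y) (h : D.src (𝟙 y) (D.one y e) = D.tgt g a) :
    D.mulTo hk (D.one y e) a h = a :=
  TotalSpace.mk_inj.1 (hD.one_mulTo hk a e h)

theorem mulTo_one_self {x y : G.Obj} {g : x ⟶ y} (hk : 𝟙 x ≫ g = g) (a : D.Gam.Fib ⟨g⟩)
    (e : D.E.Fib x) (h : D.src g a = D.tgt (𝟙 x) (D.one x e)) :
    D.mulTo hk a (D.one x e) h = a :=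
  TotalSpace.mk_inj.1 (hD.mulTo_one hk a e h)

theorem mulTo_zero_self {x y : G.Obj} {g : x ⟶ y} (hk : 𝟙 x ≫ g = g) (a : D.Gam.Fib ⟨g⟩)
    (h : D.src g a = D.tgt (𝟙 x) 0) : D.mulTo hk a 0 h = a :=
  (mulTo_congr hk h rfl (map_zero (D.one x)).symm).trans (hD.mulTo_one_self hk a 0 _)

theorem smoothAlong_src {EX HX X P : Type*} [NormedAddCommGroup EX] [NormedSpace ℝ EX]
    [TopologicalSpace HX] [TopologicalSpace X] [ChartedSpace HX X]
    {J : ModelWithCorners ℝ EX HX} {ι : P → X} {x y : P → G.Obj} {g : ∀ p, x p ⟶ y p}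
    {v : ∀ p, D.Gam.Fib ⟨g p⟩}
    (hv : SmoothAlong J D.Gam.model ι (fun p => D.Gam.pt ⟨g p⟩ (v p))) :
    SmoothAlong J D.E.model ι (fun p => D.E.pt (x p) (D.src (g p) (v p))) :=
  hD.submersion_src.smooth.comp_smoothAlong hv

theorem smoothAlong_tgt {EX HX X P : Type*} [NormedAddCommGroup EX] [NormedSpace ℝ EX]
    [TopologicalSpace HX] [TopologicalSpace X] [ChartedSpace HX X]
    {J : ModelWithCorners ℝ EX HX} {ι : P → X} {x y : P → G.Obj} {g : ∀ p, x p ⟶ y p}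
    {v : ∀ p, D.Gam.Fib ⟨g p⟩}
    (hv : SmoothAlong J D.Gam.model ι (fun p => D.Gam.pt ⟨g p⟩ (v p))) :
    SmoothAlong J D.E.model ι (fun p => D.E.pt (y p) (D.tgt (g p) (v p))) :=
  hD.submersion_tgt.smooth.comp_smoothAlong hv

end VBData.IsVBGroupoid

namespace CoreSplitting

variable {G : LieGroupoid.{u}} {D : VBData G} (S : CoreSplitting D) (hD : D.IsVBGroupoid)

/-- Right translation `c ↦ c · 0_g` of the core to the kernel of the source map over `g`. -/
def right {x y : G.Obj} (g : x ⟶ y) : S.C.Fib y →ₗ[ℝ] D.Gam.Fib ⟨g⟩ :=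
  hD.mulLin (Category.comp_id g) (S.incl y) 0
    (fun c => (S.src_incl y c).trans (map_zero (D.tgt g)).symm)

/-- The core component `v ↦ (v - σ_g(s(v))) · 0_{g⁻¹}` of an element of `Γ_g`, where `σ` is the
splitting. -/
def core {x y : G.Obj} (g : x ⟶ y) : D.Gam.Fib ⟨g⟩ →ₗ[ℝ] S.C.Fib y :=
  S.proj y ∘ₗ hD.mulLin (Groupoid.inv_comp g) (LinearMap.id - S.lift g ∘ₗ D.src g) 0
    (fun v => by
      rw [LinearMap.sub_apply, LinearMap.comp_apply, map_sub, S.src_lift, LinearMap.id_apply,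
        sub_self, LinearMap.zero_apply, map_zero])

theorem src_right {x y : G.Obj} (g : x ⟶ y) (c : S.C.Fib y) : D.src g (S.right hD g c) = 0 :=
  (hD.src_mulTo (Category.comp_id g) _ _ _).trans (map_zero (D.src g))

theorem right_one (x : G.Obj) (c : S.C.Fib x) : S.right hD (𝟙 x) c = S.incl x c :=
  hD.mulTo_zero_self _ _ _

theorem core_lift {x y : G.Obj} (g : x ⟶ y) (e : D.E.Fib x) : S.core hD g (S.lift g e) = 0 := by
  refine Eq.trans (congrArg (S.proj y) ?_) (map_zero (S.proj y))
  refine (VBData.mulTo_congr _ _ ?_ rfl).trans (hD.mulTo_zero (Groupoid.inv_comp g)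
    (by rw [map_zero, map_zero]))
  rw [LinearMap.sub_apply, LinearMap.comp_apply, S.src_lift, LinearMap.id_apply, sub_self]

theorem core_right {x y : G.Obj} (g : x ⟶ y) (c : S.C.Fib y) :
    S.core hD g (S.right hD g c) = c := by
  refine Eq.trans (congrArg (S.proj y) ?_) (S.proj_incl y c)
  refine (VBData.mulTo_congr _ _ (a' := S.right hD g c) ?_ rfl).trans ?_
  · rw [LinearMap.sub_apply, LinearMap.comp_apply, S.src_right, LinearMap.id_apply, map_zero,
      sub_zero]
  · have h0 : D.src (𝟙 y) (S.incl y c) = D.tgt g 0 := (S.src_incl y c).trans (map_zero _).symm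
    have h1 : D.src g 0 = D.tgt (Groupoid.inv g) 0 := (map_zero _).trans (map_zero _).symm
    refine (hD.mulTo_assoc (Category.comp_id g) (Groupoid.inv_comp g) (Groupoid.inv_comp g)
      (Category.comp_id (𝟙 y)) (S.incl y c) 0 0 h0 h1).trans ?_
    exact (VBData.mulTo_congr _ _ rfl (hD.mulTo_zero _ h1)).trans (hD.mulTo_zero_self _ _ _)

/-- Elements of `Γ_g` in the kernel of the source map are right translates of core elements. -/
theorem right_core_of_src_eq_zero {x y : G.Obj} (g : x ⟶ y) {v : D.Gam.Fib ⟨g⟩}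
    (hv : D.src g v = 0) : S.right hD g (S.core hD g v) = v := by
  have h1 : D.src g v = D.tgt (Groupoid.inv g) 0 := hv.trans (map_zero _).symm
  have h2 : D.src (Groupoid.inv g) 0 = D.tgt g 0 := (map_zero _).trans (map_zero _).symm
  have hcore : S.core hD g v = S.proj y (D.mulTo (Groupoid.inv_comp g) v 0 h1) := by
    refine congrArg (S.proj y) (VBData.mulTo_congr _ _ ?_ rfl)
    rw [LinearMap.sub_apply, LinearMap.comp_apply, hv, LinearMap.id_apply, map_zero, sub_zero]
  have hincl : S.incl y (S.core hD g v) = D.mulTo (Groupoid.inv_comp g) v 0 h1 := by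
    rw [hcore]
    exact S.incl_proj y _ ((hD.src_mulTo _ _ _ _).trans (map_zero _))
  refine (VBData.mulTo_congr _ _ hincl rfl).trans ?_
  refine (hD.mulTo_assoc (Groupoid.inv_comp g) (Groupoid.comp_inv g) (Category.comp_id g)
    (Category.id_comp g) v 0 0 h1 h2).trans ?_
  exact (VBData.mulTo_congr _ _ rfl (hD.mulTo_zero _ h2)).trans (hD.mulTo_zero_self _ _ _)

theorem right_core_add_lift {x y : G.Obj} (g : x ⟶ y) (v : D.Gam.Fib ⟨g⟩) :
    S.right hD g (S.core hD g v) + S.lift g (D.src g v) = v := by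
  have h : D.src g (v - S.lift g (D.src g v)) = 0 := by rw [map_sub, S.src_lift, sub_self]
  have h1 := S.right_core_of_src_eq_zero hD g h
  rw [map_sub, S.core_lift, sub_zero] at h1
  rw [h1, sub_add_cancel]

theorem src_right_add_lift {x y : G.Obj} (g : x ⟶ y) (c : S.C.Fib y) (e : D.E.Fib x) :
    D.src g (S.right hD g c + S.lift g e) = e := by
  rw [map_add, S.src_right, S.src_lift, zero_add]

theorem core_right_add_lift {x y : G.Obj} (g : x ⟶ y) (c : S.C.Fib y) (e : D.E.Fib x) :
    S.core hD g (S.right hD g c + S.lift g e) = c := by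
  rw [map_add, S.core_right, S.core_lift, add_zero]

theorem core_incl (x : G.Obj) (c : S.C.Fib x) : S.core hD (𝟙 x) (S.incl x c) = c := by
  rw [← S.right_one hD, S.core_right]

/-- The differential of the representation up to homotopy: the target map, restricted to the
core. -/
def dCore (x : G.Obj) : S.C.Fib x →ₗ[ℝ] D.E.Fib x := D.tgt (𝟙 x) ∘ₗ S.incl x

/-- The action `e ↦ t(σ_g(e))` of arrows on the side bundle. -/
def actE {x y : G.Obj} (g : x ⟶ y) : D.E.Fib x →ₗ[ℝ] D.E.Fib y := D.tgt g ∘ₗ S.lift g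

/-- The product `σ_g(∂c) · c`. -/
def mulCore {x y : G.Obj} (g : x ⟶ y) : S.C.Fib x →ₗ[ℝ] D.Gam.Fib ⟨g⟩ :=
  hD.mulLin (Category.id_comp g) (S.lift g ∘ₗ S.dCore x) (S.incl x) (fun _ => S.src_lift g _)

/-- The action of arrows on the core, `c ↦ σ_g(∂c) · c · 0_{g⁻¹}`. -/
def actC {x y : G.Obj} (g : x ⟶ y) : S.C.Fib x →ₗ[ℝ] S.C.Fib y := S.core hD g ∘ₗ S.mulCore hD g

/-- The product `σ_h(t(σ_g(e))) · σ_g(e)`, over an arrow `k` equal to the composite. -/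
def mulLift {x y z : G.Obj} {h : y ⟶ z} {g : x ⟶ y} {k : x ⟶ z} (hk : g ≫ h = k) :
    D.E.Fib x →ₗ[ℝ] D.Gam.Fib ⟨k⟩ :=
  hD.mulLin hk (S.lift h ∘ₗ S.actE g) (S.lift g) (fun _ => S.src_lift h _)

/-- The curvature, which measures the failure of the splitting to be multiplicative. -/
def curv {x y z : G.Obj} (h : y ⟶ z) (g : x ⟶ y) : D.E.Fib x →ₗ[ℝ] S.C.Fib z :=
  -(S.core hD (g ≫ h) ∘ₗ S.mulLift hD rfl)

theorem core_mulLift {x y z : G.Obj} {h : y ⟶ z} {g : x ⟶ y} {k : x ⟶ z} (hk : g ≫ h = k)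
    (e : D.E.Fib x) : S.core hD k (S.mulLift hD hk e) = -S.curv hD h g e := by
  subst hk
  exact (neg_neg _).symm

theorem src_mulLift {x y z : G.Obj} {h : y ⟶ z} {g : x ⟶ y} {k : x ⟶ z} (hk : g ≫ h = k)
    (e : D.E.Fib x) : D.src k (S.mulLift hD hk e) = e :=
  (hD.src_mulTo hk _ _ _).trans (S.src_lift g e)

theorem tgt_mulLift {x y z : G.Obj} {h : y ⟶ z} {g : x ⟶ y} {k : x ⟶ z} (hk : g ≫ h = k)
    (e : D.E.Fib x) : D.tgt k (S.mulLift hD hk e) = S.actE h (S.actE g e) :=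
  hD.tgt_mulTo hk _ _ _

theorem src_mulCore {x y : G.Obj} (g : x ⟶ y) (c : S.C.Fib x) :
    D.src g (S.mulCore hD g c) = 0 :=
  (hD.src_mulTo (Category.id_comp g) _ _ _).trans (S.src_incl x c)

theorem tgt_mulCore {x y : G.Obj} (g : x ⟶ y) (c : S.C.Fib x) :
    D.tgt g (S.mulCore hD g c) = S.actE g (S.dCore x c) :=
  hD.tgt_mulTo (Category.id_comp g) _ _ _

theorem tgt_right {x y : G.Obj} (g : x ⟶ y) (c : S.C.Fib y) :
    D.tgt g (S.right hD g c) = S.dCore y c :=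
  hD.tgt_mulTo (Category.comp_id g) _ _ _

theorem tgt_right_add_lift {x y : G.Obj} (g : x ⟶ y) (c : S.C.Fib y) (e : D.E.Fib x) :
    D.tgt g (S.right hD g c + S.lift g e) = S.dCore y c + S.actE g e := by
  rw [map_add, S.tgt_right]
  rfl

theorem tgt_eq {x y : G.Obj} (g : x ⟶ y) (v : D.Gam.Fib ⟨g⟩) :
    D.tgt g v = S.dCore y (S.core hD g v) + S.actE g (D.src g v) := by
  rw [← S.tgt_right_add_lift hD, S.right_core_add_lift]

theorem mulTo_right_zero {x y z : G.Obj} {h : y ⟶ z} {g : x ⟶ y} {k : x ⟶ z} (hk : g ≫ h = k)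
    (c : S.C.Fib z) (h0 : D.src h (S.right hD h c) = D.tgt g 0) :
    D.mulTo hk (S.right hD h c) 0 h0 = S.right hD k c := by
  have h1 : D.src (𝟙 z) (S.incl z c) = D.tgt h 0 := (S.src_incl z c).trans (map_zero _).symm
  have h2 : D.src h 0 = D.tgt g 0 := (map_zero _).trans (map_zero _).symm
  refine (hD.mulTo_assoc (Category.comp_id h) hk hk (Category.comp_id k) (S.incl z c) 0 0
    h1 h2).trans ?_
  exact VBData.mulTo_congr _ _ rfl (hD.mulTo_zero _ h2)

/-- The product `σ_h(∂c) · (c · 0_g)` is the right translate of `σ_h(∂c) · c`. -/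
theorem mulTo_lift_right {x y z : G.Obj} {h : y ⟶ z} {g : x ⟶ y} {k : x ⟶ z} (hk : g ≫ h = k)
    (c : S.C.Fib y) (h0 : D.src h (S.lift h (S.dCore y c)) = D.tgt g (S.right hD g c)) :
    D.mulTo hk (S.lift h (S.dCore y c)) (S.right hD g c) h0 = S.right hD k (S.actC hD h c) := by
  have h1 : D.src h (S.lift h (S.dCore y c)) = D.tgt (𝟙 y) (S.incl y c) := S.src_lift h _
  have h2 : D.src (𝟙 y) (S.incl y c) = D.tgt g 0 := (S.src_incl y c).trans (map_zero _).symm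
  refine (hD.mulTo_assoc (Category.id_comp h) (Category.comp_id g) hk hk
    (S.lift h (S.dCore y c)) (S.incl y c) 0 h1 h2).symm.trans ?_
  refine (VBData.mulTo_congr _ _ (a' := S.right hD h (S.actC hD h c)) ?_ rfl).trans
    (S.mulTo_right_zero hD hk _ _)
  exact (S.right_core_of_src_eq_zero hD h (S.src_mulCore hD h c)).symm

/-- The multiplication of `Γ` in terms of the decomposition into core and splitting parts. -/
theorem mulTo_right_add_lift {x y z : G.Obj} {h : y ⟶ z} {g : x ⟶ y} {k : x ⟶ z}
    (hk : g ≫ h = k) (c₁ : S.C.Fib z) (c₂ : S.C.Fib y) (e : D.E.Fib x) (e₁ : D.E.Fib y)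
    (he : e₁ = S.dCore y c₂ + S.actE g e)
    (hab : D.src h (S.right hD h c₁ + S.lift h e₁) = D.tgt g (S.right hD g c₂ + S.lift g e)) :
    D.mulTo hk (S.right hD h c₁ + S.lift h e₁) (S.right hD g c₂ + S.lift g e) hab
      = S.right hD k (c₁ + S.actC hD h c₂ - S.curv hD h g e) + S.lift k e := by
  subst he
  have h1 : D.src h (S.right hD h c₁) = D.tgt g 0 := (S.src_right hD h c₁).trans (map_zero _).symm
  have h2 : D.src h (S.lift h (S.dCore y c₂)) = D.tgt g (S.right hD g c₂) :=
    (S.src_lift h _).trans (S.tgt_right hD g c₂).symm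
  have h3 : D.src h (S.lift h (S.actE g e)) = D.tgt g (S.lift g e) := S.src_lift h _
  have h23 : D.src h (S.lift h (S.dCore y c₂) + S.lift h (S.actE g e))
      = D.tgt g (S.right hD g c₂ + S.lift g e) := by rw [map_add, map_add, h2, h3]
  have h123 : D.src h (S.right hD h c₁ + (S.lift h (S.dCore y c₂) + S.lift h (S.actE g e)))
      = D.tgt g (0 + (S.right hD g c₂ + S.lift g e)) := by rw [map_add, h1, h23, ← map_add]
  have hw : D.mulTo hk (S.lift h (S.actE g e)) (S.lift g e) h3
      = S.right hD k (-S.curv hD h g e) + S.lift k e := by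
    have := S.right_core_add_lift hD k (S.mulLift hD hk e)
    rw [S.core_mulLift, S.src_mulLift] at this
    exact this.symm
  refine (VBData.mulTo_congr hk hab (by rw [map_add (S.lift h)]) (zero_add _).symm).trans ?_
  refine (hD.mulTo_add hk h1 h23 h123).trans ?_
  rw [hD.mulTo_add hk h2 h3 h23, S.mulTo_right_zero, S.mulTo_lift_right, hw, map_sub, map_add,
    map_neg]
  abel

theorem core_mulTo {x y z : G.Obj} {h : y ⟶ z} {g : x ⟶ y} {k : x ⟶ z} (hk : g ≫ h = k)
    (a : D.Gam.Fib ⟨h⟩) (b : D.Gam.Fib ⟨g⟩) (hab : D.src h a = D.tgt g b) :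
    S.core hD k (D.mulTo hk a b hab)
      = S.core hD h a + S.actC hD h (S.core hD g b) - S.curv hD h g (D.src g b) := by
  have h1 := VBData.mulTo_congr hk hab (S.right_core_add_lift hD h a).symm
    (S.right_core_add_lift hD g b).symm
  rw [h1, S.mulTo_right_add_lift hD hk _ _ _ _ (hab.trans (S.tgt_eq hD g b)),
    S.core_right_add_lift]

include hD in
theorem actE_one (x : G.Obj) (e : D.E.Fib x) : S.actE (𝟙 x) e = e :=
  (congrArg (D.tgt (𝟙 x)) (S.lift_one x e)).trans (hD.tgt_one x e)

theorem actC_one (x : G.Obj) (c : S.C.Fib x) : S.actC hD (𝟙 x) c = c := by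
  refine Eq.trans (congrArg (S.core hD (𝟙 x)) ?_) (S.core_incl hD x c)
  exact (VBData.mulTo_congr _ _ (S.lift_one x _) rfl).trans (hD.one_mulTo_self _ _ _ _)

theorem curv_one_left {x y : G.Obj} (g : x ⟶ y) (e : D.E.Fib x) : S.curv hD (𝟙 y) g e = 0 := by
  rw [← neg_eq_zero, ← S.core_mulLift hD (Category.comp_id g), ← S.core_lift hD g e]
  refine congrArg (S.core hD g) ?_
  exact (VBData.mulTo_congr _ _ (S.lift_one y _) rfl).trans (hD.one_mulTo_self _ _ _ _)

theorem curv_one_right {x y : G.Obj} (g : x ⟶ y) (e : D.E.Fib x) : S.curv hD g (𝟙 x) e = 0 := by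
  rw [← neg_eq_zero, ← S.core_mulLift hD (Category.id_comp g),
    ← S.core_lift hD g (S.actE (𝟙 x) e)]
  refine congrArg (S.core hD g) ?_
  exact (VBData.mulTo_congr _ _ rfl (S.lift_one x e)).trans (hD.mulTo_one_self _ _ _ _)

theorem actE_dCore {x y : G.Obj} (g : x ⟶ y) (c : S.C.Fib x) :
    S.actE g (S.dCore x c) - S.dCore y (S.actC hD g c) = 0 := by
  have h := S.tgt_eq hD g (S.mulCore hD g c)
  rw [S.tgt_mulCore, S.src_mulCore, map_zero, add_zero] at h
  exact sub_eq_zero.2 h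

theorem actE_actE {x y z : G.Obj} (h : y ⟶ z) (g : x ⟶ y) (e : D.E.Fib x) :
    S.actE h (S.actE g e) - S.actE (g ≫ h) e + S.dCore z (S.curv hD h g e) = 0 := by
  have key := S.tgt_eq hD (g ≫ h) (S.mulLift hD rfl e)
  rw [S.tgt_mulLift, S.src_mulLift, S.core_mulLift, map_neg] at key
  rw [key]
  abel

/-- The consequence of the associativity of `Γ` for the core components. -/
theorem curv_assoc {w x y z : G.Obj} (k : y ⟶ z) (h : x ⟶ y) (g : w ⟶ x) (v : D.Gam.Fib ⟨g⟩) :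
    -S.curv hD k h (D.tgt g v) + S.actC hD (h ≫ k) (S.core hD g v)
        - S.curv hD (h ≫ k) g (D.src g v)
      = S.actC hD k (S.actC hD h (S.core hD g v) - S.curv hD h g (D.src g v))
        - S.curv hD k (g ≫ h) (D.src g v) := by
  have hbc : D.src h (S.lift h (D.tgt g v)) = D.tgt g v := S.src_lift h _
  have hab : D.src k (S.lift k (D.tgt h (S.lift h (D.tgt g v))))
      = D.tgt h (S.lift h (D.tgt g v)) := S.src_lift k _
  have key := congrArg (S.core hD (g ≫ h ≫ k)) (hD.mulTo_assoc (k := k) (h := h) (g := g) rfl rfl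
    rfl (Category.assoc g h k) _ _ v hab hbc)
  simp only [S.core_mulTo, hD.src_mulTo, S.core_lift, S.src_lift, map_zero, zero_add] at key
  rw [zero_sub] at key
  exact key

/-- `curv_assoc` for core elements over a unit. -/
theorem actC_actC {x y z : G.Obj} (h : y ⟶ z) (g : x ⟶ y) (c : S.C.Fib x) :
    S.actC hD h (S.actC hD g c) - S.actC hD (g ≫ h) c + S.curv hD h g (S.dCore x c) = 0 := by
  have key := S.curv_assoc hD h g (𝟙 x) (S.incl x c)
  rw [S.core_incl, S.src_incl, map_zero, map_zero, map_zero, sub_zero, sub_zero, sub_zero] at key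
  rw [← key]
  change -S.curv hD h g (S.dCore x c) + _ - _ + _ = _
  abel

/-- `curv_assoc` for elements of the image of the splitting. -/
theorem curv_cocycle {w x y z : G.Obj} (k : y ⟶ z) (h : x ⟶ y) (g : w ⟶ x) (e : D.E.Fib w) :
    S.actC hD k (S.curv hD h g e) - S.curv hD (h ≫ k) g e + S.curv hD k (g ≫ h) e
      - S.curv hD k h (S.actE g e) = 0 := by
  have key := S.curv_assoc hD k h g (S.lift g e)
  rw [S.core_lift, S.src_lift, map_zero, map_zero, add_zero, zero_sub, map_neg] at key
  change -S.curv hD k h (S.actE g e) - _ = _ at key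
  linear_combination (norm := module) key

section Smooth

variable {EX HX X P : Type*} [NormedAddCommGroup EX] [NormedSpace ℝ EX] [TopologicalSpace HX]
  [TopologicalSpace X] [ChartedSpace HX X] {J : ModelWithCorners ℝ EX HX} {ι : P → X}
  {x y z : P → G.Obj}

theorem smoothAlong_lift {g : ∀ p, x p ⟶ y p} {e : ∀ p, D.E.Fib (x p)}
    (hg : SmoothAlong J (𝓡 G.dimArr) ι (fun p => (⟨g p⟩ : G.Arr)))
    (he : SmoothAlong J D.E.model ι (fun p => D.E.pt (x p) (e p))) :
    SmoothAlong J D.Gam.model ι (fun p => D.Gam.pt ⟨g p⟩ (S.lift (g p) (e p))) :=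
  S.smooth_lift.smoothAlong (SmoothVB.smoothAlong_pullback (f := G.srcMap) hg he)

theorem smoothAlong_incl {c : ∀ p, S.C.Fib (x p)}
    (hc : SmoothAlong J S.C.model ι (fun p => S.C.pt (x p) (c p))) :
    SmoothAlong J D.Gam.model ι (fun p => D.Gam.pt ⟨𝟙 (x p)⟩ (S.incl (x p) (c p))) :=
  S.smooth_incl.comp_smoothAlong hc

theorem smoothAlong_right {g : ∀ p, x p ⟶ y p} {c : ∀ p, S.C.Fib (y p)}
    (hg : SmoothAlong J (𝓡 G.dimArr) ι (fun p => (⟨g p⟩ : G.Arr)))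
    (hc : SmoothAlong J S.C.model ι (fun p => S.C.pt (y p) (c p))) :
    SmoothAlong J D.Gam.model ι (fun p => D.Gam.pt ⟨g p⟩ (S.right hD (g p) (c p))) :=
  hD.smoothAlong_mulTo (fun p => Category.comp_id (g p)) _ (S.smoothAlong_incl hc)
    (D.Gam.smoothAlong_zero hg)

theorem smoothAlong_core {g : ∀ p, x p ⟶ y p} {v : ∀ p, D.Gam.Fib ⟨g p⟩}
    (hv : SmoothAlong J D.Gam.model ι (fun p => D.Gam.pt ⟨g p⟩ (v p))) :
    SmoothAlong J S.C.model ι (fun p => S.C.pt (y p) (S.core hD (g p) (v p))) := by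
  have hg := SmoothVB.smoothAlong_proj hv
  have hw := hD.smoothAlong_mulTo (fun p => Groupoid.inv_comp (g p))
    (a := fun p => (LinearMap.id - S.lift (g p) ∘ₗ D.src (g p) :
      D.Gam.Fib ⟨g p⟩ →ₗ[ℝ] D.Gam.Fib ⟨g p⟩) (v p))
    (b := fun p => (0 : D.Gam.Fib ⟨Groupoid.inv (g p)⟩))
    (fun p => by
      rw [LinearMap.sub_apply, LinearMap.comp_apply, map_sub, S.src_lift, LinearMap.id_apply,
        sub_self, map_zero])
    (SmoothVB.smoothAlong_sub hv (S.smoothAlong_lift hg (hD.smoothAlong_src hv)))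
    (D.Gam.smoothAlong_zero (smoothAlong_inv hg))
  exact S.smooth_proj.smoothAlong
    (SmoothVB.smoothAlong_pullback (f := G.oneMap) (smoothAlong_tgt hg) hw)

include hD in
theorem smoothAlong_dCore {c : ∀ p, S.C.Fib (x p)}
    (hc : SmoothAlong J S.C.model ι (fun p => S.C.pt (x p) (c p))) :
    SmoothAlong J D.E.model ι (fun p => D.E.pt (x p) (S.dCore (x p) (c p))) :=
  hD.smoothAlong_tgt (S.smoothAlong_incl hc)

include hD in
theorem smoothAlong_actE {g : ∀ p, x p ⟶ y p} {e : ∀ p, D.E.Fib (x p)}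
    (hg : SmoothAlong J (𝓡 G.dimArr) ι (fun p => (⟨g p⟩ : G.Arr)))
    (he : SmoothAlong J D.E.model ι (fun p => D.E.pt (x p) (e p))) :
    SmoothAlong J D.E.model ι (fun p => D.E.pt (y p) (S.actE (g p) (e p))) :=
  hD.smoothAlong_tgt (S.smoothAlong_lift hg he)

theorem smoothAlong_actC {g : ∀ p, x p ⟶ y p} {c : ∀ p, S.C.Fib (x p)}
    (hg : SmoothAlong J (𝓡 G.dimArr) ι (fun p => (⟨g p⟩ : G.Arr)))
    (hc : SmoothAlong J S.C.model ι (fun p => S.C.pt (x p) (c p))) :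
    SmoothAlong J S.C.model ι (fun p => S.C.pt (y p) (S.actC hD (g p) (c p))) :=
  S.smoothAlong_core hD (hD.smoothAlong_mulTo (fun p => Category.id_comp (g p)) _
    (S.smoothAlong_lift hg (S.smoothAlong_dCore hD hc)) (S.smoothAlong_incl hc))

theorem smoothAlong_curv {h : ∀ p, y p ⟶ z p} {g : ∀ p, x p ⟶ y p} {e : ∀ p, D.E.Fib (x p)}
    (hh : SmoothAlong J (𝓡 G.dimArr) ι (fun p => (⟨h p⟩ : G.Arr)))
    (hg : SmoothAlong J (𝓡 G.dimArr) ι (fun p => (⟨g p⟩ : G.Arr)))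
    (he : SmoothAlong J D.E.model ι (fun p => D.E.pt (x p) (e p))) :
    SmoothAlong J S.C.model ι (fun p => S.C.pt (z p) (S.curv hD (h p) (g p) (e p))) :=
  SmoothVB.smoothAlong_neg (S.smoothAlong_core hD (hD.smoothAlong_mulTo (fun _ => rfl) _
    (S.smoothAlong_lift hh (S.smoothAlong_actE hD hg he)) (S.smoothAlong_lift hg he)))

end Smooth

/-- The 2-term representation up to homotopy of a VB-groupoid with a core bundle and a unital
splitting. -/
def ruth : Ruth G where
  E := D.E
  C := S.C
  d := S.dCore
  rhoE := S.actE
  rhoC := S.actC hD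
  gamma := S.curv hD
  smooth_d := smoothAlong_id_iff.1
    (S.smoothAlong_dCore hD (smoothAlong_self (I := S.C.model) (fun c : S.C.Tot => c)))
  smooth_rhoE := by
    have h0 := smoothAlong_self (I := (𝓡 G.dimArr).prod D.E.model)
      (fun p : (Σ a : G.Arr, D.E.Fib a.src) => (p.1, D.E.pt p.1.src p.2))
    exact S.smoothAlong_actE hD h0.fst h0.snd
  smooth_rhoC := by
    have h0 := smoothAlong_self (I := (𝓡 G.dimArr).prod S.C.model)
      (fun p : (Σ a : G.Arr, S.C.Fib a.src) => (p.1, S.C.pt p.1.src p.2))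
    exact S.smoothAlong_actC hD h0.fst h0.snd
  smooth_gamma := by
    have h0 := smoothAlong_self (I := (𝓡 G.dimArr).prod ((𝓡 G.dimArr).prod D.E.model))
      (fun p : (Σ c : ComposablePair G.Obj, D.E.Fib c.x) =>
        ((⟨p.1.h⟩, ⟨p.1.g⟩, D.E.pt p.1.x p.2) : G.Arr × G.Arr × D.E.Tot))
    exact S.smoothAlong_curv hD h0.fst h0.snd.fst h0.snd.snd
  rhoE_one := S.actE_one hD
  rhoC_one := S.actC_one hD
  gamma_one_left := S.curv_one_left hD
  gamma_one_right := S.curv_one_right hD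
  rhoE_d := S.actE_dCore hD
  rhoC_rhoC := S.actC_actC hD
  rhoE_rhoE := S.actE_actE hD
  gamma_cocycle := S.curv_cocycle hD

end CoreSplitting

/-! ### Isomorphisms of VB-groupoids -/

variable {G : LieGroupoid.{u}} {D D' : VBData G}

/-- A left inverse for the multiplication of a VB-groupoid is the inverse. -/
theorem VBData.IsVBGroupoid.eq_inv (hD : D.IsVBGroupoid) {x y : G.Obj} (g : x ⟶ y)
    (a : D.Gam.Fib ⟨g⟩) (b : D.Gam.Fib ⟨Groupoid.inv g⟩)
    (hba : D.src (Groupoid.inv g) b = D.tgt g a)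
    (h : D.mulTo (Groupoid.comp_inv g) b a hba = D.one x (D.src g a)) : b = D.inv g a := by
  have hai : D.src g a = D.tgt (Groupoid.inv g) (D.inv g a) := (hD.tgt_inv g a).symm
  have h1 : D.mulTo (Groupoid.inv_comp g) a (D.inv g a) hai = D.one y (D.tgt g a) :=
    TotalSpace.mk_inj.1 ((D.pt_mulTo _ _ _ _).trans (hD.mul_inv g a hai))
  have h2 := hD.mulTo_assoc (Groupoid.comp_inv g) (Groupoid.inv_comp g)
    (Category.comp_id (Groupoid.inv g)) (Category.id_comp (Groupoid.inv g)) b a (D.inv g a) hba hai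
  rw [VBData.mulTo_congr _ _ h rfl, hD.one_mulTo_self, VBData.mulTo_congr _ _ rfl h1,
    hD.mulTo_one_self] at h2
  exact h2.symm

/-- A smooth pair of families of linear maps that respects sources, targets, units and products
also respects inverses. -/
theorem VBMapData.isVBMap_of_comm_mul (hD : D.IsVBGroupoid) (hD' : D'.IsVBGroupoid)
    {Φ : VBMapData D D'} (smooth_obj : D.E.IsSmoothHom D'.E Φ.obj)
    (smooth_arr : D.Gam.IsSmoothHom D'.Gam (fun a => Φ.arr a.hom))
    (comm_src : ∀ {x y : G.Obj} (g : x ⟶ y) (a : D.Gam.Fib ⟨g⟩),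
      D'.src g (Φ.arr g a) = Φ.obj x (D.src g a))
    (comm_tgt : ∀ {x y : G.Obj} (g : x ⟶ y) (a : D.Gam.Fib ⟨g⟩),
      D'.tgt g (Φ.arr g a) = Φ.obj y (D.tgt g a))
    (comm_one : ∀ (x : G.Obj) (e : D.E.Fib x), Φ.arr (𝟙 x) (D.one x e) = D'.one x (Φ.obj x e))
    (comm_mul : ∀ {x y z : G.Obj} (h : y ⟶ z) (g : x ⟶ y) (a : D.Gam.Fib ⟨h⟩) (b : D.Gam.Fib ⟨g⟩)
      (hab : D.src h a = D.tgt g b) (hab' : D'.src h (Φ.arr h a) = D'.tgt g (Φ.arr g b)),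
      Φ.arr (g ≫ h) (D.mul h g a b hab) = D'.mul h g (Φ.arr h a) (Φ.arr g b) hab') :
    Φ.IsVBMap where
  smooth_obj := smooth_obj
  smooth_arr := smooth_arr
  comm_src := comm_src
  comm_tgt := comm_tgt
  comm_one := comm_one
  comm_mul := comm_mul
  comm_inv {x y} g a := by
    have hia : D.src (Groupoid.inv g) (D.inv g a) = D.tgt g a := hD.src_inv g a
    have hia' : D'.src (Groupoid.inv g) (Φ.arr (Groupoid.inv g) (D.inv g a))
        = D'.tgt g (Φ.arr g a) := by rw [comm_src, comm_tgt, hia]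
    have key : ∀ {k : x ⟶ x} (hk : g ≫ Groupoid.inv g = k),
        D'.mulTo hk (Φ.arr (Groupoid.inv g) (D.inv g a)) (Φ.arr g a) hia'
          = Φ.arr k (D.mulTo hk (D.inv g a) a hia) := by
      rintro k rfl
      exact (comm_mul (Groupoid.inv g) g _ _ hia hia').symm
    refine hD'.eq_inv g _ _ hia' ?_
    have h1 : D.mulTo (Groupoid.comp_inv g) (D.inv g a) a hia = D.one x (D.src g a) :=
      TotalSpace.mk_inj.1 ((D.pt_mulTo _ _ _ _).trans (hD.inv_mul g a hia))
    rw [key, h1, comm_one, comm_src]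

/-- A smooth two-sided inverse of a VB-map is a VB-map. -/
theorem VBMapData.IsVBMap.of_inverse (hD : D.IsVBGroupoid) (hD' : D'.IsVBGroupoid)
    {Φ : VBMapData D D'} (hΦ : Φ.IsVBMap) {Ψ : VBMapData D' D}
    (smooth_obj : D'.E.IsSmoothHom D.E Ψ.obj)
    (smooth_arr : D'.Gam.IsSmoothHom D.Gam (fun a => Ψ.arr a.hom))
    (obj_left : ∀ x e, Ψ.obj x (Φ.obj x e) = e)
    (arr_left : ∀ {x y : G.Obj} (g : x ⟶ y) (a : D.Gam.Fib ⟨g⟩), Ψ.arr g (Φ.arr g a) = a)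
    (arr_right : ∀ {x y : G.Obj} (g : x ⟶ y) (a : D'.Gam.Fib ⟨g⟩), Φ.arr g (Ψ.arr g a) = a)
    (obj_right : ∀ x e, Φ.obj x (Ψ.obj x e) = e) : Ψ.IsVBMap := by
  refine VBMapData.isVBMap_of_comm_mul hD' hD smooth_obj smooth_arr ?_ ?_ ?_ ?_
  · intro x y g a
    rw [← obj_left x (D.src g (Ψ.arr g a)), ← hΦ.comm_src, arr_right]
  · intro x y g a
    rw [← obj_left y (D.tgt g (Ψ.arr g a)), ← hΦ.comm_tgt, arr_right]
  · intro x e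
    rw [← arr_left (𝟙 x) (D.one x (Ψ.obj x e)), hΦ.comm_one, obj_right]
  · intro x y z h g a b hab hab'
    have hab'' : D'.src h (Φ.arr h (Ψ.arr h a)) = D'.tgt g (Φ.arr g (Ψ.arr g b)) := by
      rw [arr_right, arr_right, hab]
    rw [← arr_left (g ≫ h) (D.mul h g _ _ hab'), hΦ.comm_mul h g _ _ hab' hab'']
    exact congrArg (Ψ.arr (g ≫ h)) (VBData.mulTo_congr rfl hab (arr_right h a).symm
      (arr_right g b).symm)

/-! ### A split VB-groupoid is isomorphic to a Grothendieck construction -/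

namespace CoreSplitting

variable (S : CoreSplitting D) (hD : D.IsVBGroupoid)

/-- The map `(c, g, e) ↦ c · 0_g + σ_g(e)` from the Grothendieck construction to `Γ`. -/
def fromSemidirect : VBMapData (S.ruth hD).semidirect D where
  obj _ := LinearMap.id
  arr g := LinearMap.coprod (S.right hD g) (S.lift g)

/-- The map from `Γ` to the Grothendieck construction with components the core component and the
source map. -/
def toSemidirect : VBMapData D (S.ruth hD).semidirect where
  obj _ := LinearMap.id
  arr g := LinearMap.prod (S.core hD g) (D.src g)

theorem isVBMap_fromSemidirect : (S.fromSemidirect hD).IsVBMap := by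
  refine VBMapData.isVBMap_of_comm_mul (S.ruth hD).isVBGroupoid hD contMDiff_id ?_ ?_ ?_ ?_ ?_
  · have h0 := smoothAlong_self (I := (S.ruth hD).semidirect.Gam.model)
      (fun v : (S.ruth hD).semidirect.Gam.Tot => v)
    have hg := (S.ruth hD).smoothAlong_proj h0
    exact smoothAlong_id_iff.1 (SmoothVB.smoothAlong_add
      (S.smoothAlong_right hD hg ((S.ruth hD).smoothAlong_fst h0))
      (S.smoothAlong_lift hg ((S.ruth hD).smoothAlong_snd h0)))
  · exact fun g a => S.src_right_add_lift hD g a.1 a.2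
  · exact fun g a => S.tgt_right_add_lift hD g a.1 a.2
  · have h : ∀ (x : G.Obj) (e : D.E.Fib x), S.right hD (𝟙 x) 0 + S.lift (𝟙 x) e = D.one x e := by
      intro x e
      rw [map_zero, zero_add, S.lift_one]
    exact h
  · intro x y z h g a b hab hab'
    exact (S.mulTo_right_add_lift hD rfl a.1 b.1 b.2 a.2 hab hab').symm

theorem toSemidirect_fromSemidirect {x y : G.Obj} (g : x ⟶ y)
    (a : (S.ruth hD).semidirect.Gam.Fib ⟨g⟩) :
    (S.toSemidirect hD).arr g ((S.fromSemidirect hD).arr g a) = a :=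
  Prod.ext (S.core_right_add_lift hD g a.1 a.2) (S.src_right_add_lift hD g a.1 a.2)

theorem isVBMap_toSemidirect : (S.toSemidirect hD).IsVBMap := by
  refine (S.isVBMap_fromSemidirect hD).of_inverse (S.ruth hD).isVBGroupoid hD contMDiff_id ?_
    (fun _ _ => rfl) (S.toSemidirect_fromSemidirect hD)
    (fun g v => S.right_core_add_lift hD g v) (fun _ _ => rfl)
  have h0 := smoothAlong_self (I := D.Gam.model) (fun v : D.Gam.Tot => v)
  exact smoothAlong_id_iff.1 ((S.ruth hD).smoothAlong_pt (SmoothVB.smoothAlong_proj h0)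
    (S.smoothAlong_core hD h0) (hD.smoothAlong_src h0))

/-- A VB-groupoid with a core bundle and a unital splitting is isomorphic to the Grothendieck
construction of its representation up to homotopy. -/
def isoSemidirect :
    (⟨(S.ruth hD).semidirect, (S.ruth hD).isVBGroupoid⟩ : VBGroupoid G) ≅ ⟨D, hD⟩ where
  hom := ⟨S.fromSemidirect hD, S.isVBMap_fromSemidirect hD⟩
  inv := ⟨S.toSemidirect hD, S.isVBMap_toSemidirect hD⟩
  hom_inv_id := VBHom.ext rfl
    (funext fun _ => funext fun _ => funext fun g =>
      LinearMap.ext fun a => S.toSemidirect_fromSemidirect hD g a)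
  inv_hom_id := VBHom.ext rfl
    (funext fun _ => funext fun _ => funext fun g =>
      LinearMap.ext fun v => S.right_core_add_lift hD g v)

end CoreSplitting

/-! ### The equivalence of categories -/

theorem isEquivalence_grothendieckFunctor (G : LieGroupoid.{u})
    (hobj : ∀ R : Ruth G, R.semidirect.IsVBGroupoid)
    (hmap : ∀ (R R' : Ruth G) (T : RuthTriple R R'), T.IsMorphism → T.semidirectMap.IsVBMap) :
    (grothendieckFunctor G hobj hmap).IsEquivalence where
  faithful := ⟨fun {R R' Φ Φ'} h => by
    have h1 : Φ.toRuthTriple.semidirectMap = Φ'.toRuthTriple.semidirectMap :=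
      congrArg VBHom.toVBMapData h
    have h2 : Φ.toRuthTriple = Φ'.toRuthTriple := by
      rw [← RuthTriple.ofVBMapData_semidirectMap Φ.toRuthTriple, h1,
        RuthTriple.ofVBMapData_semidirectMap]
    exact RuthHom.ext (congrArg RuthTriple.PhiE h2) (congrArg RuthTriple.PhiC h2)
      (congrArg (fun T => @RuthTriple.mu _ _ _ T) h2)⟩
  full := ⟨fun {R R'} Ψ => by
    have h := RuthTriple.semidirectMap_ofVBMapData Ψ.isVBMap
    refine ⟨⟨RuthTriple.ofVBMapData Ψ.toVBMapData,
      RuthTriple.isMorphism_of_isVBMap (h.symm ▸ Ψ.isVBMap)⟩, ?_⟩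
    exact VBHom.ext (congrArg VBMapData.obj h) (congrArg (fun Θ => @VBMapData.arr _ _ _ Θ) h)⟩
  essSurj := ⟨fun Γ => by
    obtain ⟨S⟩ := Γ.isVBGroupoid.nonempty_coreSplitting
    exact ⟨S.ruth Γ.isVBGroupoid, ⟨S.isoSemidirect Γ.isVBGroupoid⟩⟩⟩

end

end LieGpd

theorem mainTheorem3 (G : LieGpd.LieGroupoid.{u}) :
    ∃ (hobj : ∀ R : LieGpd.Ruth G, R.semidirect.IsVBGroupoid)
      (hmap : ∀ (R R' : LieGpd.Ruth G) (T : LieGpd.RuthTriple R R'),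
        T.IsMorphism → T.semidirectMap.IsVBMap),
      (LieGpd.grothendieckFunctor G hobj hmap).IsEquivalence ∧
      (∀ (R R' : LieGpd.Ruth G) (T : LieGpd.RuthTriple R R'),
        T.IsMorphism ↔ T.semidirectMap.IsVBMap) ∧
      (∀ (R R' : LieGpd.Ruth G) (Ψ : LieGpd.VBMapData R.semidirect R'.semidirect), Ψ.IsVBMap →
        ∃! T : LieGpd.RuthTriple R R', T.IsMorphism ∧ T.semidirectMap = Ψ) := ⟨fun R => R.isVBGroupoid, fun _ _ _ hT => hT.isVBMap,
    LieGpd.isEquivalence_grothendieckFunctor G _ _,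
    fun _ _ _ => ⟨fun hT => hT.isVBMap, LieGpd.RuthTriple.isMorphism_of_isVBMap⟩,
    fun _ _ _ hΨ => LieGpd.RuthTriple.existsUnique_of_isVBMap hΨ⟩
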